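/- Let $w$ be a word of length $n\ge 1$ over the alphabet $\{0,\dots,\sigma-1\}$. The Parikh vector of a word counts the occurrences of each letter; for Parikh vectors, $\mathcal Q\subset\mathcal P$ means that $\mathcal Q\le\mathcal P$ componentwise and $\mathcal Q\ne\mathcal P$; and $|\mathcal P|$ is the sum of the components of $\mathcal P$. A word $u$ is \emph{periodic} with period $\mathcal P$ if $u=u_0u_1\cdots u_{k-1}u_k$ with $k\ge 3$, where $u_1,\dots,u_{k-1}$ have Parikh vector $\mathcal P$ and the Parikh vectors of the head $u_0$ and of the tail $u_k$ are $\subset\mathcal P$. A fragment $w[i..j]$ is an \emph{abelian run} with period $\mathcal P$ if it is periodic with period $\mathcal P$ and each of $w[i-1..j]$ and $w[i..j+1]$ either does not exist or is not periodic with period $\mathcal P$. To \emph{compute all abelian runs} of $w$ is to list every pair (fragment $w[i..j]$, period $\mathcal P$) such that $w[i..j]$ is an abelian run with period $\mathcal P$, each pair exactly once and nothing else, where such a pair is reported as $(i,h,t,j,p)$ with $p=|\mathcal P|$ and with $h,t$ the lengths of the head and of the tail of some factorization as above (so $\mathcal P$ is the Parikh vector of $w[i+h..i+h+p-1]$). The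 model of computation is the word RAM with words of $O(\log(n+\sigma))$ bits: arithmetic operations and comparisons of words, access to an array cell, and drawing a uniformly random word (in randomized programs) take one unit of time. The input consists of $n$, $\sigma$ and the letters of $w$; all other memory is initially $0$. \textbf{Theorem.} (a) For every $c\in\mathbb N$ there is a randomized (Monte Carlo) algorithm, with words of $O_c(\log(n+\sigma))$ bits, which on every word $w$ of length $n\ge1$ over an alphabet of cardinality $\sigma$ always halts within time $O_c(n^2)$ (the implied constants depend only on $c$), and which computes all abelian runs of $w$ with probability at least $1-\frac{1}{(n+\sigma)^c}$. (b) There is a deterministic algorithm which computes all abelian runs of every word $w$ of length $n\ge1$ over an alphabet of cardinality $\sigma$ in time $O(n^2\log\sigma)$ (for $\sigma=1$: in time $O(n^2)$); precisely, in time at most $C\,n^2\,(1+\lfloor\log_2\sigma\rfloor)$ with an absolute constant $C$. -/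

import Mathlib

namespace AbelianRuns

/-! ### Words, Parikh vectors, abelian periods and abelian runs -/

section Words

variable {σ : ℕ}

/-- The Parikh vector of a word over the alphabet `{0, …, σ - 1}`: the number of occurrences of
each letter. -/
def parikh (u : List (Fin σ)) : Fin σ → ℕ := fun a => u.count a

/-- The norm of a Parikh vector: the sum of its components. -/
def norm (P : Fin σ → ℕ) : ℕ := ∑ a, P a

/-- `u = head · cores[0] ⋯ cores[l-1] · tail` is a periodic factorization of `u` with respect
to `P`: every core has Parikh vector `P`, and the Parikh vectors of the head and of the tail are
properly contained in `P` (componentwise `≤`, and different from `P`). -/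
structure IsPeriodicFactorization (P : Fin σ → ℕ) (u : List (Fin σ))
    (head : List (Fin σ)) (cores : List (List (Fin σ))) (tail : List (Fin σ)) : Prop where
  eq_append : u = head ++ cores.flatten ++ tail
  parikh_core : ∀ v ∈ cores, parikh v = P
  head_lt : parikh head < P
  tail_lt : parikh tail < P

/-- `u` is periodic with (abelian) period `P`: it has a periodic factorization with respect to
`P` that has at least two cores. -/
def IsPeriodic (P : Fin σ → ℕ) (u : List (Fin σ)) : Prop :=
  ∃ head cores tail, IsPeriodicFactorization P u head cores tail ∧ 2 ≤ cores.length

/-- The fragment `w[i..j]`, both ends included (positions start at `0`). -/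
def frag (w : List (Fin σ)) (i j : ℕ) : List (Fin σ) := (w.take (j + 1)).drop i

/-- The fragment `w[i..j]` is an abelian run with period `P`: it is periodic with period `P`, and
each of `w[i-1..j]` and `w[i..j+1]` either does not exist or is not periodic with period `P`. -/
structure IsAbelianRun (w : List (Fin σ)) (P : Fin σ → ℕ) (i j : ℕ) : Prop where
  le : i ≤ j
  lt_length : j < w.length
  periodic : IsPeriodic P (frag w i j)
  left_maximal : ∀ i', i' + 1 = i → ¬ IsPeriodic P (frag w i' j)
  right_maximal : j + 1 < w.length → ¬ IsPeriodic P (frag w i (j + 1))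

/-- The data by which an abelian run `w[i..j]` is reported: the numbers `i, h, t, j`, where `h` and
`t` are the lengths of the head and of the tail of a factorization, and the norm `p` of the period.
The period is then the Parikh vector of `w[i+h..i+h+p-1]`. -/
structure RunTuple where
  i : ℕ
  h : ℕ
  t : ℕ
  j : ℕ
  p : ℕ

/-- The five words that are written for one reported run. -/
def RunTuple.words (τ : RunTuple) : List ℕ := [τ.i, τ.h, τ.t, τ.j, τ.p]

/-- `τ` represents the abelian run `w[i..j]` with period `P`: it consists of `i`, `j`, the
norm of `P`, and the head length and the tail length of some periodic factorization of `w[i..j]`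
with respect to `P` that has at least two cores. -/
def RunTuple.Represents (τ : RunTuple) (w : List (Fin σ)) (P : Fin σ → ℕ) (i j : ℕ) : Prop :=
  IsAbelianRun w P i j ∧ τ.i = i ∧ τ.j = j ∧ τ.p = norm P ∧
    ∃ head cores tail, IsPeriodicFactorization P (frag w i j) head cores tail ∧
      2 ≤ cores.length ∧ τ.h = head.length ∧ τ.t = tail.length

/-- The sequence of words `out` lists all abelian runs of `w` (with all periods), each run exactly
once, and nothing else. -/
def ListsAllAbelianRuns (w : List (Fin σ)) (out : List ℕ) : Prop :=
  ∃ L : List RunTuple, out = L.flatMap RunTuple.words ∧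
    (∀ τ ∈ L, ∃ P i j, τ.Represents w P i j) ∧
    ∀ P i j, IsAbelianRun w P i j → ∃! m : Fin L.length, (L.get m).Represents w P i j

end Words

/-! ### The word RAM

Programs work on words, that is, on natural numbers below a modulus `W` (a power of two). There
are registers, and arrays that are indexed by words; a program text mentions finitely many of
either. Each elementary operation takes one unit of time. A random word can be drawn in one unit
of time. -/

/-- The elementary word operations. -/
inductive BinOp
  | add | sub | mul | div | mod | lt | eq

/-- Addition and multiplication are modulo `W`, subtraction is cut off at `0`, division is
Euclidean, with `x / 0 = 0` and `x % 0 = x`, and a comparison gives `1` if it is true and `0`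
otherwise. -/
def BinOp.eval (W : ℕ) : BinOp → ℕ → ℕ → ℕ
  | .add, x, y => (x + y) % W
  | .sub, x, y => x - y
  | .mul, x, y => (x * y) % W
  | .div, x, y => x / y
  | .mod, x, y => x % y
  | .lt, x, y => if x < y then 1 else 0
  | .eq, x, y => if x = y then 1 else 0

/-- A state: the registers, the arrays (`arr a k` is the cell with index `k` of the array `a`), the
random words that have not been drawn yet, and the words that have been output so far. -/
structure State where
  reg : ℕ → ℕ
  arr : ℕ → ℕ → ℕ
  tape : List ℕ
  out : List ℕ

/-- Expressions: constants, registers, reading an array cell, and elementary operations. -/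
inductive RExpr
  | const (v : ℕ)
  | reg (x : ℕ)
  | read (a : ℕ) (e : RExpr)
  | op (o : BinOp) (e₁ e₂ : RExpr)

/-- The value of an expression. -/
def RExpr.eval (W : ℕ) (s : State) : RExpr → ℕ
  | .const v => v % W
  | .reg x => s.reg x
  | .read a e => s.arr a (e.eval W s)
  | .op o e₁ e₂ => o.eval W (e₁.eval W s) (e₂.eval W s)

/-- The time for the evaluation of an expression: one unit for each of its nodes. -/
def RExpr.cost : RExpr → ℕ
  | .const _ => 1
  | .reg _ => 1
  | .read _ e => 1 + e.cost
  | .op _ e₁ e₂ => 1 + e₁.cost + e₂.cost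

/-- Programs. -/
inductive Cmd
  | skip
  | assign (x : ℕ) (e : RExpr)
  | store (a : ℕ) (idx e : RExpr)
  | draw (x : ℕ)
  | emit (e : RExpr)
  | seq (c₁ c₂ : Cmd)
  | branch (e : RExpr) (c₁ c₂ : Cmd)
  | loop (e : RExpr) (c : Cmd)

/-- A program is deterministic if it does not contain the instruction that draws a random word. -/
def Cmd.IsDeterministic : Cmd → Prop
  | .skip => True
  | .assign _ _ => True
  | .store _ _ _ => True
  | .draw _ => False
  | .emit _ => True
  | .seq c₁ c₂ => c₁.IsDeterministic ∧ c₂.IsDeterministic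
  | .branch _ c₁ c₂ => c₁.IsDeterministic ∧ c₂.IsDeterministic
  | .loop _ c => c.IsDeterministic

/-- Writing `v` to the register `x`. -/
def State.setReg (s : State) (x v : ℕ) : State :=
  { s with reg := fun y => if y = x then v else s.reg y }

/-- Writing `v` to the cell with index `k` of the array `a`. -/
def State.setArr (s : State) (a k v : ℕ) : State :=
  { s with arr := fun b l => if b = a ∧ l = k then v else s.arr b l }

/-- `Exec W c s t s'`: with words below `W`, the program `c` started in the state `s` halts in the
state `s'` after exactly `t` units of time. -/
inductive Exec (W : ℕ) : Cmd → State → ℕ → State → Prop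
  | skip (s : State) : Exec W .skip s 1 s
  | assign (s : State) (x : ℕ) (e : RExpr) :
      Exec W (.assign x e) s (1 + e.cost) (s.setReg x (e.eval W s))
  | store (s : State) (a : ℕ) (idx e : RExpr) :
      Exec W (.store a idx e) s (1 + idx.cost + e.cost) (s.setArr a (idx.eval W s) (e.eval W s))
  | draw (s : State) (x v : ℕ) (rest : List ℕ) (h : s.tape = v :: rest) :
      Exec W (.draw x) s 1 { s.setReg x v with tape := rest }
  | emit (s : State) (e : RExpr) :
      Exec W (.emit e) s (1 + e.cost) { s with out := s.out ++ [e.eval W s] }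
  | seq {c₁ c₂ : Cmd} {s s₁ s₂ : State} {t₁ t₂ : ℕ}
      (h₁ : Exec W c₁ s t₁ s₁) (h₂ : Exec W c₂ s₁ t₂ s₂) : Exec W (.seq c₁ c₂) s (t₁ + t₂) s₂
  | branch_true {e : RExpr} {c₁ c₂ : Cmd} {s s₁ : State} {t : ℕ} (he : e.eval W s ≠ 0)
      (h : Exec W c₁ s t s₁) : Exec W (.branch e c₁ c₂) s (1 + e.cost + t) s₁
  | branch_false {e : RExpr} {c₁ c₂ : Cmd} {s s₁ : State} {t : ℕ} (he : e.eval W s = 0)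
      (h : Exec W c₂ s t s₁) : Exec W (.branch e c₁ c₂) s (1 + e.cost + t) s₁
  | loop_false {e : RExpr} {c : Cmd} {s : State} (he : e.eval W s = 0) :
      Exec W (.loop e c) s (1 + e.cost) s
  | loop_true {e : RExpr} {c : Cmd} {s s₁ s₂ : State} {t₁ t₂ : ℕ} (he : e.eval W s ≠ 0)
      (h₁ : Exec W c s t₁ s₁) (h₂ : Exec W (.loop e c) s₁ t₂ s₂) :
      Exec W (.loop e c) s (1 + e.cost + t₁ + t₂) s₂

/-- The initial state on the input `w`, a word over an alphabet of `σ` letters: register `0` holds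
the length of `w`, register `1` holds `σ`, array `0` holds the letters of `w`, everything else
is `0`. -/
def inputState {σ : ℕ} (w : List (Fin σ)) (tape : List ℕ) : State where
  reg := fun x => if x = 0 then w.length else if x = 1 then σ else 0
  arr := fun a k => if a = 0 then (w.map Fin.val).getD k 0 else 0
  tape := tape
  out := []

/-- The number of words of a machine whose words have `K * Nat.size (n + σ)` bits, where
`Nat.size (n + σ)` is the length of the binary expansion of `n + σ`. -/
def wordCount (K n σ : ℕ) : ℕ := 2 ^ (K * Nat.size (n + σ))

/-- The probability of the event `E` if `T` words are drawn independently and uniformly from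
`{0, …, W - 1}`. -/
noncomputable def tapeProb (T W : ℕ) (E : (Fin T → Fin W) → Prop) : ℝ :=
  (Nat.card {ω : Fin T → Fin W // E ω} : ℝ) / (Nat.card (Fin T → Fin W) : ℝ)

/-- The random tape with the words `ω 0, …, ω (T - 1)`. -/
def tapeOf {T W : ℕ} (ω : Fin T → Fin W) : List ℕ := List.ofFn fun m => (ω m : ℕ)

/-- With words of `K * Nat.size (n + σ)` bits and time bound `T`, the randomized program `prog`, on
the input `w` of length `n`, always halts within time `T`, and with probability at least `q`
it then has listed all abelian runs of `w`. (As each draw takes one unit of time, a tape of `T`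
random words is never exhausted within time `T`.) -/
def RandomizedSolves (prog : Cmd) (K T : ℕ) (q : ℝ) {σ : ℕ} (w : List (Fin σ)) : Prop :=
  (∀ ω : Fin T → Fin (wordCount K w.length σ), ∃ t s',
    Exec (wordCount K w.length σ) prog (inputState w (tapeOf ω)) t s' ∧ t ≤ T) ∧
  q ≤ tapeProb T (wordCount K w.length σ) fun ω => ∃ t s',
    Exec (wordCount K w.length σ) prog (inputState w (tapeOf ω)) t s' ∧
      ListsAllAbelianRuns w s'.out

/-- With words of `K * Nat.size (n + σ)` bits, the deterministic program `prog`, on the input `w`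
of length `n`, halts within time `T`, and it then has listed all abelian runs of `w`. -/
def DeterministicSolves (prog : Cmd) (K T : ℕ) {σ : ℕ} (w : List (Fin σ)) : Prop :=
  prog.IsDeterministic ∧ ∃ t s',
    Exec (wordCount K w.length σ) prog (inputState w []) t s' ∧ t ≤ T ∧
      ListsAllAbelianRuns w s'.out

end AbelianRuns

/-! Fix a Parikh vector `P` of positive norm `p`. A chain is a maximal sequence of at least two
consecutive fragments of length `p` with Parikh vector `P`. Adding the longest head and the longest
tail whose vectors are contained in `P` gives its fragment, which occupies the positions `lo, …, hi
- 1`. Every periodic fragment with period `P` lies inside the fragment of some chain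
(`PerAt.exists_isFirst`), and a part of that fragment that keeps two consecutive cores is periodic
(`Chain.perAt_of_subset`). If the fragment of one chain contains that of another, everything in
between is periodic as well (`Chain.perAt_between`). Hence maximality under extension by one letter,
which defines runs, agrees with maximality under inclusion among the fragments of chains.

Several chains with the same `P` can have the same fragment, so each run is charged to the leftmost
of them. As `lo` is monotone in the start of the chain (`Chain.L_mono`), these chains are recognized
by two conditions: `hi` exceeds the `hi` of all earlier chains for `P` (`IsRec`), and no later chain
with this property has the same `lo` (`IsRep`). For each `p`, a pass to the right that remembers the
largest `hi` per Parikh vector and a pass to the left that remembers the last `lo` per Parikh vector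
decide both.

The lengths of all tails take quadratic time: for a fixed end `e` of the cores, the longest tail
grows with `p`, so two pointers suffice, and an array of differences of letter counts decides
whether the tail can grow. The right end of a chain follows from the one that is computed for `e +
p`. Heads are tails of the reversed word. Rows of tables are never cleared, because memory is
initially zero and each row has cells of its own; so none of this costs time depending on `σ`.

It remains to recognize equal Parikh vectors in constant time, by identifiers. Correctness needs the
identifiers to be `Faithful`; the time bounds do not, so the randomized program halts in time on
every tape. In the randomized program each letter that occurs gets a random weight modulo the number
`W` of words, and a fragment is identified by the sum of its weights. Two different vectors differ
in some letter by `d` with `0 < d ≤ n`, and a congruence `d * x ≡ const` modulo `W` has at most `d`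
solutions below `W`. So a collision has probability at most `n / W`, and a union bound over pairs of
fragments finishes part (a).

In the deterministic program the vector is stored at the leaves of a binary tree of depth about `log
σ`. Inner nodes are named by the pair of names of their children, through one global table that
assigns fresh names. Appending a letter renames only the path from one leaf to the root, and two
vectors are equal if and only if their roots have the same name (`TreeOk.eq_of_root_eq`,
`TreeOk.root_eq`). -/

namespace AbelianRuns

/-! ### Weakest preconditions with running time, and evaluation of expressions. -/

section Programs

/-- With words below `W`, the program `c` started in the state `s` at the time `τ` halts, and the
final state and the time at which it halts satisfy `Q`. -/
def WP (W : ℕ) (c : Cmd) (Q : State → ℕ → Prop) (s : State) (τ : ℕ) : Prop :=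
  ∃ t s', Exec W c s t s' ∧ Q s' (τ + t)

/-- The commands of a list, one after the other. -/
def block : List Cmd → Cmd
  | [] => .skip
  | c :: cs => .seq c (block cs)

variable {W : ℕ} {Q : State → ℕ → Prop} {s : State} {τ : ℕ}

theorem WP.mono {c : Cmd} {Q' : State → ℕ → Prop} (h : WP W c Q s τ)
    (hQ : ∀ s τ, Q s τ → Q' s τ) : WP W c Q' s τ := by
  obtain ⟨t, s', h1, h2⟩ := h
  exact ⟨t, s', h1, hQ _ _ h2⟩

theorem wp_skip : WP W .skip Q s τ ↔ Q s (τ + 1) := by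
  constructor
  · rintro ⟨_, _, ⟨⟩, h⟩; exact h
  · exact fun h => ⟨_, _, .skip s, h⟩

theorem wp_assign {x : ℕ} {e : RExpr} :
    WP W (.assign x e) Q s τ ↔ Q (s.setReg x (e.eval W s)) (τ + (1 + e.cost)) := by
  constructor
  · rintro ⟨_, _, ⟨⟩, h⟩; exact h
  · exact fun h => ⟨_, _, .assign s x e, h⟩

theorem wp_store {a : ℕ} {i e : RExpr} :
    WP W (.store a i e) Q s τ ↔
      Q (s.setArr a (i.eval W s) (e.eval W s)) (τ + (1 + i.cost + e.cost)) := by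
  constructor
  · rintro ⟨_, _, ⟨⟩, h⟩; exact h
  · exact fun h => ⟨_, _, .store s a i e, h⟩

theorem wp_emit {e : RExpr} :
    WP W (.emit e) Q s τ ↔ Q { s with out := s.out ++ [e.eval W s] } (τ + (1 + e.cost)) := by
  constructor
  · rintro ⟨_, _, ⟨⟩, h⟩; exact h
  · exact fun h => ⟨_, _, .emit s e, h⟩

theorem wp_draw {x v : ℕ} {rest : List ℕ} (ht : s.tape = v :: rest) :
    WP W (.draw x) Q s τ ↔ Q { s.setReg x v with tape := rest } (τ + 1) := by
  constructor
  · rintro ⟨_, _, h, hQ⟩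
    cases h with
    | draw _ _ v' rest' h =>
      rw [ht] at h
      obtain ⟨rfl, rfl⟩ := List.cons.inj h
      exact hQ
  · exact fun h => ⟨_, _, .draw s x v rest ht, h⟩

theorem wp_seq {c₁ c₂ : Cmd} :
    WP W (.seq c₁ c₂) Q s τ ↔ WP W c₁ (WP W c₂ Q) s τ := by
  constructor
  · rintro ⟨_, _, h, hQ⟩
    cases h with
    | seq h₁ h₂ => exact ⟨_, _, h₁, _, _, h₂, by rwa [add_assoc]⟩
  · rintro ⟨t₁, s₁, h₁, t₂, s₂, h₂, hQ⟩
    exact ⟨_, _, .seq h₁ h₂, by rwa [← add_assoc]⟩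

theorem wp_branch {e : RExpr} {c₁ c₂ : Cmd} :
    WP W (.branch e c₁ c₂) Q s τ ↔
      if e.eval W s ≠ 0 then WP W c₁ Q s (τ + (1 + e.cost)) else WP W c₂ Q s (τ + (1 + e.cost)) := by
  constructor
  · rintro ⟨_, _, h, hQ⟩
    cases h with
    | branch_true he h => rw [if_pos he]; exact ⟨_, _, h, by rwa [add_assoc]⟩
    | branch_false he h => rw [if_neg (by simpa using he)]; exact ⟨_, _, h, by rwa [add_assoc]⟩
  · split_ifs with he
    · rintro ⟨t, s', h, hQ⟩
      exact ⟨_, _, .branch_true he h, by rwa [← add_assoc]⟩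
    · rintro ⟨t, s', h, hQ⟩
      exact ⟨_, _, .branch_false (by simpa using he) h, by rwa [← add_assoc]⟩

theorem wp_block_nil : WP W (block []) Q s τ ↔ Q s (τ + 1) := wp_skip

theorem wp_block_cons {c : Cmd} {cs : List Cmd} :
    WP W (block (c :: cs)) Q s τ ↔ WP W c (WP W (block cs) Q) s τ := wp_seq

/-- A loop with the invariant `Inv` and the measure `μ`, which decreases in each iteration. -/
theorem wp_loop {e : RExpr} {c : Cmd} (Inv : State → ℕ → Prop) (μ : State → ℕ)
    (start : Inv s τ)
    (step : ∀ s τ, Inv s τ → e.eval W s ≠ 0 →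
      WP W c (fun s' τ' => Inv s' τ' ∧ μ s' < μ s) s (τ + (1 + e.cost)))
    (exit : ∀ s τ, Inv s τ → e.eval W s = 0 → Q s (τ + (1 + e.cost))) :
    WP W (.loop e c) Q s τ := by
  induction h : μ s using Nat.strong_induction_on generalizing s τ with
  | _ d ih =>
    by_cases he : e.eval W s = 0
    · exact ⟨_, _, .loop_false he, exit _ _ start he⟩
    · obtain ⟨t₁, s₁, h₁, h₂, h₃⟩ := step _ _ start he
      obtain ⟨t₂, s₂, h₄, h₅⟩ := ih _ (h ▸ h₃) h₂ rfl
      exact ⟨_, _, .loop_true he h₁ h₄, by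
        rw [show τ + (1 + e.cost + t₁ + t₂) = τ + (1 + e.cost) + t₁ + t₂ by ring]; exact h₅⟩

@[simp] theorem setReg_reg (x v y : ℕ) :
    (s.setReg x v).reg y = if y = x then v else s.reg y := rfl
@[simp] theorem setReg_tape (x v : ℕ) : (s.setReg x v).tape = s.tape := rfl
@[simp] theorem setReg_arr (x v : ℕ) : (s.setReg x v).arr = s.arr := rfl
@[simp] theorem setReg_out (x v : ℕ) : (s.setReg x v).out = s.out := rfl
@[simp] theorem setArr_reg (a k v : ℕ) : (s.setArr a k v).reg = s.reg := rfl
@[simp] theorem setArr_arr (a k v b l : ℕ) :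
    (s.setArr a k v).arr b l = if b = a ∧ l = k then v else s.arr b l := rfl

/-- The sum of two expressions. -/
abbrev plus (e f : RExpr) : RExpr := .op .add e f
/-- The truncated difference of two expressions. -/
abbrev minus (e f : RExpr) : RExpr := .op .sub e f
/-- The product of two expressions. -/
abbrev times (e f : RExpr) : RExpr := .op .mul e f
/-- The comparison `e < f` of two expressions. -/
abbrev less (e f : RExpr) : RExpr := .op .lt e f
/-- The comparison `e = f` of two expressions. -/
abbrev same (e f : RExpr) : RExpr := .op .eq e f

theorem eval_plus {e f : RExpr} {x y : ℕ} (he : e.eval W s = x) (hf : f.eval W s = y)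
    (h : x + y < W) : (plus e f).eval W s = x + y := by
  simp [RExpr.eval, BinOp.eval, he, hf, Nat.mod_eq_of_lt h]

theorem eval_times {e f : RExpr} {x y : ℕ} (he : e.eval W s = x) (hf : f.eval W s = y)
    (h : x * y < W) : (times e f).eval W s = x * y := by
  simp [RExpr.eval, BinOp.eval, he, hf, Nat.mod_eq_of_lt h]

theorem eval_const {v : ℕ} (h : v < W) : (RExpr.const v).eval W s = v := Nat.mod_eq_of_lt h

theorem eval_reg {x v : ℕ} (h : s.reg x = v) : (RExpr.reg x).eval W s = v := h

theorem eval_less_ne_zero {e f : RExpr} :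
    (less e f).eval W s ≠ 0 ↔ e.eval W s < f.eval W s := by
  simp [RExpr.eval, BinOp.eval]

theorem eval_same_ne_zero {e f : RExpr} :
    (same e f).eval W s ≠ 0 ↔ e.eval W s = f.eval W s := by
  simp [RExpr.eval, BinOp.eval]

/-- Multiplication by a comparison serves as conjunction: since the first factor is at most `1`, the
product cannot wrap around to `0` modulo `W`. -/
theorem eval_times_ne_zero {e f : RExpr} (he : e.eval W s ≤ 1) (hf : f.eval W s < W) :
    (times e f).eval W s ≠ 0 ↔ e.eval W s ≠ 0 ∧ f.eval W s ≠ 0 := by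
  rcases (show e.eval W s = 0 ∨ e.eval W s = 1 by omega) with h | h <;>
    simp [RExpr.eval, BinOp.eval, h, Nat.mod_eq_of_lt hf]

theorem eval_less_le_one {e f : RExpr} : (less e f).eval W s ≤ 1 := by
  simp only [RExpr.eval, BinOp.eval]; split_ifs <;> simp

/-- The index of the cell in row `x` and column `y` of a table with `m` columns. -/
def cell (m x y : ℕ) : ℕ := x * m + y

theorem cell_inj {m x y x' y' : ℕ} (hy : y < m) (hy' : y' < m) :
    cell m x y = cell m x' y' ↔ x = x' ∧ y = y' := by
  refine ⟨fun h => ?_, fun ⟨h1, h2⟩ => by rw [h1, h2]⟩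
  have h1 := congrArg (· / m) h
  have h2 := congrArg (· % m) h
  have hm : 0 < m := by omega
  simp only [cell] at h1 h2
  rw [mul_comm x, mul_comm x', Nat.mul_add_div hm, Nat.mul_add_div hm, Nat.div_eq_of_lt hy,
    Nat.div_eq_of_lt hy'] at h1
  rw [mul_comm x, mul_comm x', Nat.mul_add_mod, Nat.mul_add_mod, Nat.mod_eq_of_lt hy,
    Nat.mod_eq_of_lt hy'] at h2
  exact ⟨by simpa using h1, h2⟩

theorem cell_lt {m x y N : ℕ} (hx : x < N) (hy : y < m) : cell m x y < N * m := by
  have : (x + 1) * m ≤ N * m := Nat.mul_le_mul_right m hx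
  rw [Nat.succ_mul] at this
  unfold cell; omega

/-- The expression for the index of a cell of a table. -/
def cellE (m e f : RExpr) : RExpr := plus (times e m) f

theorem eval_cellE {m e f : RExpr} {k x y : ℕ} (hm : m.eval W s = k) (he : e.eval W s = x)
    (hf : f.eval W s = y) (h : cell k x y < W) : (cellE m e f).eval W s = cell k x y := by
  unfold cell at h
  exact eval_plus (eval_times he hm (by omega)) hf h

theorem cost_cellE (m e f : RExpr) : (cellE m e f).cost = 2 + e.cost + m.cost + f.cost := by
  simp only [cellE, RExpr.cost]; ring

/-- The states `s₀` and `s` agree on the registers below `10` and on all arrays that are not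
in `A`. -/
structure Frame (A : List ℕ) (s₀ s : State) : Prop where
  reg : ∀ x < 10, s.reg x = s₀.reg x
  arr : ∀ a ∉ A, s.arr a = s₀.arr a

theorem Frame.refl (A : List ℕ) (s : State) : Frame A s s := ⟨fun _ _ => rfl, fun _ _ => rfl⟩

theorem Frame.trans {A : List ℕ} {s₀ s₁ s₂ : State} (h : Frame A s₀ s₁) (h' : Frame A s₁ s₂) :
    Frame A s₀ s₂ :=
  ⟨fun x hx => (h'.reg x hx).trans (h.reg x hx), fun a ha => (h'.arr a ha).trans (h.arr a ha)⟩

theorem Frame.setReg {A : List ℕ} {s₀ s : State} (h : Frame A s₀ s) {x : ℕ} (hx : 10 ≤ x) (v : ℕ) :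
    Frame A s₀ (s.setReg x v) :=
  ⟨fun y hy => by rw [setReg_reg, if_neg (by omega)]; exact h.reg y hy, h.arr⟩

theorem Frame.setArr {A : List ℕ} {s₀ s : State} (h : Frame A s₀ s) {a : ℕ} (ha : a ∈ A)
    (k v : ℕ) : Frame A s₀ (s.setArr a k v) :=
  ⟨h.reg, fun b hb => by
    funext l
    rw [setArr_arr, if_neg (by rintro ⟨rfl, -⟩; exact hb ha), h.arr b hb]⟩

end Programs

/-! ### Periodicity of fragments in terms of positions. -/

section Segments

variable {σ : ℕ}

/-- The fragment of `w` that occupies the positions `i, …, j - 1`. -/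
def seg (w : List (Fin σ)) (i j : ℕ) : List (Fin σ) := (w.take j).drop i

/-- The Parikh vector of the fragment at the positions `i, …, j - 1`. -/
def pk (w : List (Fin σ)) (i j : ℕ) : Fin σ → ℕ := parikh (seg w i j)

theorem length_seg (w : List (Fin σ)) {i j : ℕ} (hj : j ≤ w.length) :
    (seg w i j).length = j - i := by
  simp [seg, hj]

theorem seg_append_seg (w : List (Fin σ)) {i j k : ℕ} (hij : i ≤ j) (hjk : j ≤ k) :
    seg w i j ++ seg w j k = seg w i k := by
  unfold seg
  obtain ⟨d, rfl⟩ := Nat.exists_eq_add_of_le hij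
  have h1 : (w.take (i + d)).drop i = ((w.take k).drop i).take d := by
    rw [List.take_drop, List.take_take, min_eq_left hjk]
  have h2 : (w.take k).drop (i + d) = ((w.take k).drop i).drop d := by
    rw [List.drop_drop]
  rw [h1, h2, List.take_append_drop]

theorem parikh_append (u v : List (Fin σ)) : parikh (u ++ v) = parikh u + parikh v := by
  funext a; simp [parikh]

theorem pk_add (w : List (Fin σ)) {i j k : ℕ} (hij : i ≤ j) (hjk : j ≤ k) :
    pk w i j + pk w j k = pk w i k := by
  unfold pk
  rw [← parikh_append, seg_append_seg w hij hjk]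

theorem pk_self (w : List (Fin σ)) (i : ℕ) : pk w i i = 0 := by
  funext a
  have : seg w i i = [] := by simp [seg]
  simp [pk, this, parikh]

theorem pk_succ_apply (w : List (Fin σ)) {i j : ℕ} (hij : i ≤ j) (hj : j < w.length) (a : Fin σ) :
    pk w i (j + 1) a = pk w i j a + if w[j] = a then 1 else 0 := by
  rw [← pk_add w hij (Nat.le_succ j)]
  have : seg w j (j + 1) = [w[j]] := by
    unfold seg
    rw [← List.take_concat_get' _ _ hj, List.drop_append_of_le_length (by simp; omega)]
    simp
  simp [pk, this, parikh, List.count_singleton]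

theorem pk_pred_apply (w : List (Fin σ)) {i j : ℕ} (hij : i < j) (hj : j ≤ w.length) (a : Fin σ) :
    pk w i j a = pk w (i + 1) j a + if w[i] = a then 1 else 0 := by
  rw [← pk_add w (Nat.le_succ i) (show i + 1 ≤ j from hij)]
  have := pk_succ_apply w (le_refl i) (by omega : i < w.length) a
  rw [pk_self] at this
  simp only [Nat.succ_eq_add_one, Pi.add_apply, this, Pi.zero_apply]
  omega

theorem norm_parikh (u : List (Fin σ)) : norm (parikh u) = u.length := by
  unfold norm parikh
  simpa using Multiset.sum_count_eq_card (s := Finset.univ) (m := (u : Multiset (Fin σ))) (by simp)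

theorem norm_pk (w : List (Fin σ)) {i j : ℕ} (hj : j ≤ w.length) : norm (pk w i j) = j - i := by
  rw [pk, norm_parikh, length_seg w hj]

theorem norm_mono {P Q : Fin σ → ℕ} (h : P ≤ Q) : norm P ≤ norm Q :=
  Finset.sum_le_sum fun a _ => h a

theorem norm_lt_norm {P Q : Fin σ → ℕ} (h : P < Q) : norm P < norm Q := by
  obtain ⟨h1, a, ha⟩ := Pi.lt_def.1 h
  exact Finset.sum_lt_sum (fun a _ => h1 a) ⟨a, Finset.mem_univ _, ha⟩

theorem eq_of_le_of_norm_le {P Q : Fin σ → ℕ} (h : P ≤ Q) (hn : norm Q ≤ norm P) : P = Q := by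
  rcases h.eq_or_lt with h | h
  · exact h
  · exact absurd (norm_lt_norm h) (by omega)

theorem pk_mono (w : List (Fin σ)) {i i' j j' : ℕ} (hi : i' ≤ i) (hij : i ≤ j) (hj : j ≤ j') :
    pk w i j ≤ pk w i' j' := by
  rw [← pk_add w hi (hij.trans hj), ← pk_add w hij hj]
  intro a
  simp only [Pi.add_apply]
  omega

/-- A fragment with fewer than `norm P` letters cannot have vector `P` itself. Positivity of the
norm covers the degenerate case `j < i`, where the fragment is empty. -/
theorem pk_lt_of_le (w : List (Fin σ)) {i j : ℕ} {P : Fin σ → ℕ} (hj : j ≤ w.length)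
    (h : pk w i j ≤ P) (hn : j < i + norm P) (hP : 0 < norm P) : pk w i j < P := by
  refine lt_of_le_of_ne h fun he => ?_
  have := norm_pk w (i := i) hj
  rw [he] at this
  omega

/-- The fragment at the positions `i, …, k - 1` has a periodic factorization with respect to `P`
whose `m ≥ 2` cores start at the position `a`. -/
structure PerAt (w : List (Fin σ)) (P : Fin σ → ℕ) (i k a m : ℕ) : Prop where
  two : 2 ≤ m
  le_start : i ≤ a
  end_le : a + m * norm P ≤ k
  head : pk w i a < P
  tail : pk w (a + m * norm P) k < P
  core : ∀ r < m, pk w (a + r * norm P) (a + (r + 1) * norm P) = P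

theorem PerAt.norm_pos {w : List (Fin σ)} {P : Fin σ → ℕ} {i k a m : ℕ} (h : PerAt w P i k a m) :
    0 < norm P := lt_of_le_of_lt (Nat.zero_le _) (norm_lt_norm h.head)

theorem seg_eq_append (w : List (Fin σ)) {i k : ℕ} {u v : List (Fin σ)} (hk : k ≤ w.length)
    (hik : i ≤ k) (h : seg w i k = u ++ v) :
    i + u.length ≤ k ∧ seg w i (i + u.length) = u ∧ seg w (i + u.length) k = v := by
  have hl : k - i = u.length + v.length := by
    rw [← length_seg w (i := i) hk, h, List.length_append]
  have hle : i + u.length ≤ k := by omega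
  have h2 := seg_append_seg w (Nat.le_add_right i u.length) hle
  rw [h] at h2
  have h3 : (seg w i (i + u.length)).length = u.length := by
    rw [length_seg w (by omega)]; omega
  exact ⟨hle, List.append_inj h2 h3⟩

/-- Each core has length `norm P`, so the core boundaries form an arithmetic progression. This
replaces lists of cores by a start and a number of cores. -/
theorem seg_cores (w : List (Fin σ)) {P : Fin σ → ℕ} (cores : List (List (Fin σ))) :
    ∀ (a k : ℕ), k ≤ w.length → a ≤ k → seg w a k = cores.flatten →
      (∀ v ∈ cores, parikh v = P) → k = a + cores.length * norm P ∧
      ∀ r < cores.length, pk w (a + r * norm P) (a + (r + 1) * norm P) = P := by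
  induction cores with
  | nil =>
    intro a k hk hak h _
    have := length_seg w (i := a) hk
    rw [h] at this
    simp at this
    exact ⟨by simp; omega, by simp⟩
  | cons v cs ih =>
    intro a k hk hak h hP
    have hv : v.length = norm P := by rw [← norm_parikh, hP v (by simp)]
    obtain ⟨h1, h2, h3⟩ := seg_eq_append w hk hak (by simpa using h)
    obtain ⟨h4, h5⟩ := ih _ k hk h1 h3 fun v hv => hP v (by simp [hv])
    rw [hv] at h4 h5 h2
    refine ⟨by rw [h4, List.length_cons]; ring, fun r hr => ?_⟩
    rcases r with _ | r
    · simp [pk, h2, hP v (by simp)]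
    · have := h5 r (by simpa using hr)
      rw [show a + norm P + r * norm P = a + (r + 1) * norm P by ring,
        show a + norm P + (r + 1) * norm P = a + (r + 1 + 1) * norm P by ring] at this
      exact this

theorem perAt_of_factorization {w : List (Fin σ)} {P : Fin σ → ℕ} {i k : ℕ}
    {head tail : List (Fin σ)} {cores : List (List (Fin σ))} (hk : k ≤ w.length) (hik : i ≤ k)
    (h : IsPeriodicFactorization P (seg w i k) head cores tail) (h2 : 2 ≤ cores.length) :
    PerAt w P i k (i + head.length) cores.length ∧
      k = i + head.length + cores.length * norm P + tail.length := by
  have h0 := h.eq_append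
  rw [List.append_assoc] at h0
  obtain ⟨a1, a2, a3⟩ := seg_eq_append w hk hik h0
  obtain ⟨b1, b2, b3⟩ := seg_eq_append w hk a1 a3
  obtain ⟨c1, c2⟩ := seg_cores w cores _ _ (by omega) (by omega) b2 h.parikh_core
  rw [c1] at b1 b3
  refine ⟨⟨h2, by omega, b1, ?_, ?_, c2⟩, ?_⟩
  · rw [pk, a2]; exact h.head_lt
  · rw [pk, b3]; exact h.tail_lt
  · have := length_seg w (i := i + head.length + cores.length * norm P) hk
    rw [b3] at this
    omega

theorem PerAt.factorization {w : List (Fin σ)} {P : Fin σ → ℕ} {i k a m : ℕ}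
    (hk : k ≤ w.length) (h : PerAt w P i k a m) :
    ∃ head cores tail, IsPeriodicFactorization P (seg w i k) head cores tail ∧
      2 ≤ cores.length ∧ head.length = a - i ∧ tail.length = k - (a + m * norm P) := by
  have h1 := h.le_start
  have h2 := h.end_le
  refine ⟨seg w i a, (List.range m).map fun r => seg w (a + r * norm P) (a + (r + 1) * norm P),
    seg w (a + m * norm P) k, ⟨?_, ?_, h.head, h.tail⟩, by simpa using h.two,
    length_seg w (by omega), length_seg w hk⟩
  · have : ∀ m, ((List.range m).map fun r =>
        seg w (a + r * norm P) (a + (r + 1) * norm P)).flatten = seg w a (a + m * norm P) := by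
      intro m
      induction m with
      | zero => simp [seg]
      | succ m ih =>
        rw [List.range_succ, List.map_append, List.flatten_append, ih]
        simp only [List.map_cons, List.map_nil, List.flatten_cons, List.flatten_nil,
          List.append_nil]
        exact seg_append_seg w (by omega) (by nlinarith)
    rw [this, seg_append_seg w h1 (by omega), seg_append_seg w (by omega) h2]
  · simp only [List.mem_map, List.mem_range]
    rintro _ ⟨r, hr, rfl⟩
    exact h.core r hr

/-- With this, periodicity is a statement about positions only; lists of cores come back only when
tuples are compared with factorizations. -/
theorem isPeriodic_seg_iff {w : List (Fin σ)} {P : Fin σ → ℕ} {i k : ℕ} (hk : k ≤ w.length)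
    (hik : i ≤ k) : IsPeriodic P (seg w i k) ↔ ∃ a m, PerAt w P i k a m := by
  constructor
  · rintro ⟨head, cores, tail, h, h2⟩
    exact ⟨_, _, (perAt_of_factorization hk hik h h2).1⟩
  · rintro ⟨a, m, h⟩
    obtain ⟨head, cores, tail, h1, h2, -⟩ := h.factorization hk
    exact ⟨head, cores, tail, h1, h2⟩

end Segments

/-! ### Chains: maximal sequences of cores with their longest heads and tails. -/

section Chains

variable {σ : ℕ} {w : List (Fin σ)} {P : Fin σ → ℕ}

/-- A maximal sequence of `M ≥ 2` consecutive fragments with Parikh vector `P` starts at the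
position `s`, and `L, …, R - 1` are the positions of the longest fragment that has a factorization
with these cores. -/
structure Chain (w : List (Fin σ)) (P : Fin σ → ℕ) (s M L R : ℕ) : Prop where
  pos : 0 < norm P
  two : 2 ≤ M
  core : ∀ r < M, pk w (s + r * norm P) (s + (r + 1) * norm P) = P
  L_le : L ≤ s
  head : pk w L s ≤ P
  s_lt : s < L + norm P
  L_min : ∀ i ≤ s, pk w i s ≤ P → L ≤ i
  le_R : s + M * norm P ≤ R
  R_le : R ≤ w.length
  tail : pk w (s + M * norm P) R ≤ P
  R_lt : R < s + M * norm P + norm P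
  R_max : ∀ k ≤ w.length, s + M * norm P ≤ k → pk w (s + M * norm P) k ≤ P → k ≤ R

namespace Chain

variable {s s' M M' L L' R R' : ℕ}

theorem perAt (A : Chain w P s M L R) : PerAt w P L R s M where
  two := A.two
  le_start := A.L_le
  end_le := A.le_R
  head := pk_lt_of_le w (by have := A.le_R; have := A.R_le; omega) A.head A.s_lt A.pos
  tail := pk_lt_of_le w A.R_le A.tail A.R_lt A.pos
  core := A.core

/-- The fragment still contains the cores `q` and `q + 1`. Cut it at the first and the last core
boundary that it contains: what remains on either side is part of a neighbouring core or of the head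
or tail of the chain, and is shorter than a core. -/
theorem perAt_of_subset (A : Chain w P s M L R) {i k q : ℕ} (hL : L ≤ i) (hR : k ≤ R)
    (hi : i ≤ s + q * norm P) (hk : s + (q + 2) * norm P ≤ k) : ∃ a m, PerAt w P i k a m := by
  obtain ⟨p, hp⟩ : ∃ p, norm P = p := ⟨_, rfl⟩
  have hpos := A.pos
  have hRl := A.R_le
  have hRlt := A.R_lt
  have core := A.core
  have hs := A.s_lt
  have tail := A.tail
  simp only [hp] at hpos hRlt core hs tail hi hk
  have hkn : k ≤ w.length := hR.trans hRl
  have hqM : q + 2 < M + 1 := by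
    -- Beyond the last core less than one core length is left before `R`, so the two cores that fit
    -- into the fragment are cores of the chain.
    by_contra hc
    have : (M + 1) * p ≤ (q + 2) * p := Nat.mul_le_mul_right p (by omega)
    rw [Nat.succ_mul] at this
    omega
  classical
  have hex : ∃ q, i ≤ s + q * p := ⟨q, hi⟩
  obtain ⟨q0, hq0, hq0min⟩ : ∃ q0, i ≤ s + q0 * p ∧ ∀ q' < q0, ¬ i ≤ s + q' * p :=
    ⟨Nat.find hex, Nat.find_spec hex, fun q' h => Nat.find_min hex h⟩
  have hq0q : q0 ≤ q := by
    by_contra hc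
    exact hq0min q (by omega) hi
  have hsk : s ≤ k := le_trans (Nat.le_add_right _ _) hk
  -- `r` is the index of the last core boundary at or before `k`, and `q0` is the index of the first
  -- one at or after `i`.
  set r := min M ((k - s) / p) with hr
  have hrk : s + r * p ≤ k := by
    have : r * p ≤ (k - s) / p * p := Nat.mul_le_mul_right p (min_le_right _ _)
    have := Nat.div_mul_le_self (k - s) p
    omega
  have hqr : q + 2 ≤ r := by
    refine le_min (by omega) ((Nat.le_div_iff_mul_le hpos).2 ?_)
    omega
  have hlast : k < s + r * p + p := by
    rcases min_choice M ((k - s) / p) with h | h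
    · rw [hr, h]; omega
    · rw [hr, h]
      have := Nat.lt_div_mul_add (a := k - s) hpos
      omega
  refine ⟨s + q0 * p, r - q0, ⟨by omega, hq0, ?_, ?_, ?_, ?_⟩⟩
  · rw [hp, add_assoc, ← add_mul, show q0 + (r - q0) = r by omega]; exact hrk
  · have hq0M : q0 * p ≤ r * p := Nat.mul_le_mul_right p (by omega)
    have hlen : s + q0 * p < i + p := by
      rcases q0 with _ | q1
      · simp; omega
      · have := hq0min q1 (by omega)
        rw [Nat.succ_mul]; omega
    refine pk_lt_of_le w (by omega) ?_ (by rw [hp]; exact hlen) (by omega)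
    rcases q0 with _ | q1
    · simp only [zero_mul, add_zero] at hq0 ⊢
      exact (pk_mono w hL hq0 le_rfl).trans A.head
    · rw [← core q1 (by omega)]
      exact pk_mono w (by have := hq0min q1 (by omega); omega) hq0 le_rfl
  · rw [hp, add_assoc s, ← add_mul, show q0 + (r - q0) = r by omega]
    refine pk_lt_of_le w hkn ?_ (by rw [hp]; exact hlast) (by omega)
    rcases (show r ≤ M from min_le_left _ _).eq_or_lt with h | h
    · rw [h] at hrk ⊢
      exact (pk_mono w le_rfl hrk hR).trans tail
    · rw [← core r h]
      exact pk_mono w le_rfl hrk (by rw [Nat.succ_mul]; omega)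
  · intro t ht
    have := core (q0 + t) (by have : r ≤ M := min_le_left _ _; omega)
    rw [hp, ← this]
    congr 1 <;> ring

/-- Chains with the same Parikh vector that start further to the right extend less to the left. -/
theorem L_mono (A : Chain w P s M L R) (B : Chain w P s' M' L' R') (h : s ≤ s') : L ≤ L' := by
  rcases le_total L' s with h1 | h1
  · exact A.L_min _ h1 ((pk_mono w le_rfl h1 h).trans B.head)
  · exact A.L_le.trans h1

/-- Any fragment between the fragment of a chain and the fragment of another chain with the same
Parikh vector is periodic. -/
theorem perAt_between (A : Chain w P s M L R) (B : Chain w P s' M' L' R') {i k : ℕ}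
    (h1 : L' ≤ i) (h2 : i ≤ L) (h3 : R ≤ k) (h4 : k ≤ R') : ∃ a m, PerAt w P i k a m := by
  obtain ⟨p, hp⟩ : ∃ p, norm P = p := ⟨_, rfl⟩
  have hpos := A.pos
  have hRl := B.R_le
  have hRlt := B.R_lt
  have coreA := A.core
  have coreB := B.core
  have hs := B.s_lt
  have tail := A.tail
  have hAR := A.le_R
  have hAR1 := A.R_lt
  have hA2 := A.two
  have hAs := A.L_le
  have hAs1 := A.s_lt
  have hM2 : 2 * p ≤ M * p := Nat.mul_le_mul_right p hA2
  have hBs := B.L_le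
  simp only [hp] at hpos hRlt coreA coreB hs tail hAR hAR1 hAs1
  classical
  have hex : ∃ q, i ≤ s' + q * p := ⟨i, by nlinarith⟩
  -- The first core boundary of `B` at or after `i`. If two cores of `B` follow it before `k`, they
  -- make the fragment periodic; otherwise the maximality of the head or of the tail of `A` is
  -- violated.
  obtain ⟨q, hq, hqmin⟩ : ∃ q, i ≤ s' + q * p ∧ ∀ q' < q, ¬ i ≤ s' + q' * p :=
    ⟨Nat.find hex, Nat.find_spec hex, fun q' h => Nat.find_min hex h⟩
  have hqlt : s' + q * p < i + p := by
    rcases q with _ | q1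
    · simp; omega
    · have := hqmin q1 (by omega)
      rw [Nat.succ_mul]; omega
  by_cases hbk : s' + (q + 2) * p ≤ k
  · exact B.perAt_of_subset (q := q) h1 h4 (by rw [hp]; exact hq) (by rw [hp]; exact hbk)
  exfalso
  have e2 : (q + 2) * p = q * p + 2 * p := by ring
  -- The boundary is less than `p` after `i ≤ s`, and `k` is at least `s + 2 * p`. So more than one
  -- core length lies between the boundary and `k ≤ R'`, too much for a tail of `B`.
  have hqM : q + 1 ≤ M' := by
    by_contra hc
    have : (M') * p ≤ q * p := Nat.mul_le_mul_right p (by omega)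
    omega
  by_cases hqM2 : q + 2 ≤ M'
  · have w1 := coreA 0 (by omega)
    have w2 := coreA 1 (by omega)
    have w3 := coreB q (by omega)
    have w4 := coreB (q + 1) (by omega)
    have e1 : (q + 1) * p = q * p + p := by ring
    have e3 : (q + 1 + 1) * p = q * p + 2 * p := by ring
    simp only [e1, e3, zero_add, one_mul, zero_mul, add_zero, show (1 + 1) * p = 2 * p by ring]
      at w1 w2 w3 w4
    set b := s' + q * p with hb
    rw [← add_assoc] at w3 w4
    rw [← add_assoc] at w4
    rw [← hb] at w3 w4
    have hle : R < b + 2 * p := by omega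
    refine absurd hle (not_lt.2 ?_)
    -- Core `q + 1` of `B` ends after `R`. If `A` has just two cores, the tail of `A` can be
    -- prolonged to the end of that core, since it then stays inside it; if `A` has three cores,
    -- these already reach beyond that end.
    rcases hA2.eq_or_lt with h | h
    · subst h
      refine A.R_max _ ?_ (by rw [hp]; omega) ?_
      · have : (q + 2) * p ≤ M' * p := Nat.mul_le_mul_right p hqM2
        have := B.le_R
        rw [hp] at this
        omega
      · rw [hp]
        rw [← w4]
        exact pk_mono w (by omega) (by omega) le_rfl
    · have : 3 * p ≤ M * p := Nat.mul_le_mul_right p h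
      omega
  -- Now `q` is the last core of `B`, so `R'`, and hence `s + 2 * p`, lies less than two core
  -- lengths after the boundary. Thus `s` is before that boundary, and the head of `A` can be
  -- prolonged to the start of the preceding core of `B`, which is before `i ≤ L`.
  · have hM' : M' = q + 1 := by omega
    have hB2 := B.two
    obtain ⟨q1, rfl⟩ : ∃ q1, q = q1 + 1 := ⟨q - 1, by omega⟩
    have hi := hqmin q1 (by omega)
    have w1 := coreB q1 (by omega)
    have e1 : (q1 + 1) * p = q1 * p + p := by ring
    have : pk w (s' + q1 * p) s ≤ P := by
      have w2 := coreA 0 (by omega)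
      have : pk w (s' + q1 * p) s ≤ pk w (s' + q1 * p) (s' + (q1 + 1) * p) :=
        pk_mono w le_rfl (by omega) (by omega)
      rwa [w1] at this
    have := A.L_min _ (by omega) this
    omega

end Chain

end Chains

/-! ### Lengths of heads and tails, and the chains that represent runs. -/

section Runs

variable {σ : ℕ}

open Classical in
/-- The length of the longest fragment that starts at the position `e` and whose Parikh vector is
contained in the one of the `p` letters before the position `e`. -/
noncomputable def tailLen (w : List (Fin σ)) (e p : ℕ) : ℕ :=
  Nat.findGreatest (fun t => e + t ≤ w.length ∧ pk w e (e + t) ≤ pk w (e - p) e) w.length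

open Classical in
/-- The length of the longest fragment that ends before the position `s` and whose Parikh vector is
contained in the one of the `p` letters from the position `s` on. -/
noncomputable def headLen (w : List (Fin σ)) (s p : ℕ) : ℕ :=
  Nat.findGreatest (fun h => h ≤ s ∧ pk w (s - h) s ≤ pk w s (s + p)) w.length

theorem tailLen_spec (w : List (Fin σ)) {e : ℕ} (he : e ≤ w.length) (p : ℕ) :
    e + tailLen w e p ≤ w.length ∧ pk w e (e + tailLen w e p) ≤ pk w (e - p) e := by
  classical
  have := @Nat.findGreatest_spec 0
    (fun t => e + t ≤ w.length ∧ pk w e (e + t) ≤ pk w (e - p) e) _ w.length (Nat.zero_le _)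
    ⟨he, by rw [add_zero, pk_self]; exact fun a => Nat.zero_le _⟩
  unfold tailLen
  convert this

theorem le_tailLen {w : List (Fin σ)} {e p t : ℕ} (h1 : e + t ≤ w.length)
    (h2 : pk w e (e + t) ≤ pk w (e - p) e) : t ≤ tailLen w e p := by
  classical
  unfold tailLen
  exact Nat.le_findGreatest (by omega) ⟨h1, h2⟩

theorem headLen_spec (w : List (Fin σ)) (s p : ℕ) :
    headLen w s p ≤ s ∧ pk w (s - headLen w s p) s ≤ pk w s (s + p) := by
  classical
  have := @Nat.findGreatest_spec 0
    (fun h => h ≤ s ∧ pk w (s - h) s ≤ pk w s (s + p)) _ w.length (Nat.zero_le _)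
    ⟨Nat.zero_le _, by rw [Nat.sub_zero, pk_self]; exact fun a => Nat.zero_le _⟩
  unfold headLen
  convert this

theorem le_headLen {w : List (Fin σ)} {s p h : ℕ} (hs : s ≤ w.length) (h1 : h ≤ s)
    (h2 : pk w (s - h) s ≤ pk w s (s + p)) : h ≤ headLen w s p := by
  classical
  unfold headLen
  exact Nat.le_findGreatest (by omega) ⟨h1, h2⟩

/-- Containment passes to shorter fragments, so the greedy extension may stop at the first letter
that fails. -/
theorem eq_tailLen {w : List (Fin σ)} {e p t : ℕ} (h1 : e + t ≤ w.length)
    (h2 : pk w e (e + t) ≤ pk w (e - p) e)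
    (h3 : e + t < w.length → ¬ pk w e (e + t + 1) ≤ pk w (e - p) e) : t = tailLen w e p := by
  refine le_antisymm (le_tailLen h1 h2) (not_lt.1 fun hlt => ?_)
  obtain ⟨h4, h5⟩ := tailLen_spec w (by omega : e ≤ w.length) p
  exact h3 (by omega) ((pk_mono w le_rfl (by omega) (by omega)).trans h5)

theorem tailLen_le (w : List (Fin σ)) {e p : ℕ} (he : e ≤ w.length) : tailLen w e p ≤ p := by
  obtain ⟨h1, h2⟩ := tailLen_spec w he p
  have := norm_mono h2
  rw [norm_pk w h1, norm_pk w he] at this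
  omega

theorem headLen_le (w : List (Fin σ)) {s p : ℕ} (hs : s + p ≤ w.length) : headLen w s p ≤ p := by
  obtain ⟨h1, h2⟩ := headLen_spec w s p
  have := norm_mono h2
  rw [norm_pk w (by omega), norm_pk w hs] at this
  omega

/-- Containment between vectors of equal norm is equality: a tail of full length is another core. -/
theorem tailLen_eq_iff {w : List (Fin σ)} {e p : ℕ} (hp : p ≤ e) (he : e ≤ w.length) :
    tailLen w e p = p ↔ e + p ≤ w.length ∧ pk w e (e + p) = pk w (e - p) e := by
  constructor
  · intro h
    obtain ⟨h1, h2⟩ := tailLen_spec w he p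
    rw [h] at h1 h2
    exact ⟨h1, eq_of_le_of_norm_le h2 (by rw [norm_pk w h1, norm_pk w he]; omega)⟩
  · rintro ⟨h1, h2⟩
    exact le_antisymm (tailLen_le w he) (le_tailLen h1 h2.le)

theorem headLen_eq_iff {w : List (Fin σ)} {s p : ℕ} (hs : s + p ≤ w.length) :
    headLen w s p = p ↔ p ≤ s ∧ pk w (s - p) s = pk w s (s + p) := by
  constructor
  · intro h
    obtain ⟨h1, h2⟩ := headLen_spec w s p
    rw [h] at h1 h2
    exact ⟨h1, eq_of_le_of_norm_le h2 (by rw [norm_pk w hs, norm_pk w (by omega)]; omega)⟩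
  · rintro ⟨h1, h2⟩
    exact le_antisymm (headLen_le w hs) (le_headLen (by omega) h1 h2.le)

theorem pk_reverse (w : List (Fin σ)) {i j : ℕ} (hij : i ≤ j) (hj : j ≤ w.length) :
    pk w.reverse (w.length - j) (w.length - i) = pk w i j := by
  have h : seg w.reverse (w.length - j) (w.length - i) = (seg w i j).reverse := by
    unfold seg
    rw [List.take_reverse, List.drop_reverse, List.length_drop, List.take_drop]
    congr 2
    · omega
    · congr 1; omega
  funext a
  simp [pk, h, parikh]

/-- Thus the program for tails, run on the reversed word, also provides the heads. -/
theorem headLen_eq_tailLen_reverse (w : List (Fin σ)) {s p : ℕ} (hs : s + p ≤ w.length) :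
    tailLen w.reverse (w.length - s) p = headLen w s p := by
  have key : ∀ h ≤ s, pk w.reverse (w.length - s) (w.length - s + h) = pk w (s - h) s := by
    intro h hh
    rw [← pk_reverse w (by omega : s - h ≤ s) (by omega)]
    congr 1; omega
  have key2 : pk w.reverse (w.length - s - p) (w.length - s) = pk w s (s + p) := by
    rw [← pk_reverse w (by omega : s ≤ s + p) (by omega)]
    congr 1; omega
  have hr : w.reverse.length = w.length := List.length_reverse
  apply le_antisymm
  · obtain ⟨h1, h2⟩ := tailLen_spec w.reverse (e := w.length - s) (by omega) p
    refine le_headLen (by omega) (by omega) ?_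
    rwa [← key _ (by omega), ← key2]
  · obtain ⟨h1, h2⟩ := headLen_spec w s p
    refine le_tailLen (by omega) ?_
    rwa [key _ h1, key2]

/-- The end of the longest fragment with period norm `p` whose cores start with the `p` letters
before the position `e`. -/
noncomputable def reach (w : List (Fin σ)) (p e : ℕ) : ℕ :=
  if _h : 0 < p ∧ e + p ≤ w.length ∧ tailLen w e p = p then reach w p (e + p)
  else e + tailLen w e p
termination_by w.length - e

/-- The bounds in the condition of `reach` serve termination; `e + p ≤ w.length` follows from a tail
of length `p`. This recursion is what the program evaluates, with decreasing `e`. -/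
theorem reach_eq {w : List (Fin σ)} {p e : ℕ} (he : e ≤ w.length) (hp : 0 < p) :
    reach w p e = if tailLen w e p = p then reach w p (e + p) else e + tailLen w e p := by
  rw [reach]
  by_cases h : tailLen w e p = p
  · have := (tailLen_spec w he p).1
    rw [h] at this
    simp [h, hp, this]
  · simp [h]

theorem reach_spec (w : List (Fin σ)) {p : ℕ} (hp : 0 < p) : ∀ e, p ≤ e → e ≤ w.length →
    ∃ m, e + m * p ≤ w.length ∧ (∀ r < m, pk w (e + r * p) (e + (r + 1) * p) = pk w (e - p) e) ∧
      pk w (e + m * p - p) (e + m * p) = pk w (e - p) e ∧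
      reach w p e = e + m * p + tailLen w (e + m * p) p ∧ tailLen w (e + m * p) p < p := by
  intro e
  induction h : w.length - e using Nat.strong_induction_on generalizing e with
  | _ d ih =>
    intro hpe he
    by_cases ht : tailLen w e p = p
    · obtain ⟨h1, h2⟩ := (tailLen_eq_iff hpe he).1 ht
      obtain ⟨m, m1, m2, m3, m4, m5⟩ := ih _ (by omega) (e + p) rfl (by omega) h1
      have e1 : ∀ r, e + p + r * p = e + (r + 1) * p := fun r => by ring
      simp only [e1, Nat.add_sub_cancel, h2] at m1 m2 m3 m4 m5
      refine ⟨m + 1, m1, fun r hr => ?_, m3, ?_, m5⟩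
      · rcases r with _ | r
        · simpa using h2
        · exact m2 r (by omega)
      · rw [reach_eq he hp, if_pos ht, m4]
    · have := tailLen_le w (p := p) he
      refine ⟨0, by simpa using he, by simp, by simp, ?_, ?_⟩
      · rw [reach_eq he hp, if_neg ht]; simp
      · simp only [zero_mul, add_zero]; omega

/-- A maximal sequence of at least two consecutive fragments of length `p` with equal Parikh vectors
starts at the position `s`. -/
structure IsFirst (w : List (Fin σ)) (p s : ℕ) : Prop where
  pos : 0 < p
  le : s + 2 * p ≤ w.length
  tail : tailLen w (s + p) p = p
  head : headLen w s p ≠ p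

/-- The left end of the fragment of the chain that starts at `s`. -/
noncomputable def lo (w : List (Fin σ)) (p s : ℕ) : ℕ := s - headLen w s p

/-- The right end of the fragment of the chain that starts at `s`. -/
noncomputable def hi (w : List (Fin σ)) (p s : ℕ) : ℕ := reach w p (s + p)

theorem norm_window {w : List (Fin σ)} {p s : ℕ} (h : s + p ≤ w.length) :
    norm (pk w s (s + p)) = p := by
  rw [norm_pk w h]; omega

theorem IsFirst.chain {w : List (Fin σ)} {p s : ℕ} (h : IsFirst w p s) :
    ∃ M, Chain w (pk w s (s + p)) s M (lo w p s) (hi w p s) := by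
  have hp := h.pos
  have hle := h.le
  have hn := norm_window (w := w) (p := p) (s := s) (by omega)
  obtain ⟨m, m1, m2, m3, m4, m5⟩ := reach_spec w hp (s + p) (by omega) (by omega)
  simp only [show s + p + m * p = s + (m + 1) * p by ring, Nat.add_sub_cancel] at m1 m2 m3 m4 m5
  obtain ⟨t1, t2⟩ := tailLen_spec w m1 p
  obtain ⟨u1, u2⟩ := headLen_spec w s p
  have hlt : headLen w s p < p := lt_of_le_of_ne (headLen_le w (by omega)) h.head
  -- `reach` starts after the first core, so its `m` cores are joined by the one at `s`. The case `m
  -- = 0` is excluded because the tail after the first core has full length.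
  refine ⟨m + 1, ?_⟩
  constructor
  · omega
  · rcases m with _ | m
    · exfalso
      have := h.tail
      simp only [zero_add, one_mul] at m5
      omega
    · omega
  · intro r hr
    rw [hn]
    rcases r with _ | r
    · simp
    · rw [← m2 r (by omega)]
      congr 1 <;> ring
  · exact Nat.sub_le _ _
  · exact u2
  · rw [hn]; unfold lo; omega
  · intro i hi hle
    have := le_headLen (w := w) (s := s) (p := p) (h := s - i) (by omega) (by omega)
      (by rwa [Nat.sub_sub_self hi])
    unfold lo; omega
  · rw [hn]; unfold hi; omega
  · unfold hi; omega
  · rw [hn, ← m3]; unfold hi; rw [m4]; exact t2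
  · rw [hn]; unfold hi; omega
  · intro k hk hk1 hk2
    rw [hn] at hk1 hk2
    have := le_tailLen (w := w) (e := s + (m + 1) * p) (p := p) (t := k - (s + (m + 1) * p))
      (by omega) (by rwa [Nat.add_sub_cancel' hk1, m3])
    unfold hi; omega

/-- Move left by `p` as long as the head has full length, that is, as long as another core precedes.
-/
theorem exists_isFirst {w : List (Fin σ)} {P : Fin σ → ℕ} {p : ℕ} (hp : 0 < p) :
    ∀ a, a + 2 * p ≤ w.length → pk w a (a + p) = P → pk w (a + p) (a + 2 * p) = P →
      ∃ s q, a = s + q * p ∧ IsFirst w p s ∧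
        ∀ r < q + 2, pk w (s + r * p) (s + (r + 1) * p) = P := by
  intro a
  induction a using Nat.strong_induction_on with
  | _ a ih =>
    intro ha h1 h2
    by_cases hh : headLen w a p = p
    · obtain ⟨g1, g2⟩ := (headLen_eq_iff (by omega)).1 hh
      obtain ⟨s, q, s1, s2, s3⟩ := ih (a - p) (by omega) (by omega)
        (by rw [Nat.sub_add_cancel g1, g2, h1])
        (by rw [Nat.sub_add_cancel g1, show a - p + 2 * p = a + p by omega, h1])
      refine ⟨s, q + 1, by rw [Nat.succ_mul]; omega, s2, fun r hr => ?_⟩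
      rcases (show r < q + 2 ∨ r = q + 2 by omega) with h | h
      · exact s3 r h
      · subst h
        rw [← h2]
        have : (q + 2) * p = q * p + 2 * p := by ring
        have : (q + 2 + 1) * p = q * p + 3 * p := by ring
        congr 1 <;> omega
    · refine ⟨a, 0, by simp, ⟨hp, ha, ?_, hh⟩, fun r hr => ?_⟩
      · rw [tailLen_eq_iff (by omega) (by omega), Nat.add_sub_cancel, h1,
          show a + p + p = a + 2 * p by ring]
        exact ⟨ha, h2⟩
      · rcases (show r = 0 ∨ r = 1 by omega) with rfl | rfl
        · simpa using h1
        · simpa using h2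

/-- The cores of the factorization belong to the chain through them, and its head and tail are
either limited by the maximal extension of the chain or shorter than the core of the chain that
continues there. -/
theorem PerAt.exists_isFirst {w : List (Fin σ)} {P : Fin σ → ℕ} {i k a m : ℕ}
    (h : PerAt w P i k a m) (hk : k ≤ w.length) :
    ∃ s q, IsFirst w (norm P) s ∧ pk w s (s + norm P) = P ∧ lo w (norm P) s ≤ i ∧
      k ≤ hi w (norm P) s ∧ a = s + q * norm P := by
  obtain ⟨p, hp⟩ : ∃ p, norm P = p := ⟨_, rfl⟩
  have hpos := h.norm_pos
  have hcore := h.core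
  have hend := h.end_le
  have hstart := h.le_start
  have hhead := h.head
  have htail := h.tail
  have h2 := h.two
  have hkl := norm_lt_norm htail
  have hil := norm_lt_norm hhead
  rw [norm_pk w hk] at hkl
  rw [hp] at hpos hcore hend htail hkl hil ⊢
  have h2m : 2 * p ≤ m * p := Nat.mul_le_mul_right p h2
  rw [norm_pk w (by omega)] at hil
  obtain ⟨s, q, s1, s2, s3⟩ := AbelianRuns.exists_isFirst (w := w) (P := P) hpos a (by omega)
    (by simpa using hcore 0 (by omega)) (by simpa using hcore 1 (by omega))
  have hP : pk w s (s + p) = P := by simpa using s3 0 (by omega)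
  obtain ⟨M, A⟩ := s2.chain
  rw [hP] at A
  have hall : ∀ r < q + m, pk w (s + r * p) (s + (r + 1) * p) = P := by
    intro r hr
    rcases lt_or_ge r (q + 2) with h | h
    · exact s3 r h
    · obtain ⟨d, rfl⟩ := Nat.exists_eq_add_of_le (show q ≤ r by omega)
      rw [← hcore d (by omega), s1]
      congr 1 <;> ring
  have hR := A.R_lt
  have hle := A.le_R
  have hqm : s + (q + m) * p ≤ k := by rw [add_mul]; omega
  rw [hp] at hR hle
  -- Otherwise the maximality of the right end would put a whole further core after the last core of
  -- the chain, where less than one core length is left.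
  have hM : q + m ≤ M := by
    by_contra hc
    have h3 : (M + 1) * p ≤ (q + m) * p := Nat.mul_le_mul_right p (by omega)
    have h5 : (M + 1) * p = M * p + p := by ring
    have := A.R_max (s + (M + 1) * p) (by omega) (by rw [hp]; omega)
      (by rw [hp, hall M (by omega)])
    omega
  refine ⟨s, q, s2, hP, ?_, ?_, s1⟩
  · rcases q with _ | q
    · simp only [zero_mul, add_zero] at s1
      exact A.L_min _ (by omega) (by rw [← s1]; exact hhead.le)
    · have h1 := A.L_le
      have h5 : (q + 1) * p = q * p + p := by ring
      omega
  · rcases hM.eq_or_lt with h | h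
    · refine A.R_max _ hk (by rw [hp, ← h]; exact hqm) ?_
      rw [hp, ← h, add_mul, ← add_assoc, ← s1]
      exact htail.le
    · have h1 : (q + m + 1) * p ≤ M * p := Nat.mul_le_mul_right p h
      have h4 : (q + m + 1) * p = q * p + m * p + p := by ring
      omega

/-- The chain that starts at `s` extends further to the right than every earlier chain with the same
Parikh vector. -/
def IsRec (w : List (Fin σ)) (p s : ℕ) : Prop :=
  IsFirst w p s ∧ ∀ s' < s, IsFirst w p s' → pk w s' (s' + p) = pk w s (s + p) →
    hi w p s' < hi w p s

/-- The chain that starts at `s` is the one by which the run at its positions is reported. -/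
def IsRep (w : List (Fin σ)) (p s : ℕ) : Prop :=
  IsRec w p s ∧ ∀ s', s < s' → IsRec w p s' → pk w s' (s' + p) = pk w s (s + p) →
    lo w p s' ≠ lo w p s

theorem lo_mono {w : List (Fin σ)} {p s s' : ℕ} (h : IsFirst w p s) (h' : IsFirst w p s')
    (hP : pk w s' (s' + p) = pk w s (s + p)) (hle : s ≤ s') : lo w p s ≤ lo w p s' := by
  obtain ⟨M, A⟩ := h.chain
  obtain ⟨M', A'⟩ := h'.chain
  rw [hP] at A'
  exact A.L_mono A' hle

/-- Records for one Parikh vector have strictly increasing right ends, so the right end alone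
identifies the chain. -/
theorem IsRep.eq_of_lo_eq_of_hi_eq {w : List (Fin σ)} {p s s' : ℕ} (h : IsRep w p s)
    (h' : IsRep w p s') (hP : pk w s' (s' + p) = pk w s (s + p)) (hhi : hi w p s = hi w p s') :
    s = s' := by
  rcases lt_trichotomy s s' with hlt | heq | hlt
  · have := h'.1.2 s hlt h.1.1 hP.symm
    omega
  · exact heq
  · have := h.1.2 s' hlt h'.1.1 hP
    omega

theorem hi_pos {w : List (Fin σ)} {p s : ℕ} (h : IsFirst w p s) :
    s < hi w p s ∧ hi w p s ≤ w.length ∧ lo w p s ≤ s := by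
  obtain ⟨M, A⟩ := h.chain
  have h1 := A.le_R
  have h2 := A.two
  have h4 := h.le
  rw [norm_window (by omega)] at h1
  have h3 : 2 * p ≤ M * p := Nat.mul_le_mul_right p h2
  have := h.pos
  exact ⟨by omega, A.R_le, A.L_le⟩

/-- A periodic extension by one letter would lie in the fragment of another chain, or of the same
one, which is too short. An earlier chain does not reach as far to the right, and a later one does
not reach further to the left. There remains a later chain with the same left end that ends further
to the right. -/
theorem IsRep.isAbelianRun {w : List (Fin σ)} {p s : ℕ} (h : IsRep w p s) :
    IsAbelianRun w (pk w s (s + p)) (lo w p s) (hi w p s - 1) := by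
  have hf := h.1.1
  obtain ⟨M, A⟩ := hf.chain
  obtain ⟨g1, g2, g3⟩ := hi_pos hf
  have hle := hf.le
  have hn : norm (pk w s (s + p)) = p := norm_window (by omega)
  have hsub : hi w p s - 1 + 1 = hi w p s := by omega
  refine ⟨by omega, by omega, ?_, ?_, ?_⟩
  · change IsPeriodic _ (seg w _ _)
    rw [hsub, isPeriodic_seg_iff g2 (by omega)]
    exact ⟨_, _, A.perAt⟩
  · intro i' hi' hper
    change IsPeriodic _ (seg w _ _) at hper
    rw [hsub, isPeriodic_seg_iff g2 (by omega)] at hper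
    obtain ⟨a, m, hper⟩ := hper
    obtain ⟨s', q, f1, f2, f3, f4, f5⟩ := hper.exists_isFirst g2
    rw [hn] at f1 f2 f3 f4 f5
    rcases lt_or_ge s' s with hlt | hge
    · have := h.1.2 s' hlt f1 f2
      omega
    · have := lo_mono hf f1 f2 hge
      omega
  · intro hlt hper
    change IsPeriodic _ (seg w _ _) at hper
    rw [hsub] at hlt hper
    rw [isPeriodic_seg_iff (by omega) (by omega)] at hper
    obtain ⟨a, m, hper⟩ := hper
    obtain ⟨s', q, f1, f2, f3, f4, f5⟩ := hper.exists_isFirst (by omega)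
    rw [hn] at f1 f2 f3 f4 f5
    rcases lt_trichotomy s' s with hlt | heq | hgt
    · have := h.1.2 s' hlt f1 f2
      omega
    · subst heq; omega
    · classical
      -- The first later chain that ends beyond `hi w p s` is a record, and its left end is squeezed
      -- between those of `s` and of `s'`, which agree; this contradicts `IsRep`.
      have hex : ∃ t, s < t ∧ IsFirst w p t ∧ pk w t (t + p) = pk w s (s + p) ∧
          hi w p s < hi w p t := ⟨s', hgt, f1, f2, by omega⟩
      obtain ⟨t1, t2, t3, t4⟩ := Nat.find_spec hex
      have tmin := fun t' => Nat.find_min hex (m := t')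
      have tle : Nat.find hex ≤ s' := Nat.find_min' hex ⟨hgt, f1, f2, by omega⟩
      set t := Nat.find hex
      refine h.2 t t1 ⟨t2, fun u hu hu1 hu2 => ?_⟩ t3 ?_
      · rw [t3] at hu2
        rcases lt_trichotomy u s with h1 | h1 | h1
        · have := h.1.2 u h1 hu1 hu2
          omega
        · subst h1; exact t4
        · by_contra hc
          exact tmin u hu ⟨h1, hu1, hu2, by omega⟩
      · have h1 := lo_mono hf t2 t3 (by omega)
        have h2 := lo_mono t2 f1 (by rw [f2, t3]) tle
        omega

/-- The run lies in the fragment of a chain and contains two of its cores, so if it were smaller,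
one more letter of that fragment would extend it. Among the chains with exactly this fragment the
leftmost is the representative: an earlier chain that ends at least as far right, or a later record
with the same left end, would have a strictly larger fragment, and `Chain.perAt_between` would give
a periodic extension by one letter. -/
theorem exists_isRep_of_isAbelianRun {w : List (Fin σ)} {P : Fin σ → ℕ} {i j : ℕ}
    (h : IsAbelianRun w P i j) : ∃ s, IsRep w (norm P) s ∧ pk w s (s + norm P) = P ∧
      lo w (norm P) s = i ∧ hi w (norm P) s = j + 1 := by
  have hij := h.le
  have hj := h.lt_length
  have hleft : ∀ i', i' + 1 = i → ∀ a m, ¬ PerAt w P i' (j + 1) a m := fun i' hi' a m hp =>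
    h.left_maximal i' hi' ((isPeriodic_seg_iff (w := w) (i := i') (k := j + 1) (by omega)
      (by omega)).2 ⟨a, m, hp⟩)
  have hright : j + 1 < w.length → ∀ a m, ¬ PerAt w P i (j + 1 + 1) a m := fun hlt a m hp =>
    h.right_maximal hlt ((isPeriodic_seg_iff (w := w) (i := i) (k := j + 1 + 1) (by omega)
      (by omega)).2 ⟨a, m, hp⟩)
  have hper := h.periodic
  change IsPeriodic _ (seg w _ _) at hper
  rw [isPeriodic_seg_iff (by omega) (by omega)] at hper
  obtain ⟨a, m, hper⟩ := hper
  have hex : ∃ s, IsFirst w (norm P) s ∧ pk w s (s + norm P) = P ∧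
      lo w (norm P) s = i ∧ hi w (norm P) s = j + 1 := by
    obtain ⟨s, q, f1, f2, f3, f4, f5⟩ := hper.exists_isFirst (by omega)
    obtain ⟨M, A⟩ := f1.chain
    rw [f2] at A
    have e1 := hper.end_le
    have e2 := hper.le_start
    have e3 : 2 * norm P ≤ m * norm P := Nat.mul_le_mul_right _ hper.two
    have e4 : (q + 2) * norm P = q * norm P + 2 * norm P := by ring
    have e5 := A.R_le
    refine ⟨s, f1, f2, ?_, ?_⟩
    · by_contra hne
      obtain ⟨a', m', hp⟩ := A.perAt_of_subset (i := i - 1) (k := j + 1) (q := q) (by omega) f4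
        (by omega) (by omega)
      exact hleft (i - 1) (by omega) a' m' hp
    · by_contra hne
      obtain ⟨a', m', hp⟩ := A.perAt_of_subset (i := i) (k := j + 1 + 1) (q := q) f3 (by omega)
        (by omega) (by omega)
      exact hright (by omega) a' m' hp
  classical
  obtain ⟨s1, s2, s3, s4⟩ := Nat.find_spec hex
  have smin := fun t => Nat.find_min hex (m := t)
  set s := Nat.find hex
  obtain ⟨M, A⟩ := s1.chain
  rw [s2, s3, s4] at A
  refine ⟨s, ⟨⟨s1, fun t ht t1 t2 => ?_⟩, fun t ht t1 t2 t3 => ?_⟩, s2, s3, s4⟩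
  · rw [s2] at t2
    by_contra hc
    obtain ⟨M', B⟩ := t1.chain
    have hlo := lo_mono t1 s1 (by rw [s2, t2]) ht.le
    rw [t2] at B
    have hne : lo w (norm P) t = i → hi w (norm P) t ≠ j + 1 := fun h1 h2 =>
      smin t ht ⟨t1, t2, h1, h2⟩
    by_cases h1 : lo w (norm P) t = i
    · have := hne h1
      have := B.R_le
      obtain ⟨a', m', hp⟩ := A.perAt_between B (i := i) (k := j + 1 + 1) (by omega) le_rfl
        (by omega) (by omega)
      exact hright (by omega) a' m' hp
    · obtain ⟨a', m', hp⟩ := A.perAt_between B (i := i - 1) (k := j + 1) (by omega) (by omega)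
        (by omega) (by omega)
      exact hleft (i - 1) (by omega) a' m' hp
  · obtain ⟨M', B⟩ := t1.1.chain
    have hhi := t1.2 s ht s1 t2.symm
    rw [t2, s2] at B
    have := B.R_le
    obtain ⟨a', m', hp⟩ := A.perAt_between B (i := i) (k := j + 1 + 1) (by omega) le_rfl
      (by omega) (by omega)
    exact hright (by omega) a' m' hp

/-- The tuple by which the chain that starts at `s` is reported. -/
noncomputable def tupleOf (w : List (Fin σ)) (p s : ℕ) : RunTuple where
  i := lo w p s
  h := headLen w s p
  t := (hi w p s - s) % p
  j := hi w p s - 1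
  p := p

theorem IsRep.represents {w : List (Fin σ)} {p s : ℕ} (h : IsRep w p s) :
    (tupleOf w p s).Represents w (pk w s (s + p)) (lo w p s) (hi w p s - 1) := by
  have hf := h.1.1
  obtain ⟨M, A⟩ := hf.chain
  obtain ⟨g1, g2, g3⟩ := hi_pos hf
  have hle := hf.le
  have hn : norm (pk w s (s + p)) = p := norm_window (by omega)
  refine ⟨h.isAbelianRun, rfl, rfl, hn.symm, ?_⟩
  obtain ⟨head, cores, tail, f1, f2, f3, f4⟩ := A.perAt.factorization g2
  refine ⟨head, cores, tail, ?_, f2, ?_, ?_⟩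
  · change IsPeriodicFactorization _ (seg w _ _) _ _ _
    rwa [show hi w p s - 1 + 1 = hi w p s by omega]
  · rw [f3]
    have := (headLen_spec w s p).1
    simp only [tupleOf, lo]
    omega
  · have h1 := A.le_R
    have h2 := A.R_lt
    rw [hn] at f4 h1 h2
    rw [f4]
    simp only [tupleOf]
    -- From the first core on the fragment consists of `M` cores and a tail shorter than `p`, so the
    -- remainder modulo `p` is the length of the tail.
    rw [show hi w p s - s = (hi w p s - (s + M * p)) + p * M by rw [mul_comm p]; omega,
      Nat.add_mul_mod_self_left, Nat.mod_eq_of_lt (by omega)]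

/-- The head ends at `i + h = s`, where the first core starts, so the tuple determines the period as
well as the positions; it cannot represent two runs. -/
theorem IsRep.eq_of_represents {w : List (Fin σ)} {p s : ℕ} (h : IsRep w p s) {P : Fin σ → ℕ}
    {i j : ℕ} (hr : (tupleOf w p s).Represents w P i j) :
    p = norm P ∧ pk w s (s + p) = P ∧ hi w p s = j + 1 := by
  obtain ⟨hrun, h1, h2, h3, head, cores, tail, f1, f2, f3, f4⟩ := hr
  have hl := hrun.le
  have hlt := hrun.lt_length
  simp only [tupleOf] at h1 h2 h3 f3 f4
  obtain ⟨g1, g2, g3⟩ := hi_pos h.1.1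
  have hper := (perAt_of_factorization (w := w) (i := i) (k := j + 1) (by omega) (by omega) f1 f2).1
  have hh := (headLen_spec w s p).1
  have hs : i + head.length = s := by
    rw [← f3, ← h1, lo]; omega
  have := hper.core 0 (by omega)
  rw [hs, ← h3] at this
  exact ⟨h3, by simpa using this, by omega⟩

-- Each run has a representative, and a second tuple for the same run would come from a
-- representative with the same period and right end, that is, from the same entry of the
-- duplicate-free list.
open Classical in
theorem listsAllAbelianRuns_of_nodup (w : List (Fin σ)) (l : List (ℕ × ℕ)) (hl : l.Nodup)
    (hmem : ∀ p s, (p, s) ∈ l ↔ IsRep w p s) :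
    ListsAllAbelianRuns w ((l.map fun x => tupleOf w x.1 x.2).flatMap RunTuple.words) := by
  refine ⟨l.map fun x => tupleOf w x.1 x.2, rfl, ?_, ?_⟩
  · simp only [List.mem_map]
    rintro _ ⟨⟨p, s⟩, hx, rfl⟩
    exact ⟨_, _, _, ((hmem p s).1 hx).represents⟩
  · intro P i j hrun
    obtain ⟨s, s1, s2, s3, s4⟩ := exists_isRep_of_isAbelianRun hrun
    obtain ⟨m, hm, hm2⟩ := List.getElem_of_mem ((hmem _ _).2 s1)
    refine ⟨⟨m, by simpa using hm⟩, ?_, ?_⟩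
    · have := s1.represents
      rw [s2, s3, s4, Nat.add_sub_cancel] at this
      simpa [hm2] using this
    · rintro ⟨m', hm'⟩ h
      have hm'' : m' < l.length := by simpa using hm'
      simp only [List.get_eq_getElem, List.getElem_map] at h
      have hrep : IsRep w l[m'].1 l[m'].2 := (hmem _ _).1 (List.getElem_mem hm'')
      obtain ⟨e1, e2, e3⟩ := hrep.eq_of_represents h
      rw [e1] at hrep e2 e3
      have hss := hrep.eq_of_lo_eq_of_hi_eq s1 (by rw [s2, e2]) (by rw [s4, e3])
      have : l[m'] = l[m] := by
        rw [hm2]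
        exact Prod.ext e1 hss
      simpa using (List.Nodup.getElem_inj_iff hl).1 this

end Runs

/-! ### The tables of tails, by two pointers. -/

section Tails

/-- The words of a machine with `W` words suffice for the indices of the tables that are used. -/
structure Wide (n σ W : ℕ) : Prop where
  pos : 0 < n
  sq : (n + 1) * (n + 1) ≤ W
  mul : (n + 1) * σ ≤ W
  lin : 2 * n + 4 ≤ W
  alph : σ < W

/-- The registers `0`, `1`, `2` hold `n`, `σ`, `n + 1`, and the array `src` holds the letters
of `w`. -/
structure Holds {σ : ℕ} (w : List (Fin σ)) (src : ℕ) (s : State) : Prop where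
  len : s.reg 0 = w.length
  alph : s.reg 1 = σ
  succ : s.reg 2 = w.length + 1
  letter : ∀ k (h : k < w.length), s.arr src k = w[k]

variable {σ : ℕ} {w : List (Fin σ)} {W : ℕ}

theorem Holds.frame {src : ℕ} {s s' : State} {A : List ℕ} (h : Holds w src s) (hf : Frame A s s')
    (hs : src ∉ A) : Holds w src s' :=
  ⟨by rw [hf.reg 0 (by omega), h.len], by rw [hf.reg 1 (by omega), h.alph],
    by rw [hf.reg 2 (by omega), h.succ], fun k hk => by rw [hf.arr src hs, h.letter k hk]⟩

theorem Wide.cell_sq {n x y : ℕ} (h : Wide n σ W) (hx : x ≤ n) (hy : y ≤ n) :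
    cell (n + 1) x y < W :=
  lt_of_lt_of_le (cell_lt (Nat.lt_succ_of_le hx) (Nat.lt_succ_of_le hy)) h.sq

theorem Wide.cell_mul {n x y : ℕ} (h : Wide n σ W) (hx : x ≤ n) (hy : y < σ) :
    cell σ x y < W :=
  lt_of_lt_of_le (cell_lt (Nat.lt_succ_of_le hx) hy) h.mul

/-- One step for the row `e` (register `10`): the length of the tail for `p` letters (register `12`)
is at least register `11`; either increase it, or store it and increase `p`. -/
def tailStep (src D T R : ℕ) : Cmd :=
  .branch (times (less (plus (.reg 10) (.reg 11)) (.reg 0))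
      (.read D (cellE (.reg 1) (.reg 10) (.read src (plus (.reg 10) (.reg 11))))))
    (block [
      .store D (cellE (.reg 1) (.reg 10) (.read src (plus (.reg 10) (.reg 11))))
        (minus (.read D (cellE (.reg 1) (.reg 10) (.read src (plus (.reg 10) (.reg 11)))))
          (.const 1)),
      .assign 11 (plus (.reg 11) (.const 1))])
    (block [
      .store T (cellE (.reg 2) (.reg 10) (.reg 12)) (.reg 11),
      .branch (same (.reg 11) (.reg 12))
        (.store R (cellE (.reg 2) (.reg 10) (.reg 12))
          (.read R (cellE (.reg 2) (plus (.reg 10) (.reg 12)) (.reg 12))))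
        (.store R (cellE (.reg 2) (.reg 10) (.reg 12)) (plus (.reg 10) (.reg 11))),
      .assign 12 (plus (.reg 12) (.const 1)),
      .store D (cellE (.reg 1) (.reg 10) (.read src (minus (.reg 10) (.reg 12))))
        (plus (.read D (cellE (.reg 1) (.reg 10) (.read src (minus (.reg 10) (.reg 12)))))
          (.const 1))])

/-- The tables of the lengths of tails and of the right ends that they yield, for the word in the
array `src`. -/
def tailProg (src D T R : ℕ) : Cmd :=
  block [
    .assign 10 (.reg 0),
    .loop (.reg 10) (block [
      .assign 11 (.const 0),
      .assign 12 (.const 0),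
      .loop (less (.reg 12) (plus (.reg 10) (.const 1))) (tailStep src D T R),
      .assign 10 (minus (.reg 10) (.const 1))])]

/-- The tables `T` and `R` are correct in the rows below `e` and, up to column `p - 1`, in
row `e`. -/
def TailTable (w : List (Fin σ)) (T R e p : ℕ) (s : State) : Prop :=
  ∀ e' p', p' ≤ e' → e' ≤ w.length → (e < e' ∨ e = e' ∧ p' < p) →
    s.arr T (cell (w.length + 1) e' p') = tailLen w e' p' ∧
    (0 < p' → s.arr R (cell (w.length + 1) e' p') = reach w p' e')

/-- The invariant of the computation of the tables of tails. -/
structure TailInv (w : List (Fin σ)) (src D T R : ℕ) (s₀ : State) (e p t : ℕ) (s : State) :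
    Prop where
  frame : Frame [D, T, R] s₀ s
  out : s.out = s₀.out
  reg_e : s.reg 10 = e
  reg_t : s.reg 11 = t
  reg_p : s.reg 12 = p
  p_le : p ≤ e + 1
  t_le : e + t ≤ w.length
  table : TailTable w T R e p s
  diff : p ≤ e → ∀ a : Fin σ,
    s.arr D (cell σ e a) + pk w e (e + t) a = pk w (e - p) e a
  zero : ∀ e' < e, ∀ a < σ, s.arr D (cell σ e' a) = 0

theorem pk_apply_le (w : List (Fin σ)) {i j : ℕ} (hj : j ≤ w.length) (a : Fin σ) :
    pk w i j a ≤ j - i := by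
  rw [← norm_pk w hj]
  exact Finset.single_le_sum (f := pk w i j) (fun _ _ => Nat.zero_le _) (Finset.mem_univ a)

/-- Row `e` of `D` holds the counts of the last `p` letters before `e` minus those of the current
tail. The tail can grow if and only if the entry of the next letter is positive. When it cannot, its
length is final for `p`, and it remains admissible for `p + 1`, so neither pointer ever moves back.
-/
theorem tailStep_spec {src D T R : ℕ} (hD : src ≠ D) (hT : src ≠ T) (hR : src ≠ R)
    (hDT : D ≠ T) (hDR : D ≠ R) (hTR : T ≠ R) (hW : Wide w.length σ W) {s₀ s : State}
    (h₀ : Holds w src s₀) {e p t τ : ℕ} (he : 0 < e) (hp : p ≤ e)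
    (h : TailInv w src D T R s₀ e p t s) :
    WP W (tailStep src D T R) (fun s' τ' => τ' ≤ τ + 100 ∧
      ((TailInv w src D T R s₀ e p (t + 1) s' ∧ e + t < w.length) ∨
        TailInv w src D T R s₀ e (p + 1) t s')) s τ := by
  have hH := h₀.frame h.frame (by simp [hD, hT, hR])
  have r0 := hH.len
  have r1 := hH.alph
  have r2 := hH.succ
  have r10 := h.reg_e
  have r11 := h.reg_t
  have r12 := h.reg_p
  have htn := h.t_le
  have hlin := hW.lin
  have hadd : (plus (.reg 10) (.reg 11)).eval W s = e + t :=
    eval_plus r10 r11 (by omega)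
  have hcellD : e + t < w.length → ∃ a : Fin σ, (∃ hk : e + t < w.length, w[e + t] = a) ∧
      (cellE (.reg 1) (.reg 10) (.read src (plus (.reg 10) (.reg 11)))).eval W s
        = cell σ e a := by
    intro hk
    refine ⟨w[e + t], ⟨hk, rfl⟩, eval_cellE r1 r10 ?_ (hW.cell_mul (by omega) (Fin.is_lt _))⟩
    rw [RExpr.eval, hadd, hH.letter _ hk]
  have hDle : ∀ a : Fin σ, s.arr D (cell σ e a) ≤ w.length := by
    intro a
    have h1 := h.diff hp a
    have h2 := pk_apply_le w (i := e - p) (j := e) (by omega) a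
    omega
  -- At the end of the word the letter is read from outside the word; the comparison then
  -- contributes the factor `0`, so that the value read is irrelevant.
  have hguard : (times (less (plus (.reg 10) (.reg 11)) (.reg 0))
      (.read D (cellE (.reg 1) (.reg 10) (.read src (plus (.reg 10) (.reg 11)))))).eval W s ≠ 0 ↔
      ∃ hk : e + t < w.length, s.arr D (cell σ e w[e + t]) ≠ 0 := by
    by_cases hk : e + t < w.length
    · obtain ⟨a, ⟨_, ha⟩, hc⟩ := hcellD hk
      rw [eval_times_ne_zero eval_less_le_one, eval_less_ne_zero, hadd, RExpr.eval, RExpr.eval,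
        hc, r0]
      · simp [hk, ha]
      · rw [RExpr.eval, hc]
        have := hDle a
        omega
    · simp only [hk, IsEmpty.exists_iff, iff_false, not_not]
      simp [RExpr.eval, BinOp.eval] at hadd ⊢
      simp [hadd, r0, hk]
  rw [tailStep, wp_branch]
  split_ifs with hg
  · obtain ⟨hk, hpos⟩ := hguard.1 hg
    obtain ⟨a, ⟨_, ha⟩, hc⟩ := hcellD hk
    rw [ha] at hpos
    simp only [wp_block_cons, wp_block_nil, wp_store, wp_assign]
    refine ⟨by simp only [RExpr.cost, cost_cellE]; omega, Or.inl ⟨?_, hk⟩⟩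
    rw [hc, show (minus (.read D (cellE (.reg 1) (.reg 10) (.read src (plus (.reg 10) (.reg 11)))))
          (.const 1)).eval W s = s.arr D (cell σ e a) - 1 by
        simp only [RExpr.eval, BinOp.eval]
        rw [hc, Nat.mod_eq_of_lt (by omega)],
      eval_plus (x := t) (y := 1) (by simpa [RExpr.eval] using r11) (eval_const (by omega))
        (by omega)]
    constructor
    · exact (h.frame.setArr (by simp) _ _).setReg (by omega) _
    · exact h.out
    · simpa using r10
    · simp
    · simpa using r12
    · exact h.p_le
    · omega
    · intro e' p' h1 h2 h3
      simpa [hDT.symm, hDR.symm] using h.table e' p' h1 h2 h3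
    · intro _ b
      have h1 := h.diff hp b
      rw [← add_assoc, pk_succ_apply w (by omega) hk, ha]
      simp only [setReg_arr, setArr_arr, true_and, cell_inj b.is_lt a.is_lt, Fin.val_inj]
      by_cases hab : a = b
      · subst hab
        simp
        omega
      · simp [hab, Ne.symm hab, h1]
    · intro e' he' b hb
      simp only [setReg_arr, setArr_arr, true_and, cell_inj hb a.is_lt]
      rw [if_neg (by omega)]
      exact h.zero e' he' b hb
  · rw [hguard] at hg
    push Not at hg
    have hle : pk w e (e + t) ≤ pk w (e - p) e := fun a =>
      (h.diff hp a) ▸ Nat.le_add_left _ _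
    have htail : t = tailLen w e p := by
      refine eq_tailLen htn hle fun hk hc => ?_
      have h1 := hg hk
      have h2 := h.diff hp w[e + t]
      have h3 := hc w[e + t]
      rw [pk_succ_apply w (by omega) hk] at h3
      simp at h3
      omega
    have hpc : ∀ s' : State, s'.reg 2 = w.length + 1 → s'.reg 10 = e → s'.reg 12 = p →
        (cellE (.reg 2) (.reg 10) (.reg 12)).eval W s' = cell (w.length + 1) e p :=
      fun s' h1 h2 h3 => eval_cellE h1 h2 h3 (hW.cell_sq (by omega) (by omega))
    have hfin : ∀ (v τ' : ℕ), τ' ≤ τ + 60 → (0 < p → v = reach w p e) →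
        WP W (block [.assign 12 (plus (.reg 12) (.const 1)),
          .store D (cellE (.reg 1) (.reg 10) (.read src (minus (.reg 10) (.reg 12))))
            (plus (.read D (cellE (.reg 1) (.reg 10) (.read src (minus (.reg 10) (.reg 12)))))
              (.const 1))]) (fun s' τ' => τ' ≤ τ + 100 ∧
          ((TailInv w src D T R s₀ e p (t + 1) s' ∧ e + t < w.length) ∨
            TailInv w src D T R s₀ e (p + 1) t s'))
          ((s.setArr T (cell (w.length + 1) e p) t).setArr R (cell (w.length + 1) e p) v) τ' := by
      intro v τ' hτ' hv
      simp only [wp_block_cons, wp_block_nil, wp_store, wp_assign]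
      refine ⟨by simp only [RExpr.cost, cost_cellE]; omega, Or.inr ?_⟩
      rw [eval_plus (e := .reg 12) (x := p) (y := 1) (by simpa [RExpr.eval] using r12)
        (eval_const (by omega)) (by omega)]
      set s₁ := (((s.setArr T (cell (w.length + 1) e p) t).setArr R (cell (w.length + 1) e p)
        v).setReg 12 (p + 1)) with hs₁
      -- For `p = e` the truncated difference is `0` and a spurious count is added. The row `e` is
      -- finished then, and the invariant `diff` makes no claim about it.
      have hk : e - (p + 1) < w.length := by omega
      have hc : (cellE (.reg 1) (.reg 10) (.read src (minus (.reg 10) (.reg 12)))).eval W s₁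
          = cell σ e w[e - (p + 1)] := by
        refine eval_cellE (by simpa [hs₁, RExpr.eval] using r1)
          (by simpa [hs₁, RExpr.eval] using r10) ?_
          (hW.cell_mul (by omega) (Fin.is_lt _))
        rw [RExpr.eval, show (minus (.reg 10) (.reg 12)).eval W s₁ = e - (p + 1) by
          simp [RExpr.eval, BinOp.eval, hs₁, r10]]
        simp [hs₁, hT, hR, hH.letter _ hk]
      have hDval : ∀ l, s₁.arr D l = s.arr D l := fun l => by simp [hs₁, hDT, hDR]
      rw [hc, eval_plus (x := s.arr D (cell σ e w[e - (p + 1)])) (y := 1)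
        (by rw [RExpr.eval, hc, hDval]) (eval_const (by omega))
        (by have := hDle w[e - (p + 1)]; omega)]
      constructor
      · exact ((((h.frame.setArr (by simp) _ _).setArr (by simp) _ _).setReg (by omega) _).setArr
          (by simp) _ _)
      · exact h.out
      · simpa [hs₁] using r10
      · simpa [hs₁] using r11
      · simp [hs₁]
      · omega
      · exact htn
      · intro e' p' h1 h2 h3
        simp only [setArr_arr, hDT.symm, hDR.symm, false_and, if_false]
        simp only [hs₁, setReg_arr, setArr_arr, hTR, hTR.symm, false_and, if_false, true_and,
          cell_inj (show p' < w.length + 1 by omega) (show p < w.length + 1 by omega)]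
        by_cases hc : e' = e ∧ p' = p
        · obtain ⟨rfl, rfl⟩ := hc
          simp only [and_self, if_true]
          exact ⟨htail, hv⟩
        · simp only [hc, if_false]
          exact h.table e' p' h1 h2 (by omega)
      · intro hpe b
        have h1 := h.diff hp b
        have h2 := pk_pred_apply w (i := e - (p + 1)) (j := e) (by omega) (by omega) b
        rw [show e - (p + 1) + 1 = e - p by omega] at h2
        rw [h2]
        simp only [setArr_arr, true_and, cell_inj b.is_lt (w[e - (p + 1)]).is_lt, Fin.val_inj,
          hDval]
        by_cases hab : b = w[e - (p + 1)]
        · simp only [← hab, if_true]; omega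
        · simp [hab, Ne.symm hab, h1]
      · intro e' he' b hb
        simp only [setArr_arr, true_and, cell_inj hb (w[e - (p + 1)]).is_lt, hDval]
        rw [if_neg (by omega)]
        exact h.zero e' he' b hb
    simp only [wp_block_cons (c := Cmd.store T _ _), wp_block_cons (c := Cmd.branch _ _ _),
      wp_branch, wp_store]
    rw [hpc s r2 r10 r12, show (RExpr.reg 11).eval W s = t from r11]
    set s₁ := s.setArr T (cell (w.length + 1) e p) t with hs₁
    have hsame : (same (.reg 11) (.reg 12)).eval W s₁ ≠ 0 ↔ t = p := by
      rw [eval_same_ne_zero]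
      simp [RExpr.eval, hs₁, r11, r12]
    have hpc1 := hpc s₁ (by simpa [hs₁] using r2) (by simpa [hs₁] using r10)
      (by simpa [hs₁] using r12)
    split_ifs with hs
    · have htp := hsame.1 hs
      rw [hpc1]
      refine hfin _ _ (by simp only [RExpr.cost, cost_cellE]; omega) fun hp0 => ?_
      rw [RExpr.eval, eval_cellE (k := w.length + 1) (x := e + p) (y := p)
        (by simpa [RExpr.eval, hs₁] using r2)
        (eval_plus (by simpa [RExpr.eval, hs₁] using r10) (by simpa [RExpr.eval, hs₁] using r12)
          (by omega))
        (by simpa [RExpr.eval, hs₁] using r12) (hW.cell_sq (by omega) (by omega))]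
      -- The entry in row `e + p` is final already, as the rows are treated by decreasing `e`.
      rw [reach_eq (by omega) hp0, if_pos (by omega)]
      rw [hs₁, setArr_arr, if_neg (by simp [hTR.symm])]
      exact (h.table (e + p) p (by omega) (by omega) (by omega)).2 hp0
    · have htp := fun h => hs (hsame.2 h)
      rw [hpc1]
      refine hfin _ _ (by simp only [RExpr.cost, cost_cellE]; omega) fun hp0 => ?_
      rw [eval_plus (x := e) (y := t) (by simpa [RExpr.eval, hs₁] using r10)
        (by simpa [RExpr.eval, hs₁] using r11) (by omega), reach_eq (by omega) hp0,
        if_neg (by omega), htail]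

/-- In one row `p + t` increases with each step and is at most `2 * n + 1`, so a row takes linear
time. -/
theorem tailProg_spec {src D T R : ℕ} (hD : src ≠ D) (hT : src ≠ T) (hR : src ≠ R)
    (hDT : D ≠ T) (hDR : D ≠ R) (hTR : T ≠ R) (hW : Wide w.length σ W) {s₀ : State}
    (h₀ : Holds w src s₀) (hzero : ∀ l, s₀.arr D l = 0) {τ₀ : ℕ} :
    WP W (tailProg src D T R) (fun s τ => τ ≤ τ₀ + 500 * w.length ^ 2 ∧ Frame [D, T, R] s₀ s ∧
      s.out = s₀.out ∧ TailTable w T R 0 0 s) s₀ τ₀ := by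
  have hpos := hW.pos
  have hlin := hW.lin
  rw [tailProg, wp_block_cons, wp_assign, wp_block_cons]
  refine wp_loop (fun s τ => s.reg 10 ≤ w.length ∧
      τ + s.reg 10 * (200 * w.length + 200) ≤ τ₀ + 2 + w.length * (200 * w.length + 200) ∧
      Frame [D, T, R] s₀ s ∧ s.out = s₀.out ∧ TailTable w T R (s.reg 10) 0 s ∧
      ∀ e' ≤ s.reg 10, ∀ a < σ, s.arr D (cell σ e' a) = 0) (fun s => s.reg 10) ?_ ?_ ?_
  · simp only [setReg_reg, RExpr.eval, RExpr.cost, h₀.len, if_true]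
    refine ⟨le_rfl, by omega, (Frame.refl _ _).setReg (by omega) _, rfl, ?_, fun e' _ a _ => ?_⟩
    · intro e' p' h1 h2 h3; omega
    · exact hzero _
  · rintro s τ ⟨h1, h2, h3, h4, h5, h6⟩ he
    change s.reg 10 ≠ 0 at he
    obtain ⟨e, hre⟩ : ∃ e, s.reg 10 = e := ⟨_, rfl⟩
    rw [hre] at h1 h2 h5 h6 he
    simp only [wp_block_cons (c := Cmd.assign _ _), wp_assign]
    rw [eval_const (by omega), eval_const (by omega), wp_block_cons]
    -- Each increase of `p + t` pays for one step (`100`) and one evaluation of the guard.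
    refine wp_loop (fun s' τ' => ∃ p t, TailInv w src D T R s₀ e p t s' ∧
      τ' ≤ τ + 10 + (p + t) * 107)
      (fun s' => (e + 1 - s'.reg 12) + (w.length - s'.reg 11)) ?_ ?_ ?_
    · refine ⟨0, 0, ⟨(h3.setReg (by omega) _).setReg (by omega) _, h4, by simpa using hre,
        by simp, by simp, by omega, by omega, h5, fun _ a => ?_, fun e' he' => h6 e' he'.le⟩, ?_⟩
      · simpa [pk_self] using h6 e le_rfl a a.is_lt
      · simp only [RExpr.cost]; omega
    · rintro s' τ' ⟨p, t, hinv, hτ⟩ hg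
      rw [eval_less_ne_zero, eval_plus (x := e) (y := 1) (eval_reg hinv.reg_e) (eval_const (by omega))
        (by omega), show (RExpr.reg 12).eval W s' = p from hinv.reg_p] at hg
      refine (tailStep_spec hD hT hR hDT hDR hTR hW h₀ (by omega) (by omega) hinv).mono ?_
      rintro s'' τ'' ⟨hτ'', ⟨hinv', hlt⟩ | hinv'⟩
      · refine ⟨⟨p, t + 1, hinv', ?_⟩, ?_⟩
        · simp only [RExpr.cost] at hτ''; omega
        · simp only [hinv'.reg_t, hinv'.reg_p, hinv.reg_t, hinv.reg_p]; omega
      · refine ⟨⟨p + 1, t, hinv', ?_⟩, ?_⟩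
        · simp only [RExpr.cost] at hτ''; omega
        · simp only [hinv'.reg_t, hinv'.reg_p, hinv.reg_t, hinv.reg_p]; omega
    · rintro s' τ' ⟨p, t, hinv, hτ⟩ hg
      have hp : ¬ p < e + 1 := by
        rw [← not_ne_iff, eval_less_ne_zero, eval_plus (x := e) (y := 1) (eval_reg hinv.reg_e)
          (eval_const (by omega)) (by omega),
          show (RExpr.reg 12).eval W s' = p from hinv.reg_p] at hg
        exact hg
      have hpe : p = e + 1 := by have := hinv.p_le; omega
      have htn := hinv.t_le
      rw [wp_block_cons, wp_assign, wp_block_nil,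
        show (minus (.reg 10) (.const 1)).eval W s' = e - 1 by
          simp only [RExpr.eval, BinOp.eval, hinv.reg_e]; rw [Nat.mod_eq_of_lt (by omega)]]
      simp only [setReg_reg, if_true, hre]
      refine ⟨⟨by omega, ?_, hinv.frame.setReg (by omega) _, hinv.out, ?_, ?_⟩, by omega⟩
      · obtain ⟨e', rfl⟩ : ∃ e', e = e' + 1 := ⟨e - 1, by omega⟩
        rw [Nat.add_sub_cancel]
        have : (e' + 1) * (200 * w.length + 200) = e' * (200 * w.length + 200) +
          (200 * w.length + 200) := by ring
        simp only [RExpr.cost]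
        omega
      · intro e' p' g1 g2 g3
        exact hinv.table e' p' g1 g2 (by omega)
      · intro e' he' a ha
        exact hinv.zero e' (by omega) a ha
  · rintro s τ ⟨h1, h2, h3, h4, h5, h6⟩ he
    change s.reg 10 = 0 at he
    rw [wp_block_nil]
    rw [he] at h5
    refine ⟨?_, h3, h4, h5⟩
    simp only [RExpr.cost]
    nlinarith

end Tails

/-! ### Selection and output of the representatives by two passes for each `p`. -/

section Report

variable {σ : ℕ} {w : List (Fin σ)} {W : ℕ}

/-- The index of the cell for the chain that starts at register `11`, with cores of length register
`10`, in the tables of tails. -/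
def tailCell : RExpr := cellE (.reg 2) (plus (.reg 11) (.reg 10)) (.reg 10)

/-- The head of the chain that starts at register `11`. -/
def headE : RExpr := .read 6 (cellE (.reg 2) (minus (.reg 0) (.reg 11)) (.reg 10))

/-- The right end of the chain that starts at register `11`. -/
def hiE : RExpr := .read 4 tailCell

/-- The identifier of the fragment of length register `10` that starts at register `11`. -/
def idE : RExpr := .read 8 (cellE (.reg 2) (.reg 11) (.reg 10))

/-- Find out whether the chain that starts at register `11` extends further to the right than all
earlier chains with the same identifier, and increase the register. -/
def recStep : Cmd :=
  block [
    .store 11 (.reg 11) (.const 0),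
    .branch (same (.read 3 tailCell) (.reg 10))
      (.branch (same headE (.reg 10)) .skip
        (.branch (less (.read 9 idE) hiE)
          (block [.store 9 idE hiE, .store 11 (.reg 11) (.const 1)]) .skip)) .skip,
    .assign 11 (plus (.reg 11) (.const 1))]

/-- Decrease register `11`, and report the chain that starts there, if it represents a run. -/
def emitStep : Cmd :=
  block [
    .assign 11 (minus (.reg 11) (.const 1)),
    .branch (.read 11 (.reg 11))
      (block [
        .branch (same (.read 10 idE) (plus (minus (.reg 11) headE) (.const 1))) .skip
          (block [.emit (minus (.reg 11) headE), .emit headE,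
            .emit (.op .mod (minus hiE (.reg 11)) (.reg 10)), .emit (minus hiE (.const 1)),
            .emit (.reg 10)]),
        .store 10 idE (plus (minus (.reg 11) headE) (.const 1))])
      .skip]

/-- Report all runs, given the tables of tails and the identifiers. -/
def reportProg : Cmd :=
  block [
    .assign 10 (.const 1),
    .loop (less (.reg 10) (plus (.reg 0) (.const 1))) (block [
      .assign 11 (.const 0),
      .loop (less (plus (.reg 11) (times (.const 2) (.reg 10))) (plus (.reg 0) (.const 1))) recStep,
      .loop (.reg 11) emitStep,
      .assign 10 (plus (.reg 10) (.const 1))])]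

/-- The state holds the tables of tails and heads, and the identifiers `ident`. -/
structure Tables (w : List (Fin σ)) (ident : ℕ → ℕ → ℕ) (s : State) : Prop where
  holds : Holds w 0 s
  tail : ∀ a p, 0 < p → a + 2 * p ≤ w.length →
    s.arr 3 (cell (w.length + 1) (a + p) p) = tailLen w (a + p) p
  hi : ∀ a p, 0 < p → a + 2 * p ≤ w.length →
    s.arr 4 (cell (w.length + 1) (a + p) p) = hi w p a
  head : ∀ a p, 0 < p → a + 2 * p ≤ w.length →
    s.arr 6 (cell (w.length + 1) (w.length - a) p) = headLen w a p
  ident : ∀ a p, 0 < p → a + 2 * p ≤ w.length →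
    s.arr 8 (cell (w.length + 1) a p) = ident a p

theorem Tables.frame {ident : ℕ → ℕ → ℕ} {A : List ℕ} {s s' : State} (h : Tables w ident s)
    (hf : Frame A s s') (h0 : 0 ∉ A) (h3 : 3 ∉ A) (h4 : 4 ∉ A) (h6 : 6 ∉ A) (h8 : 8 ∉ A) :
    Tables w ident s' := by
  refine ⟨h.holds.frame hf h0, ?_, ?_, ?_, ?_⟩
  · rw [hf.arr 3 h3]; exact h.tail
  · rw [hf.arr 4 h4]; exact h.hi
  · rw [hf.arr 6 h6]; exact h.head
  · rw [hf.arr 8 h8]; exact h.ident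

/-- Two fragments have the same identifier if and only if they have the same Parikh vector. -/
def Faithful (w : List (Fin σ)) (ident : ℕ → ℕ → ℕ) : Prop :=
  ∀ a p a' p', 0 < p → 0 < p' → a + p ≤ w.length → a' + p' ≤ w.length →
    (ident a p = ident a' p' ↔ pk w a (a + p) = pk w a' (a' + p'))

/-- The expressions for a chain have their intended values. -/
structure ChainValues (w : List (Fin σ)) (ident : ℕ → ℕ → ℕ) (W p a : ℕ) (s : State) : Prop where
  tail : (RExpr.read 3 tailCell).eval W s = tailLen w (a + p) p
  hi : hiE.eval W s = AbelianRuns.hi w p a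
  head : headE.eval W s = headLen w a p
  ident : idE.eval W s = ident a p

theorem Tables.chainValues {ident : ℕ → ℕ → ℕ} (hW : Wide w.length σ W) {s : State} {p a : ℕ}
    (h : Tables w ident s) (h10 : s.reg 10 = p) (h11 : s.reg 11 = a) (hp : 0 < p)
    (ha : a + 2 * p ≤ w.length) : ChainValues w ident W p a s := by
  have r0 := h.holds.len
  have r2 := h.holds.succ
  have hlin := hW.lin
  have h1 : tailCell.eval W s = cell (w.length + 1) (a + p) p :=
    eval_cellE (eval_reg r2) (eval_plus h11 h10 (by omega)) h10 (hW.cell_sq (by omega) (by omega))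
  refine ⟨?_, ?_, ?_, ?_⟩
  · rw [RExpr.eval, h1, h.tail a p hp ha]
  · rw [hiE, RExpr.eval, h1, h.hi a p hp ha]
  · rw [headE, RExpr.eval, eval_cellE (e := minus (.reg 0) (.reg 11)) (eval_reg r2)
      (x := w.length - a) (by simp [RExpr.eval, BinOp.eval, r0, h11]) (eval_reg h10) (hW.cell_sq (by omega) (by omega)), h.head a p hp ha]
  · rw [idE, RExpr.eval, eval_cellE (eval_reg r2) (eval_reg h11) (eval_reg h10) (hW.cell_sq (by omega) (by omega)),
      h.ident a p hp ha]

/-- The invariant of the first pass for `p`, before the position `a`. -/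
structure RecInv (w : List (Fin σ)) (ident : ℕ → ℕ → ℕ) (s₀ : State) (p a : ℕ) (s : State) :
    Prop where
  frame : Frame [9, 11] s₀ s
  out : s.out = s₀.out
  reg_p : s.reg 10 = p
  reg_a : s.reg 11 = a
  bound : a = 0 ∨ a + 2 * p ≤ w.length + 1
  upper : Faithful w ident → ∀ b, b + 2 * p ≤ w.length → ∀ c < a, IsFirst w p c →
    pk w c (c + p) = pk w b (b + p) → hi w p c ≤ s.arr 9 (ident b p)
  attained : Faithful w ident → ∀ b, b + 2 * p ≤ w.length → s.arr 9 (ident b p) = 0 ∨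
    ∃ c < a, IsFirst w p c ∧ pk w c (c + p) = pk w b (b + p) ∧ hi w p c = s.arr 9 (ident b p)
  isRec : Faithful w ident → ∀ b < a, (s.arr 11 b ≠ 0 ↔ IsRec w p b)
  later : Faithful w ident → ∀ b p', p < p' → b + 2 * p' ≤ w.length → s.arr 9 (ident b p') = 0

/-- Array `9` holds, for each identifier, the largest right end of the earlier chains, or `0` if
there are none, so one comparison decides whether the chain at `a` is a record. Identifiers for
larger norms are different, so their cells are still `0`; hence no reset between different `p`. Time
and frame are claimed without `Faithful`. -/
theorem recStep_spec {ident : ℕ → ℕ → ℕ} (hW : Wide w.length σ W) {s₀ s : State} {p a τ : ℕ}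
    (h₀ : Tables w ident s₀) (hp : 0 < p) (ha : a + 2 * p ≤ w.length)
    (h : RecInv w ident s₀ p a s) :
    WP W recStep (fun s' τ' => τ' ≤ τ + 100 ∧ RecInv w ident s₀ p (a + 1) s') s τ := by
  have hlin := hW.lin
  have r10 := h.reg_p
  have r11 := h.reg_a
  set s₁ := s.setArr 11 a 0 with hs₁
  have hf₁ : Frame [9, 11] s₀ s₁ := h.frame.setArr (by simp) _ _
  have hT : Tables w ident s₁ := h₀.frame hf₁ (by simp) (by simp) (by simp) (by simp) (by simp)
  obtain ⟨v1, v2, v3, v4⟩ := hT.chainValues hW (p := p) (a := a) (by simpa [hs₁] using r10)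
    (by simpa [hs₁] using r11) hp ha
  -- This serves both branches in which no chain starts at `a`; there the second alternative is
  -- refuted.
  have hnot : ¬ IsRec w p a → RecInv w ident s₀ p (a + 1) (s₁.setReg 11 (a + 1)) ∨
      IsFirst w p a := by
    intro hna
    by_cases hfa : IsFirst w p a
    · exact Or.inr hfa
    refine Or.inl ⟨hf₁.setReg (by omega) _, h.out, by simpa [hs₁] using r10, by simp,
      by omega, ?_, ?_, ?_, ?_⟩
    · intro hF b hb c hc hc1 hc2
      have : c ≠ a := by rintro rfl; exact hfa hc1
      simpa [hs₁] using h.upper hF b hb c (by omega) hc1 hc2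
    · intro hF b hb
      rcases h.attained hF b hb with h1 | ⟨c, h1, h2⟩
      · exact Or.inl (by simpa [hs₁] using h1)
      · exact Or.inr ⟨c, by omega, by simpa [hs₁] using h2⟩
    · intro hF b hb
      by_cases hba : b = a
      · subst hba; simp [hs₁, hna]
      · simpa [hs₁, hba] using h.isRec hF b (by omega)
    · intro hF b p' hp' hb
      simpa [hs₁] using h.later hF b p' hp' hb
  have hinc : ∀ s' : State, s'.reg 11 = a →
      (plus (.reg 11) (.const 1)).eval W s' = a + 1 := fun s' h =>
    eval_plus (eval_reg h) (eval_const (by omega)) (by omega)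
  have r11' : s₁.reg 11 = a := by simpa [hs₁] using r11
  have r10' : s₁.reg 10 = p := by simpa [hs₁] using r10
  simp only [recStep, wp_block_cons, wp_store, eval_reg r11, eval_const (show 0 < W by omega)]
  rw [← hs₁, wp_branch]
  have hg1 : (same (.read 3 tailCell) (.reg 10)).eval W s₁ ≠ 0 ↔ tailLen w (a + p) p = p := by
    rw [eval_same_ne_zero, v1, eval_reg r10']
  have hg2 : (same headE (.reg 10)).eval W s₁ ≠ 0 ↔ headLen w a p = p := by
    rw [eval_same_ne_zero, v3, eval_reg r10']
  have hg3 : (less (.read 9 idE) hiE).eval W s₁ ≠ 0 ↔ s.arr 9 (ident a p) < hi w p a := by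
    rw [eval_less_ne_zero, v2, RExpr.eval, v4, hs₁, setArr_arr, if_neg (by omega)]
  have hfin : ∀ {s' : State} {τ' : ℕ}, s'.reg 11 = a → τ' ≤ τ + 80 →
      RecInv w ident s₀ p (a + 1) (s'.setReg 11 (a + 1)) →
      WP W (block [.assign 11 (plus (.reg 11) (.const 1))])
        (fun s' τ' => τ' ≤ τ + 100 ∧ RecInv w ident s₀ p (a + 1) s') s' τ' := by
    intro s' τ' h1 h2 h3
    rw [wp_block_cons, wp_assign, wp_block_nil, hinc s' h1]
    exact ⟨by simp only [RExpr.cost]; omega, h3⟩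
  split_ifs with g1
  · rw [wp_branch]
    split_ifs with g2
    · rw [wp_skip]
      have hna : ¬ IsFirst w p a := fun hc => hc.head (hg2.1 g2)
      refine hfin r11' ?_ ?_
      · simp [RExpr.cost, cost_cellE, tailCell, headE]
      rcases hnot (fun hc => hna hc.1) with h1 | h1
      · exact h1
      · exact absurd h1 hna
    · have hfa : IsFirst w p a := ⟨hp, ha, hg1.1 g1, fun hc => g2 (hg2.2 hc)⟩
      have hrec : Faithful w ident → (IsRec w p a ↔ s.arr 9 (ident a p) < hi w p a) := by
        intro hF
        constructor
        · intro hc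
          rcases h.attained hF a ha with h1 | ⟨c, c1, c2, c3, c4⟩
          · have := hi_pos hfa; omega
          · rw [← c4]; exact hc.2 c c1 c2 c3
        · intro hlt
          exact ⟨hfa, fun c hc hc1 hc2 => lt_of_le_of_lt (h.upper hF a ha c hc hc1 hc2) hlt⟩
      rw [wp_branch]
      split_ifs with g3
      · have hlt := hg3.1 g3
        simp only [wp_block_cons (c := Cmd.store _ _ _), wp_block_nil, wp_store]
        rw [v4, v2, eval_reg (v := a) (by simpa using r11'), eval_const (by omega)]
        refine hfin (by simpa using r11')
          (by simp [RExpr.cost, cost_cellE, tailCell, headE, hiE, idE]) ?_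
        have hid : Faithful w ident → ∀ b p', 0 < p' → b + 2 * p' ≤ w.length →
            (ident b p' = ident a p ↔ pk w b (b + p') = pk w a (a + p)) :=
          fun hF b p' hp' hb => hF b p' a p hp' hp (by omega) (by omega)
        refine ⟨((hf₁.setArr (by simp) _ _).setArr (by simp) _ _).setReg (by omega) _, h.out,
          by simpa using r10', by simp, by omega, ?_, ?_, ?_, ?_⟩
        · intro hF b hb c hc hc1 hc2
          simp only [hs₁, setReg_arr, setArr_arr]
          simp only [show (9 : ℕ) ≠ 11 by omega, false_and, if_false, true_and, hid hF b p hp hb]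
          split_ifs with h1
          · rcases (show c < a ∨ c = a by omega) with h2 | h2
            · have := h.upper hF a ha c h2 hc1 (by rw [hc2, h1])
              omega
            · rw [h2]
          · rcases (show c < a ∨ c = a by omega) with h2 | h2
            · exact h.upper hF b hb c h2 hc1 hc2
            · rw [h2] at hc2; exact absurd hc2.symm h1
        · intro hF b hb
          simp only [hs₁, setReg_arr, setArr_arr]
          simp only [show (9 : ℕ) ≠ 11 by omega, false_and, if_false, true_and, hid hF b p hp hb]
          split_ifs with h1
          · exact Or.inr ⟨a, by omega, hfa, h1.symm, rfl⟩
          · rcases h.attained hF b hb with h1 | ⟨c, h1, h2⟩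
            · exact Or.inl h1
            · exact Or.inr ⟨c, by omega, h2⟩
        · intro hF b hb
          by_cases hba : b = a
          · subst hba; simp [(hrec hF).2 hlt]
          · simpa [hs₁, hba] using h.isRec hF b (by omega)
        · intro hF b p' hp' hb
          simp only [hs₁, setReg_arr, setArr_arr]
          simp only [show (9 : ℕ) ≠ 11 by omega, false_and, if_false, true_and,
            hid hF b p' (by omega) hb]
          rw [if_neg, h.later hF b p' hp' hb]
          intro hc
          -- Fragments of different lengths have vectors of different norms, so the cells for larger
          -- `p'` are not touched.
          have := congrArg norm hc
          rw [norm_window (by omega), norm_window (by omega)] at this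
          omega
      · have hge := fun hc => g3 (hg3.2 hc)
        rw [wp_skip]
        refine hfin r11' ?_ ?_
        · simp [RExpr.cost, cost_cellE, tailCell, headE, hiE, idE]
        refine ⟨hf₁.setReg (by omega) _, h.out, by simpa using r10', by simp, by omega,
          ?_, ?_, ?_, ?_⟩
        · intro hF b hb c hc hc1 hc2
          rcases (show c < a ∨ c = a by omega) with h2 | h2
          · simpa [hs₁] using h.upper hF b hb c h2 hc1 hc2
          · subst h2
            have := (hF c p b p hp hp (by omega) (by omega)).2 hc2
            simp only [hs₁, setReg_arr, setArr_arr]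
            simp only [show (9 : ℕ) ≠ 11 by omega, false_and, if_false, ← this]
            omega
        · intro hF b hb
          rcases h.attained hF b hb with h1 | ⟨c, h1, h2⟩
          · exact Or.inl (by simpa [hs₁] using h1)
          · exact Or.inr ⟨c, by omega, by simpa [hs₁] using h2⟩
        · intro hF b hb
          by_cases hba : b = a
          · subst hba
            have : ¬ IsRec w p b := fun hc => hge ((hrec hF).1 hc)
            simp [hs₁, this]
          · simpa [hs₁, hba] using h.isRec hF b (by omega)
        · intro hF b p' hp' hb
          simpa [hs₁] using h.later hF b p' hp' hb
  · rw [wp_skip]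
    have hna : ¬ IsFirst w p a := fun hc => g1 (hg1.2 hc.tail)
    refine hfin r11' ?_ ?_
    · simp [RExpr.cost, cost_cellE, tailCell]
    rcases hnot (fun hc => hna hc.1) with h1 | h1
    · exact h1
    · exact absurd h1 hna

/-- The words for the chains of the list `l` of pairs of a norm and a starting position. -/
noncomputable def outputOf (w : List (Fin σ)) (l : List (ℕ × ℕ)) : List ℕ :=
  (l.map fun x => tupleOf w x.1 x.2).flatMap RunTuple.words

theorem outputOf_concat (w : List (Fin σ)) (l : List (ℕ × ℕ)) (p a : ℕ) :
    outputOf w (l ++ [(p, a)]) = outputOf w l ++ (tupleOf w p a).words := by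
  simp [outputOf]

/-- `l` lists the chains that represent runs and satisfy `q`. -/
def Enumerates (w : List (Fin σ)) (q : ℕ → ℕ → Prop) (l : List (ℕ × ℕ)) : Prop :=
  l.Nodup ∧ ∀ p a, (p, a) ∈ l ↔ IsRep w p a ∧ q p a

theorem Enumerates.congr {q q' : ℕ → ℕ → Prop} {l : List (ℕ × ℕ)} (h : Enumerates w q l)
    (hq : ∀ p a, IsRep w p a → (q p a ↔ q' p a)) : Enumerates w q' l :=
  ⟨h.1, fun p a => (h.2 p a).trans (and_congr_right (hq p a))⟩

theorem Enumerates.concat {q q' : ℕ → ℕ → Prop} {l : List (ℕ × ℕ)} (h : Enumerates w q l)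
    {p a : ℕ} (hrep : IsRep w p a) (hpa : ¬ q p a)
    (hq : ∀ p' a', q' p' a' ↔ q p' a' ∨ (p' = p ∧ a' = a)) :
    Enumerates w q' (l ++ [(p, a)]) := by
  refine ⟨?_, fun p' a' => ?_⟩
  · rw [List.nodup_append]
    refine ⟨h.1, by simp, ?_⟩
    rintro x hx y hy rfl
    rw [List.mem_singleton] at hy
    subst hy
    exact hpa ((h.2 p a).1 hx).2
  · rw [List.mem_append, h.2, List.mem_singleton, Prod.mk.injEq, hq]
    constructor
    · rintro (⟨h1, h2⟩ | ⟨rfl, rfl⟩)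
      · exact ⟨h1, Or.inl h2⟩
      · exact ⟨hrep, Or.inr ⟨rfl, rfl⟩⟩
    · rintro ⟨h1, h2 | h2⟩
      · exact Or.inl ⟨h1, h2⟩
      · exact Or.inr h2

/-- The invariant of the second pass for `p`, before the positions below `a`. -/
structure EmitInv (w : List (Fin σ)) (ident : ℕ → ℕ → ℕ) (s₀ : State) (out : List ℕ) (p a : ℕ)
    (s : State) : Prop where
  frame : Frame [10] s₀ s
  reg_p : s.reg 10 = p
  reg_a : s.reg 11 = a
  lower : Faithful w ident → ∀ b, b + 2 * p ≤ w.length → ∀ c ≥ a, IsRec w p c →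
    pk w c (c + p) = pk w b (b + p) → s.arr 10 (ident b p) ≠ 0 ∧
      s.arr 10 (ident b p) ≤ lo w p c + 1
  attained : Faithful w ident → ∀ b, b + 2 * p ≤ w.length → s.arr 10 (ident b p) = 0 ∨
    ∃ c ≥ a, IsRec w p c ∧ pk w c (c + p) = pk w b (b + p) ∧
      lo w p c + 1 = s.arr 10 (ident b p)
  later : Faithful w ident → ∀ b p', p < p' → b + 2 * p' ≤ w.length → s.arr 10 (ident b p') = 0
  output : Faithful w ident → ∃ l, s.out = out ++ outputOf w l ∧
    Enumerates w (fun p' a' => p' < p ∨ p' = p ∧ a ≤ a') l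

/-- Scanning to the left, array `10` holds the left end of the nearest later record with the same
identifier. By monotonicity this is the least left end among the later records, so a single
comparison replaces the quantifier in `IsRep`. The left end is stored increased by one, to
distinguish it from an empty cell. -/
theorem emitStep_spec {ident : ℕ → ℕ → ℕ} (hW : Wide w.length σ W) {s₀ s : State}
    {out : List ℕ} {p a τ : ℕ} (h₀ : Tables w ident s₀) (hp : 0 < p)
    (ha : a + 2 * p ≤ w.length)
    (hrec : Faithful w ident → ∀ b ≤ a, (s₀.arr 11 b ≠ 0 ↔ IsRec w p b))
    (h : EmitInv w ident s₀ out p (a + 1) s) :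
    WP W emitStep (fun s' τ' => τ' ≤ τ + 200 ∧ EmitInv w ident s₀ out p a s') s τ := by
  have hlin := hW.lin
  have r10 := h.reg_p
  have r11 := h.reg_a
  simp only [emitStep, wp_block_cons (c := Cmd.assign _ _), wp_assign]
  rw [show (minus (.reg 11) (.const 1)).eval W s = a by
    simp only [RExpr.eval, BinOp.eval, r11]; rw [Nat.mod_eq_of_lt (by omega), Nat.add_sub_cancel]]
  set s₁ := s.setReg 11 a with hs₁
  have hf₁ : Frame [10] s₀ s₁ := by exact h.frame.setReg (by omega) _
  have hT : Tables w ident s₁ := h₀.frame hf₁ (by simp) (by simp) (by simp) (by simp) (by simp)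
  have r11' : s₁.reg 11 = a := by simp [hs₁]
  have r10' : s₁.reg 10 = p := by simpa [hs₁] using r10
  have a11 : s₁.arr 11 = s₀.arr 11 := hf₁.arr 11 (by simp)
  rw [wp_block_cons, wp_branch]
  have hg1 : Faithful w ident → ((RExpr.read 11 (.reg 11)).eval W s₁ ≠ 0 ↔ IsRec w p a) := by
    intro hF
    rw [RExpr.eval, eval_reg r11', a11]
    exact hrec hF a le_rfl
  have hqa : ∀ p' a', (p' < p ∨ p' = p ∧ a ≤ a') ↔
      (p' < p ∨ p' = p ∧ a + 1 ≤ a') ∨ (p' = p ∧ a' = a) := by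
    intro p' a'; omega
  have hskip : ∀ {l}, Enumerates w (fun p' a' => p' < p ∨ p' = p ∧ a + 1 ≤ a') l →
      ¬ IsRep w p a → Enumerates w (fun p' a' => p' < p ∨ p' = p ∧ a ≤ a') l := by
    intro l hl hna
    refine hl.congr fun p' a' hr => ?_
    have : ¬ (p' = p ∧ a' = a) := by rintro ⟨rfl, rfl⟩; exact hna hr
    omega
  split_ifs with g1
  -- Emitting changes only the output, so the expressions keep their values between the five
  -- emissions.
  · have hvals : ∀ o : List ℕ, ChainValues w ident W p a { s₁ with out := o } := fun o =>
      Tables.chainValues hW (h₀.frame (s' := { s₁ with out := o }) ⟨hf₁.reg, hf₁.arr⟩ (by simp)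
        (by simp) (by simp) (by simp) (by simp)) r10' r11' hp ha
    have hlo : ∀ o : List ℕ, (minus (.reg 11) headE).eval W { s₁ with out := o } = lo w p a := by
      intro o
      simp only [RExpr.eval, BinOp.eval, (hvals o).head]
      rw [r11', lo]
    have hlo1 : ∀ o : List ℕ, (plus (minus (.reg 11) headE) (.const 1)).eval W
        { s₁ with out := o } = lo w p a + 1 := fun o =>
      eval_plus (hlo o) (eval_const (by omega)) (by unfold lo; omega)
    have hid : Faithful w ident → ∀ b p', 0 < p' → b + 2 * p' ≤ w.length →
        (ident b p' = ident a p ↔ pk w b (b + p') = pk w a (a + p)) :=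
      fun hF b p' hp' hb => hF b p' a p hp' hp (by omega) (by omega)
    have hrep : Faithful w ident → (IsRep w p a ↔ s.arr 10 (ident a p) ≠ lo w p a + 1) := by
      intro hF
      have hra := (hg1 hF).1 g1
      constructor
      · intro hr hc
        rcases h.attained hF a ha with h1 | ⟨c, c1, c2, c3, c4⟩
        · omega
        · exact hr.2 c (by omega) c2 c3 (by omega)
      · intro hne
        refine ⟨hra, fun c hc hc1 hc2 hc3 => ?_⟩
        obtain ⟨h1, h2⟩ := h.lower hF a ha c hc hc1 hc2
        rcases h.attained hF a ha with h3 | ⟨d, d1, d2, d3, d4⟩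
        · exact h1 h3
        · have := lo_mono hra.1 d2.1 d3 (by omega)
          omega
    have hfin : ∀ {o : List ℕ} {τ' : ℕ}, τ' ≤ τ + 150 → (Faithful w ident →
        ∃ l, o = out ++ outputOf w l ∧
          Enumerates w (fun p' a' => p' < p ∨ p' = p ∧ a ≤ a') l) →
        WP W (block [.store 10 idE (plus (minus (.reg 11) headE) (.const 1))])
          (WP W (block []) (fun s' τ' => τ' ≤ τ + 200 ∧ EmitInv w ident s₀ out p a s'))
          { s₁ with out := o } τ' := by
      intro o τ' hτ' ho
      simp only [wp_block_cons, wp_block_nil, wp_store]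
      rw [hlo1, (hvals o).ident]
      refine ⟨by simp [RExpr.cost, cost_cellE, headE, idE]; omega, ?_⟩
      have hval : ∀ l, (({ s₁ with out := o } : State).setArr 10 (ident a p) (lo w p a + 1)).arr 10 l
          = if l = ident a p then lo w p a + 1 else s.arr 10 l := by
        intro l; simp [hs₁]
      refine ⟨?_, r10', r11', ?_, ?_, ?_, ho⟩
      · exact Frame.setArr (s := { s₁ with out := o }) ⟨hf₁.reg, hf₁.arr⟩ (by simp) _ _
      · intro hF b hb c hc hc1 hc2
        have hra := (hg1 hF).1 g1
        rw [hval]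
        simp only [hid hF b p hp hb]
        split_ifs with h1
        · exact ⟨by omega, by have := lo_mono hra.1 hc1.1 (by rw [hc2, h1]) hc; omega⟩
        · rcases (show a + 1 ≤ c ∨ c = a by omega) with h2 | h2
          · exact h.lower hF b hb c h2 hc1 hc2
          · rw [h2] at hc2; exact absurd hc2.symm h1
      · intro hF b hb
        rw [hval]
        simp only [hid hF b p hp hb]
        split_ifs with h1
        · exact Or.inr ⟨a, le_rfl, (hg1 hF).1 g1, h1.symm, rfl⟩
        · rcases h.attained hF b hb with h2 | ⟨c, c1, c2⟩
          · exact Or.inl h2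
          · exact Or.inr ⟨c, by omega, c2⟩
      · intro hF b p' hp' hb
        rw [hval]
        simp only [hid hF b p' (by omega) hb]
        rw [if_neg, h.later hF b p' hp' hb]
        intro hc
        have := congrArg norm hc
        rw [norm_window (by omega), norm_window (by omega)] at this
        omega
    have hg2 : (same (.read 10 idE) (plus (minus (.reg 11) headE) (.const 1))).eval W s₁ ≠ 0 ↔
        s.arr 10 (ident a p) = lo w p a + 1 := by
      rw [eval_same_ne_zero, hlo1 s₁.out, RExpr.eval, (hvals s₁.out).ident, hs₁]
      rfl
    rw [wp_block_cons, wp_branch]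
    split_ifs with g2
    · rw [wp_skip]
      refine hfin (o := s₁.out) (by simp [RExpr.cost, cost_cellE, headE, idE]) fun hF => ?_
      obtain ⟨l, h1, h2⟩ := h.output hF
      refine ⟨l, h1, hskip h2 fun hc => (hrep hF).1 hc (hg2.1 g2)⟩
    · simp only [wp_block_cons (c := Cmd.emit _), wp_emit, wp_block_nil]
      have e0 : (minus (.reg 11) headE).eval W s₁ = lo w p a := hlo s₁.out
      rw [e0]
      simp only [(hvals _).head, show ∀ o : List ℕ, (RExpr.op .mod (minus hiE (.reg 11)) (.reg 10)).eval
        W { s₁ with out := o } = (hi w p a - a) % p from fun o => by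
          simp only [RExpr.eval, BinOp.eval, (hvals o).hi]; rw [r11', r10'],
        show ∀ o : List ℕ, (minus hiE (.const 1)).eval W { s₁ with out := o } = hi w p a - 1 from
          fun o => by
            simp only [RExpr.eval, BinOp.eval, (hvals o).hi]; rw [Nat.mod_eq_of_lt (by omega)],
        show ∀ o : List ℕ, (RExpr.reg 10).eval W { s₁ with out := o } = p from fun o => r10']
      refine hfin (by simp [RExpr.cost, cost_cellE, tailCell, hiE, headE, idE])
        fun hF => ?_
      obtain ⟨l, h1, h2⟩ := h.output hF
      refine ⟨l ++ [(p, a)], ?_, h2.concat ((hrep hF).2 fun hc => g2 (hg2.2 hc)) (by omega) hqa⟩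
      rw [outputOf_concat, ← List.append_assoc, ← h1]
      simp [hs₁, RunTuple.words, tupleOf]
  · rw [wp_skip, wp_block_nil]
    refine ⟨by simp [RExpr.cost], hf₁, r10', r11', ?_, ?_, h.later, ?_⟩
    · intro hF b hb c hc hc1 hc2
      have : c ≠ a := by rintro rfl; exact g1 ((hg1 hF).2 hc1)
      exact h.lower hF b hb c (by omega) hc1 hc2
    · intro hF b hb
      rcases h.attained hF b hb with h2 | ⟨c, c1, c2⟩
      · exact Or.inl h2
      · exact Or.inr ⟨c, by omega, c2⟩
    · intro hF
      obtain ⟨l, h1, h2⟩ := h.output hF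
      exact ⟨l, h1, hskip h2 fun hc => g1 ((hg1 hF).2 hc.1)⟩

/-- For each `p` both passes are linear in `n`. The chains listed are those with smaller norm, and
at `p = n + 1` these are all chains. -/
theorem reportProg_spec {ident : ℕ → ℕ → ℕ} (hW : Wide w.length σ W) {s₀ : State} {τ₀ : ℕ}
    (h₀ : Tables w ident s₀) (h9 : ∀ l, s₀.arr 9 l = 0) (h10 : ∀ l, s₀.arr 10 l = 0)
    (hout : s₀.out = []) :
    WP W reportProg (fun s τ => τ ≤ τ₀ + 1500 * w.length ^ 2 ∧
      (Faithful w ident → ListsAllAbelianRuns w s.out)) s₀ τ₀ := by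
  have hpos := hW.pos
  have hlin := hW.lin
  rw [reportProg, wp_block_cons, wp_assign, eval_const (by omega), wp_block_cons]
  refine wp_loop (fun s τ => ∃ p, s.reg 10 = p ∧ 0 < p ∧ p ≤ w.length + 1 ∧
      τ ≤ τ₀ + 10 + (p - 1) * (400 * w.length + 400) ∧ Frame [9, 10, 11] s₀ s ∧
      (Faithful w ident → (∀ b p', p ≤ p' → b + 2 * p' ≤ w.length →
        s.arr 9 (ident b p') = 0 ∧ s.arr 10 (ident b p') = 0) ∧
        ∃ l, s.out = [] ++ outputOf w l ∧ Enumerates w (fun p' _ => p' < p) l))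
    (fun s => w.length + 1 - s.reg 10) ?_ ?_ ?_
  · refine ⟨1, by simp, by omega, by omega, by simp [RExpr.cost],
      (Frame.refl _ _).setReg (by omega) _, fun _ => ⟨fun _ _ _ _ => ⟨h9 _, h10 _⟩, [], ?_, ?_⟩⟩
    · simpa [outputOf] using hout
    · refine ⟨by simp, fun p a => ?_⟩
      have : IsRep w p a → 0 < p := fun h => h.1.1.pos
      simp
      exact fun h => (this h).ne'
  · rintro s τ ⟨p, r10, hp, hpn, hτ, hf, hg⟩ hcond
    have hT : Tables w ident s := h₀.frame hf (by simp) (by simp) (by simp) (by simp) (by simp)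
    have r0 := hT.holds.len
    rw [eval_less_ne_zero, eval_reg r10, eval_plus (eval_reg r0) (eval_const (by omega))
      (by omega)] at hcond
    rw [wp_block_cons, wp_assign, eval_const (by omega), wp_block_cons]
    set s₁ := s.setReg 11 0 with hs₁
    have hT₁ : Tables w ident s₁ := hT.frame (A := []) ((Frame.refl _ _).setReg (by omega) _)
      (by simp) (by simp) (by simp) (by simp) (by simp)
    have hguard : ∀ {s' : State} {a : ℕ}, RecInv w ident s₁ p a s' →
        ((less (plus (.reg 11) (times (.const 2) (.reg 10))) (plus (.reg 0) (.const 1))).eval W s' ≠ 0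
          ↔ a + 2 * p < w.length + 1) := by
      intro s' a h
      have hb := h.bound
      have r0' : s'.reg 0 = w.length := by rw [h.frame.reg 0 (by omega), hT₁.holds.len]
      rw [eval_less_ne_zero, eval_plus (x := a) (y := 2 * p) (eval_reg h.reg_a)
        (eval_times (eval_const (by omega)) (eval_reg h.reg_p) (by omega)) (by omega),
        eval_plus (eval_reg r0') (eval_const (by omega)) (by omega)]
    refine wp_loop (fun s' τ' => ∃ a, RecInv w ident s₁ p a s' ∧ τ' ≤ τ + 20 + a * 120)
      (fun s' => w.length + 1 - s'.reg 11) ?_ ?_ ?_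
    · refine ⟨0, ⟨Frame.refl _ _, rfl, by simpa [hs₁] using r10, by simp [hs₁], Or.inl rfl,
        by simp, ?_, by simp, ?_⟩, by simp [RExpr.cost]⟩
      · exact fun hF b hb => Or.inl ((hg hF).1 b p le_rfl hb).1
      · exact fun hF b p' hp' hb => ((hg hF).1 b p' hp'.le hb).1
    · rintro s' τ' ⟨a, hinv, hτ'⟩ hc
      rw [hguard hinv] at hc
      refine (recStep_spec hW hT₁ hp (by omega) hinv).mono ?_
      rintro s'' τ'' ⟨h1, h2⟩
      refine ⟨⟨a + 1, h2, ?_⟩, ?_⟩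
      · simp only [RExpr.cost] at h1; omega
      · rw [h2.reg_a, hinv.reg_a]; omega
    · rintro s₂ τ₂ ⟨a₂, hinv, hτ₂⟩ hc
      rw [← not_ne_iff, hguard hinv] at hc
      have ha₂ := hinv.bound
      have hT₂ : Tables w ident s₂ := hT₁.frame hinv.frame (by simp) (by simp) (by simp) (by simp)
        (by simp)
      -- The first pass stops only when two cores no longer fit, so it has visited the starts of all
      -- chains for `p`.
      have hfirst : ∀ c, IsFirst w p c → c < a₂ := fun c hc => by have := hc.le; omega
      rw [wp_block_cons]
      refine wp_loop (fun s' τ' => ∃ a ≤ a₂, EmitInv w ident s₂ [] p a s' ∧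
        τ' + a * 210 ≤ τ₂ + 20 + a₂ * 210) (fun s' => s'.reg 11) ?_ ?_ ?_
      · have e10 : s₂.arr 10 = s.arr 10 := hinv.frame.arr 10 (by simp)
        refine ⟨a₂, le_rfl, ⟨Frame.refl _ _, hinv.reg_p, hinv.reg_a, ?_, ?_, ?_, ?_⟩, ?_⟩
        · intro hF b hb c hc hc1
          have := hfirst c hc1.1; omega
        · exact fun hF b hb => Or.inl (by rw [e10]; exact ((hg hF).1 b p le_rfl hb).2)
        · exact fun hF b p' hp' hb => by rw [e10]; exact ((hg hF).1 b p' hp'.le hb).2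
        · intro hF
          obtain ⟨l, h1, h2⟩ := (hg hF).2
          refine ⟨l, by rw [hinv.out, ← h1]; rfl, h2.congr fun p' a' hr => ?_⟩
          have : p' = p → a' < a₂ := by rintro rfl; exact hfirst a' hr.1.1
          omega
        · simp only [RExpr.cost]; omega
      · rintro s' τ' ⟨a, haa, hE, hτ'⟩ hc
        rw [eval_reg hE.reg_a] at hc
        obtain ⟨b, rfl⟩ : ∃ b, a = b + 1 := ⟨a - 1, by omega⟩
        refine (emitStep_spec hW hT₂ hp (by omega)
          (fun hF c hc => hinv.isRec hF c (by omega)) hE).mono ?_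
        rintro s'' τ'' ⟨h1, h2⟩
        refine ⟨⟨b, by omega, h2, ?_⟩, ?_⟩
        · simp only [RExpr.cost] at h1; omega
        · rw [h2.reg_a, hE.reg_a]; omega
      · rintro s₃ τ₃ ⟨a, haa, hE, hτ₃⟩ hc
        rw [eval_reg hE.reg_a] at hc
        subst hc
        rw [wp_block_cons, wp_assign, wp_block_nil,
          eval_plus (eval_reg hE.reg_p) (eval_const (by omega)) (by omega)]
        refine ⟨⟨p + 1, by simp, by omega, by omega, ?_, ?_, fun hF => ⟨?_, ?_⟩⟩, ?_⟩
        · have h1 : (p + 1 - 1) * (400 * w.length + 400) =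
            (p - 1) * (400 * w.length + 400) + (400 * w.length + 400) := by
            obtain ⟨q, rfl⟩ : ∃ q, p = q + 1 := ⟨p - 1, by omega⟩
            simp only [Nat.add_sub_cancel]; ring
          simp only [RExpr.cost] at hτ₂ hτ₃ ⊢
          omega
        · refine Frame.setReg ?_ (by omega) _
          refine ⟨fun x hx => ?_, fun x hx => ?_⟩
          · rw [hE.frame.reg x hx, hinv.frame.reg x hx, hs₁, setReg_reg, if_neg (by omega),
              hf.reg x hx]
          · simp only [List.mem_cons, List.not_mem_nil, or_false, not_or] at hx
            rw [hE.frame.arr x (by simp [hx]), hinv.frame.arr x (by simp [hx]), hs₁, setReg_arr,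
              hf.arr x (by simp [hx])]
        · intro b p' hp' hb
          refine ⟨?_, hE.later hF b p' hp' hb⟩
          rw [setReg_arr, hE.frame.arr 9 (by simp)]
          exact hinv.later hF b p' hp' hb
        · obtain ⟨l, h1, h2⟩ := hE.output hF
          exact ⟨l, h1, h2.congr fun p' a' _ => by omega⟩
        · simp only [setReg_reg, if_true, r10]; omega
  · rintro s τ ⟨p, r10, hp, hpn, hτ, hf, hg⟩ hcond
    have r0 : s.reg 0 = w.length := by rw [hf.reg 0 (by omega), h₀.holds.len]
    rw [← not_ne_iff, eval_less_ne_zero, eval_reg r10, eval_plus (eval_reg r0)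
      (eval_const (by omega)) (by omega)] at hcond
    obtain rfl : p = w.length + 1 := by omega
    rw [wp_block_nil]
    refine ⟨?_, fun hF => ?_⟩
    · simp only [RExpr.cost, Nat.add_sub_cancel] at hτ ⊢
      nlinarith
    · obtain ⟨l, h1, h2⟩ := (hg hF).2
      rw [h1, List.nil_append]
      refine listsAllAbelianRuns_of_nodup w l h2.1 fun p a => ?_
      rw [h2.2]
      refine ⟨fun h => h.1, fun h => ⟨h, ?_⟩⟩
      have := h.1.1.le
      omega

end Report

/-! ### Reversal of the word, and assembly of the whole program. -/

section Preparation

variable {σ : ℕ} {w : List (Fin σ)} {W : ℕ}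

/-- Write the reversed word to the array `1`. -/
def reverseProg : Cmd :=
  block [
    .assign 10 (.const 0),
    .loop (less (.reg 10) (.reg 0)) (block [
      .store 1 (.reg 10) (.read 0 (minus (minus (.reg 0) (.const 1)) (.reg 10))),
      .assign 10 (plus (.reg 10) (.const 1))])]

/-- Compute the tables of tails for the word and for the reversed word. -/
def tablesProg : Cmd :=
  block [reverseProg, tailProg 0 2 3 4, tailProg 1 5 6 7]

theorem reverseProg_spec (hW : Wide w.length σ W) {s₀ : State} (h₀ : Holds w 0 s₀) {τ₀ : ℕ} :
    WP W reverseProg (fun s τ => τ ≤ τ₀ + 50 * w.length ^ 2 ∧ Frame [1] s₀ s ∧ s.out = s₀.out ∧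
      Holds w.reverse 1 s) s₀ τ₀ := by
  have hpos := hW.pos
  have hlin := hW.lin
  rw [reverseProg, wp_block_cons, wp_assign, eval_const (by omega), wp_block_cons]
  refine wp_loop (fun s τ => Frame [1] s₀ s ∧ s.out = s₀.out ∧ τ + (w.length - s.reg 10) * 20 ≤
      τ₀ + 5 + w.length * 20 ∧ s.reg 10 ≤ w.length ∧
      ∀ k (hk : k < w.reverse.length), k < s.reg 10 → s.arr 1 k = w.reverse[k])
    (fun s => w.length - s.reg 10) ?_ ?_ ?_
  · exact ⟨(Frame.refl _ _).setReg (by omega) _, rfl, by simp [RExpr.cost], by simp,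
      by simp⟩
  · rintro s τ ⟨hf, ho, hτ, hle, hk⟩ hc
    have hH := h₀.frame hf (by simp)
    have r0 := hH.len
    rw [eval_less_ne_zero, eval_reg (x := 10) rfl, eval_reg r0] at hc
    simp only [wp_block_cons, wp_block_nil, wp_store, wp_assign]
    have e10 : ∀ l v, (plus (.reg 10) (.const 1)).eval W (s.setArr 1 l v) = s.reg 10 + 1 :=
      fun l v => eval_plus (eval_reg rfl) (eval_const (by omega)) (by omega)
    rw [eval_reg (x := 10) (v := s.reg 10) rfl, e10]
    have hv : (RExpr.read 0 (minus (minus (.reg 0) (.const 1)) (.reg 10))).eval W s =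
        w[w.length - 1 - s.reg 10] := by
      rw [← hH.letter]
      simp only [RExpr.eval, BinOp.eval, r0]
      rw [Nat.mod_eq_of_lt (by omega)]
    rw [hv]
    simp only [setReg_reg, if_true]
    refine ⟨⟨(hf.setArr (by simp) _ _).setReg (by omega) _, ho,
      by simp only [RExpr.cost] at hτ ⊢; omega, by omega, fun k hkl hks => ?_⟩, by omega⟩
    simp only [setReg_arr, setArr_arr, true_and]
    split_ifs with h
    · subst h; simp
    · exact hk k hkl (by omega)
  · rintro s τ ⟨hf, ho, hτ, hle, hk⟩ hc
    have hH := h₀.frame hf (by simp)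
    rw [← not_ne_iff, eval_less_ne_zero, eval_reg (x := 10) rfl, eval_reg hH.len] at hc
    rw [wp_block_nil]
    refine ⟨?_, hf, ho, ⟨by rw [hH.len, List.length_reverse], hH.alph,
      by rw [hH.succ, List.length_reverse], fun k hkl => hk k hkl ?_⟩⟩
    · simp only [RExpr.cost] at hτ ⊢
      nlinarith
    · rw [List.length_reverse] at hkl
      omega

theorem tablesProg_spec (hW : Wide w.length σ W) {s₀ : State} (h₀ : Holds w 0 s₀)
    (h2 : ∀ l, s₀.arr 2 l = 0) (h5 : ∀ l, s₀.arr 5 l = 0) {ident : ℕ → ℕ → ℕ}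
    (h8 : ∀ a p, 0 < p → a + 2 * p ≤ w.length → s₀.arr 8 (cell (w.length + 1) a p) = ident a p)
    {τ₀ : ℕ} :
    WP W tablesProg (fun s τ => τ ≤ τ₀ + 1100 * w.length ^ 2 ∧ Frame [1, 2, 3, 4, 5, 6, 7] s₀ s ∧
      s.out = s₀.out ∧ Tables w ident s) s₀ τ₀ := by
  have hpos := hW.pos
  have hsub : ∀ {A : List ℕ} {s s' : State}, A ⊆ [1, 2, 3, 4, 5, 6, 7] → Frame A s s' →
      Frame [1, 2, 3, 4, 5, 6, 7] s s' := fun hA hf => ⟨hf.reg, fun a ha => hf.arr a fun h => ha (hA h)⟩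
  have hWr : Wide w.reverse.length σ W := by rwa [List.length_reverse]
  simp only [tablesProg, wp_block_cons (c := reverseProg)]
  refine (reverseProg_spec hW h₀).mono ?_
  rintro s₁ τ₁ ⟨t₁, f₁, o₁, H₁⟩
  rw [wp_block_cons]
  refine (tailProg_spec (by simp) (by simp) (by simp) (by simp) (by simp) (by simp) hW
    (h₀.frame f₁ (by simp)) (fun l => by rw [f₁.arr 2 (by simp)]; exact h2 l)).mono ?_
  rintro s₂ τ₂ ⟨t₂, f₂, o₂, T₂⟩
  rw [wp_block_cons]
  refine (tailProg_spec (by simp) (by simp) (by simp) (by simp) (by simp) (by simp) hWr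
    (H₁.frame f₂ (by simp))
    (fun l => by rw [f₂.arr 5 (by simp), f₁.arr 5 (by simp)]; exact h5 l)).mono ?_
  rintro s₃ τ₃ ⟨t₃, f₃, o₃, T₃⟩
  rw [wp_block_nil]
  rw [List.length_reverse] at t₃
  have hf := ((hsub (by simp) f₁).trans (hsub (by simp) f₂)).trans (hsub (by simp) f₃)
  have hsq : 1 ≤ w.length ^ 2 := Nat.one_le_pow _ _ hpos
  refine ⟨by omega, hf, by rw [o₃, o₂, o₁], h₀.frame hf (by simp), ?_, ?_, ?_, ?_⟩
  · intro a p hp ha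
    rw [f₃.arr 3 (by simp)]
    exact (T₂ (a + p) p (by omega) (by omega) (by omega)).1
  · intro a p hp ha
    rw [f₃.arr 4 (by simp)]
    exact (T₂ (a + p) p (by omega) (by omega) (by omega)).2 hp
  · intro a p hp ha
    -- The start `a` of a core becomes the end `w.length - a` of a core in the reversed word.
    have := (T₃ (w.length - a) p (by omega) (by rw [List.length_reverse]; omega) (by omega)).1
    rw [List.length_reverse] at this
    rw [this, headLen_eq_tailLen_reverse w (by omega)]
  · intro a p hp ha
    rw [hf.arr 8 (by simp)]
    exact h8 a p hp ha

/-- The whole program, with the part `idProg` that computes identifiers. -/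
def runsProg (idProg : Cmd) : Cmd :=
  block [.assign 2 (plus (.reg 0) (.const 1)), idProg, tablesProg, reportProg]

/-- The predicate `q` lets both programs share this proof: for the randomized one it fixes the
identifiers as a function of the tape, for the deterministic one it is `Faithful`. -/
theorem runsProg_spec (hW : Wide w.length σ W) {idProg : Cmd} {tape : List ℕ}
    {q : (ℕ → ℕ → ℕ) → Prop} {N : ℕ}
    (hid : ∀ τ₀ : ℕ, ∀ s₀ : State, Holds w 0 s₀ → (∀ a ≠ 0, ∀ l, s₀.arr a l = 0) → s₀.tape = tape →
      WP W idProg (fun s τ => τ ≤ τ₀ + N ∧ Frame [8, 12, 13] s₀ s ∧ s.out = s₀.out ∧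
        ∃ ident, q ident ∧ ∀ a p, 0 < p → a + p ≤ w.length →
          s.arr 8 (cell (w.length + 1) a p) = ident a p) s₀ τ₀) :
    WP W (runsProg idProg) (fun s τ => τ ≤ N + 3000 * w.length ^ 2 ∧
      ∃ ident, q ident ∧ (Faithful w ident → ListsAllAbelianRuns w s.out)) (inputState w tape) 0 := by
  have hpos := hW.pos
  have hlin := hW.lin
  have hsq : 1 ≤ w.length ^ 2 := Nat.one_le_pow _ _ hpos
  rw [runsProg, wp_block_cons, wp_assign,
    eval_plus (x := w.length) (y := 1) rfl (eval_const (by omega)) (by omega)]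
  set s₁ := (inputState w tape).setReg 2 (w.length + 1) with hs₁
  have H₁ : Holds w 0 s₁ := ⟨by simp [hs₁, inputState], by simp [hs₁, inputState],
    by simp [hs₁], fun k hk => by simp [hs₁, inputState, hk]⟩
  have Z₁ : ∀ a ≠ 0, ∀ l, s₁.arr a l = 0 := fun a ha l => by simp [hs₁, inputState, ha]
  rw [wp_block_cons]
  refine (hid _ s₁ H₁ Z₁ (by simp [hs₁, inputState])).mono ?_
  rintro s₂ τ₂ ⟨t₂, f₂, o₂, ident, hq, h₂⟩
  rw [wp_block_cons]
  refine (tablesProg_spec hW (H₁.frame f₂ (by simp))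
    (fun l => by rw [f₂.arr 2 (by simp)]; exact Z₁ 2 (by omega) l)
    (fun l => by rw [f₂.arr 5 (by simp)]; exact Z₁ 5 (by omega) l)
    (fun a p hp ha => h₂ a p hp (by omega))).mono ?_
  rintro s₃ τ₃ ⟨t₃, f₃, o₃, T₃⟩
  rw [wp_block_cons]
  refine (reportProg_spec hW T₃
    (fun l => by rw [f₃.arr 9 (by simp), f₂.arr 9 (by simp)]; exact Z₁ 9 (by omega) l)
    (fun l => by rw [f₃.arr 10 (by simp), f₂.arr 10 (by simp)]; exact Z₁ 10 (by omega) l)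
    (by rw [o₃, o₂]; rfl)).mono ?_
  rintro s₄ τ₄ ⟨t₄, L₄⟩
  rw [wp_block_nil]
  refine ⟨?_, ident, hq, L₄⟩
  simp only [RExpr.cost] at t₂
  omega

end Preparation

/-! ### Random weights of letters as identifiers. -/

section Random

variable {σ : ℕ} {w : List (Fin σ)} {W : ℕ}

/-- Draw a weight for each letter, and compute the weights of all fragments modulo the number of
words. -/
def randomProg : Cmd :=
  block [
    .assign 10 (.const 0),
    .loop (less (.reg 10) (.reg 0)) (block [
      .draw 11,
      .store 12 (.read 0 (.reg 10)) (.reg 11),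
      .assign 10 (plus (.reg 10) (.const 1))]),
    .assign 10 (.const 0),
    .loop (less (.reg 10) (.reg 0)) (block [
      .assign 11 (.const 0),
      .assign 12 (.const 0),
      .loop (less (plus (.reg 10) (.reg 11)) (.reg 0)) (block [
        .assign 12 (plus (.reg 12) (.read 12 (.read 0 (plus (.reg 10) (.reg 11))))),
        .assign 11 (plus (.reg 11) (.const 1)),
        .store 8 (cellE (.reg 2) (.reg 10) (.reg 11)) (.reg 12)]),
      .assign 10 (plus (.reg 10) (.const 1))])]

/-- The weights of the letters after the numbers `x 0, …, x (k - 1)` have been drawn. -/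
def weight (w : List (Fin σ)) (x : ℕ → ℕ) : ℕ → Fin σ → ℕ
  | 0, _ => 0
  | k + 1, b => if w[k]? = some b then x k else weight w x k b

/-- The weight of a Parikh vector modulo `W`. -/
def weightSum (w : List (Fin σ)) (W : ℕ) (x : ℕ → ℕ) (P : Fin σ → ℕ) : ℕ :=
  (∑ b, P b * weight w x w.length b) % W

theorem weightSum_succ (x : ℕ → ℕ) {a j : ℕ} (ha : a ≤ j) (hj : j < w.length) :
    (weightSum w W x (pk w a j) + weight w x w.length w[j]) % W =
      weightSum w W x (pk w a (j + 1)) := by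
  unfold weightSum
  rw [Nat.mod_add_mod]
  congr 1
  simp only [pk_succ_apply w ha hj, add_mul, Finset.sum_add_distrib]
  simp

/-- A number is drawn for each position, not for each letter of the alphabet, which keeps the time
independent of `σ`. Later draws overwrite earlier ones; letters that do not occur keep the weight
`0`, which does no harm as their counts vanish. -/
theorem randomProg_spec (hW : Wide w.length σ W) {s₀ : State} (h₀ : Holds w 0 s₀)
    (h12 : ∀ l, s₀.arr 12 l = 0) (x : ℕ → ℕ)
    (htape : ∀ k < w.length, ∃ rest, s₀.tape.drop k = x k :: rest) {τ₀ : ℕ} :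
    WP W randomProg (fun s τ => τ ≤ τ₀ + 200 * w.length ^ 2 ∧ Frame [8, 12, 13] s₀ s ∧
      s.out = s₀.out ∧ ∀ a p, 0 < p → a + p ≤ w.length →
        s.arr 8 (cell (w.length + 1) a p) = weightSum w W x (pk w a (a + p))) s₀ τ₀ := by
  have hpos := hW.pos
  have hlin := hW.lin
  rw [randomProg, wp_block_cons, wp_assign, eval_const (by omega), wp_block_cons]
  refine wp_loop (fun s τ => ∃ k ≤ w.length, Frame [8, 12, 13] s₀ s ∧ s.out = s₀.out ∧
      τ ≤ τ₀ + 5 + k * 20 ∧ s.reg 10 = k ∧ s.tape = s₀.tape.drop k ∧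
      ∀ b : Fin σ, s.arr 12 b = weight w x k b)
    (fun s => w.length - s.reg 10) ?_ ?_ ?_
  · exact ⟨0, by omega, (Frame.refl _ _).setReg (by omega) _, rfl, by simp [RExpr.cost],
      by simp, by simp, fun b => h12 _⟩
  · rintro s τ ⟨k, hk, hf, ho, hτ, r10, ht, hb⟩ hc
    have hH := h₀.frame hf (by simp)
    rw [eval_less_ne_zero, eval_reg r10, eval_reg hH.len] at hc
    obtain ⟨rest, hrest⟩ := htape k hc
    rw [← ht] at hrest
    rw [wp_block_cons, wp_draw hrest]
    simp only [wp_block_cons, wp_block_nil, wp_store, wp_assign]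
    set s₁ : State := { s.setReg 11 (x k) with tape := rest } with hs₁
    have r10' : s₁.reg 10 = k := by simpa [hs₁] using r10
    have hv : (RExpr.read 0 (.reg 10)).eval W s₁ = w[k] := by
      rw [RExpr.eval, eval_reg r10', ← hH.letter k hc]; rfl
    have e10 : ∀ l v, (plus (.reg 10) (.const 1)).eval W (s₁.setArr 12 l v) = k + 1 :=
      fun l v => eval_plus (eval_reg r10') (eval_const (by omega)) (by omega)
    rw [hv, eval_reg (x := 11) (v := x k) (by simp [hs₁]), e10]
    refine ⟨⟨k + 1, hc, ?_, ho, ?_, by simp, ?_, fun b => ?_⟩, by simp [r10]; omega⟩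
    · refine Frame.setReg (Frame.setArr ?_ (by simp) _ _) (by omega) _
      have := hf.setReg (show 10 ≤ 11 by omega) (x k)
      exact ⟨this.reg, this.arr⟩
    · simp only [RExpr.cost] at hτ ⊢; omega
    · change rest = _
      have h1 := congrArg List.tail hrest
      rw [ht, List.tail_drop] at h1
      exact h1.symm
    · have h1 : s₁.arr 12 b = weight w x k b := hb b
      simp only [setReg_arr, setArr_arr, true_and, weight, h1, List.getElem?_eq_getElem hc,
        Option.some.injEq, Fin.val_inj, eq_comm]
  · rintro s τ ⟨k, hk, hf, ho, hτ, r10, ht, hb⟩ hc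
    have hH := h₀.frame hf (by simp)
    rw [← not_ne_iff, eval_less_ne_zero, eval_reg r10, eval_reg hH.len] at hc
    obtain rfl : k = w.length := by omega
    rw [wp_block_cons, wp_assign, eval_const (by omega), wp_block_cons]
    refine wp_loop (fun s' τ' => ∃ a ≤ w.length, Frame [8, 12, 13] s₀ s' ∧ s'.out = s₀.out ∧
        τ' ≤ τ + 10 + a * (40 * w.length + 40) ∧ s'.reg 10 = a ∧ s'.arr 12 = s.arr 12 ∧
        ∀ a' < a, ∀ p, 0 < p → a' + p ≤ w.length → s'.arr 8 (cell (w.length + 1) a' p) =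
          weightSum w W x (pk w a' (a' + p)))
      (fun s => w.length - s.reg 10) ?_ ?_ ?_
    · exact ⟨0, by omega, hf.setReg (by omega) _, ho, by simp [RExpr.cost],
        by simp, rfl, by simp⟩
    · rintro s₁ τ₁ ⟨a, ha, f₁, o₁, t₁, r₁, a₁, i₁⟩ hc
      have H₁ := h₀.frame f₁ (by simp)
      rw [eval_less_ne_zero, eval_reg r₁, eval_reg H₁.len] at hc
      simp only [wp_block_cons (c := Cmd.assign _ _), wp_assign]
      rw [eval_const (by omega), eval_const (by omega), wp_block_cons]
      refine wp_loop (fun s' τ' => ∃ p, a + p ≤ w.length ∧ Frame [8, 12, 13] s₀ s' ∧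
          s'.out = s₀.out ∧ τ' ≤ τ₁ + 15 + p * 40 ∧ s'.reg 10 = a ∧ s'.reg 11 = p ∧
          s'.reg 12 = weightSum w W x (pk w a (a + p)) ∧ s'.arr 12 = s.arr 12 ∧
          ∀ a' p', (a' < a ∨ a' = a ∧ p' ≤ p) → 0 < p' → a' + p' ≤ w.length →
            s'.arr 8 (cell (w.length + 1) a' p') = weightSum w W x (pk w a' (a' + p')))
        (fun s => w.length - s.reg 11) ?_ ?_ ?_
      · refine ⟨0, by omega, (f₁.setReg (by omega) _).setReg (by omega) _, o₁,
          by simp [RExpr.cost], by simpa using r₁, by simp, ?_, a₁, ?_⟩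
        · simp [pk_self, weightSum]
        · intro a' p' h1 h2 h3
          exact i₁ a' (by omega) p' h2 h3
      · rintro s₂ τ₂ ⟨p, hp, f₂, o₂, t₂, r10₂, r11₂, r12₂, a₂, i₂⟩ hc₂
        have H₂ := h₀.frame f₂ (by simp)
        have hap : (plus (.reg 10) (.reg 11)).eval W s₂ = a + p :=
          eval_plus r10₂ r11₂ (by omega)
        rw [eval_less_ne_zero, hap, eval_reg H₂.len] at hc₂
        simp only [wp_block_cons, wp_block_nil, wp_store, wp_assign]
        have hv : (plus (.reg 12) (.read 12 (.read 0 (plus (.reg 10) (.reg 11))))).eval W s₂ =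
            weightSum w W x (pk w a (a + p + 1)) := by
          rw [← weightSum_succ x (by omega) hc₂, ← hb, ← a₂, ← H₂.letter _ hc₂, ← r12₂, ← hap]
          rfl
        rw [hv]
        set v := weightSum w W x (pk w a (a + p + 1)) with hvdef
        have e11 : (plus (.reg 11) (.const 1)).eval W (s₂.setReg 12 v) = p + 1 :=
          eval_plus (eval_reg (by simpa using r11₂)) (eval_const (by omega)) (by omega)
        rw [e11, eval_cellE (eval_reg (by simpa using H₂.succ)) (eval_reg (by simpa using r10₂))
          (eval_reg (v := p + 1) (by simp)) (hW.cell_sq (by omega) (by omega)),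
          eval_reg (x := 12) (v := v) (by simp)]
        refine ⟨⟨p + 1, by omega, ?_, o₂, ?_, by simpa using r10₂, by simp, by simp [hvdef, add_assoc],
          by rw [← a₂]; funext l; simp, ?_⟩, by simp [r11₂]; omega⟩
        · exact ((f₂.setReg (by omega) _).setReg (by omega) _).setArr (by simp) _ _
        · simp only [RExpr.cost, cost_cellE] at t₂ ⊢; omega
        · intro a' p' h1 h2 h3
          simp only [setReg_arr, setArr_arr, true_and,
            cell_inj (show p' < w.length + 1 by omega) (show p + 1 < w.length + 1 by omega)]
          split_ifs with h
          · rw [h.1, h.2, hvdef, add_assoc]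
          · exact i₂ a' p' (by omega) h2 h3
      · rintro s₂ τ₂ ⟨p, hp, f₂, o₂, t₂, r10₂, r11₂, r12₂, a₂, i₂⟩ hc₂
        have H₂ := h₀.frame f₂ (by simp)
        have hap : (plus (.reg 10) (.reg 11)).eval W s₂ = a + p :=
          eval_plus r10₂ r11₂ (by omega)
        rw [← not_ne_iff, eval_less_ne_zero, hap, eval_reg H₂.len] at hc₂
        rw [wp_block_cons, wp_assign, wp_block_nil,
          eval_plus (eval_reg r10₂) (eval_const (by omega)) (by omega)]
        refine ⟨⟨a + 1, by omega, f₂.setReg (by omega) _, o₂, ?_, by simp, a₂, ?_⟩,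
          by simp [r₁]; omega⟩
        · have : (a + 1) * (40 * w.length + 40) = a * (40 * w.length + 40) +
            (40 * w.length + 40) := by ring
          simp only [RExpr.cost] at t₁ t₂ ⊢; omega
        · intro a' ha' p' h2 h3
          exact i₂ a' p' (by omega) h2 h3
    · rintro s₁ τ₁ ⟨a, ha, f₁, o₁, t₁, r₁, a₁, i₁⟩ hc
      have H₁ := h₀.frame f₁ (by simp)
      rw [← not_ne_iff, eval_less_ne_zero, eval_reg r₁, eval_reg H₁.len] at hc
      obtain rfl : a = w.length := by omega
      rw [wp_block_nil]
      refine ⟨?_, f₁, o₁, fun a p hp hap => i₁ a (by omega) p hp hap⟩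
      simp only [RExpr.cost] at hτ t₁ ⊢
      nlinarith

end Random

/-! ### Probability of collisions. -/

section Probability

variable {σ : ℕ} {w : List (Fin σ)} {W T : ℕ}

/-- The draw at the last occurrence of a letter survives, so its weight is a single coordinate of
the tape. -/
theorem exists_last_occurrence (w : List (Fin σ)) (b : Fin σ) : ∀ k, (∃ j < k, w[j]? = some b) →
    ∃ κ < k, w[κ]? = some b ∧ ∀ x, weight w x k b = x κ := by
  intro k
  induction k with
  | zero => simp
  | succ k ih =>
    rintro ⟨j, hj, hjb⟩
    by_cases h : w[k]? = some b
    · exact ⟨k, by omega, h, fun x => by simp [weight, h]⟩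
    · have hjk : j < k := lt_of_le_of_ne (by omega) (by rintro rfl; exact h hjb)
      obtain ⟨κ, h1, h2, h3⟩ := ih ⟨j, hjk, hjb⟩
      exact ⟨κ, by omega, h2, fun x => by rw [weight, if_neg h, h3]⟩

theorem weight_congr {b : Fin σ} {κ : ℕ} (hκ : w[κ]? ≠ some b) {x x' : ℕ → ℕ}
    (hx : ∀ j ≠ κ, x j = x' j) : ∀ k, weight w x k b = weight w x' k b := by
  intro k
  induction k with
  | zero => rfl
  | succ k ih =>
    rw [weight, weight, ih]
    split_ifs with h
    · exact hx k (by rintro rfl; exact hκ h)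
    · rfl

/-- The numbers on a random tape. -/
def tapeFun (ω : Fin T → Fin W) (k : ℕ) : ℕ := if h : k < T then ω ⟨k, h⟩ else 0

theorem drop_tapeOf (ω : Fin T → Fin W) {k : ℕ} (hk : k < T) :
    ∃ rest, (tapeOf ω).drop k = tapeFun ω k :: rest := by
  refine ⟨(tapeOf ω).drop (k + 1), ?_⟩
  rw [List.drop_eq_getElem_cons (by simpa [tapeOf] using hk)]
  simp [tapeOf, tapeFun, hk]

/-- With all coordinates but `κ` fixed, the numbers `d * ω κ` have one residue modulo `W`, and they
are below `d * W`. So the quotient by `W`, which has `d` possible values, determines `ω κ`. It does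
not matter that `W` is not a prime. -/
theorem card_mul_le_of_congr (κ : Fin T) {d : ℕ} {B : (Fin T → Fin W) → Prop} [DecidablePred B]
    (hd : 0 < d)
    (hB : ∀ ω ω', B ω → B ω' → (∀ j ≠ κ, ω j = ω' j) → d * ω κ ≡ d * ω' κ [MOD W]) :
    (Finset.univ.filter B).card * W ≤ d * W ^ T := by
  classical
  have key : (Finset.univ.filter B).card ≤ d * W ^ (T - 1) := by
    refine (Finset.card_le_mul_card_image (f := fun ω (j : {j : Fin T // j ≠ κ}) => ω j) _ d
      fun g _ => ?_).trans (Nat.mul_le_mul_left d ?_)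
    · rw [← Finset.card_range d]
      refine Finset.card_le_card_of_injOn (fun ω => d * ω κ / W) ?_ ?_
      · intro ω _
        simp only [Finset.coe_range, Set.mem_Iio]
        exact Nat.div_lt_of_lt_mul (by rw [mul_comm]; exact Nat.mul_lt_mul_of_pos_right (ω κ).2 hd)
      · intro ω hω ω' hω' h
        simp only [Finset.coe_filter, Set.mem_ofPred_eq, Finset.mem_filter, Finset.mem_univ,
          true_and] at hω hω'
        have hj : ∀ j ≠ κ, ω j = ω' j := fun j hj =>
          congrFun (hω.2.trans hω'.2.symm) ⟨j, hj⟩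
        have h1 : d * ω κ = d * ω' κ := by
          rw [← Nat.div_add_mod (d * ω κ) W, ← Nat.div_add_mod (d * ω' κ) W]
          rw [show d * ω κ / W = d * ω' κ / W from h, hB ω ω' hω.1 hω'.1 hj]
        funext j
        by_cases hjκ : j = κ
        · subst hjκ
          exact Fin.ext (Nat.eq_of_mul_eq_mul_left hd h1)
        · exact hj j hjκ
    · refine (Finset.card_le_univ _).trans ?_
      simp [Fintype.card_subtype_compl]
  have hT : 0 < T := by have := κ.2; omega
  calc _ ≤ d * W ^ (T - 1) * W := Nat.mul_le_mul_right W key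
    _ = d * W ^ T := by rw [mul_assoc, ← pow_succ, Nat.sub_add_cancel hT]

/-- Choose a letter in which the two vectors differ. A collision is a linear congruence for the
weight of this letter, whose coefficient is the difference of the two counts and hence at most `n`;
the weights of the other letters do not depend on that coordinate of the tape. -/
theorem card_collision_mul_le (hT : w.length ≤ T) {a a' j j' : ℕ} (hj : j ≤ w.length)
    (hj' : j' ≤ w.length) (hne : pk w a j ≠ pk w a' j') :
    (Finset.univ.filter fun ω : Fin T → Fin W => weightSum w W (tapeFun ω) (pk w a j) =
      weightSum w W (tapeFun ω) (pk w a' j')).card * W ≤ w.length * W ^ T := by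
  obtain ⟨b, hb⟩ := Function.ne_iff.1 hne
  have hP := pk_apply_le w (i := a) hj b
  have hQ := pk_apply_le w (i := a') hj' b
  have hocc : ∃ k < w.length, w[k]? = some b := by
    have hmem : b ∈ w := by
      rcases (show 0 < pk w a j b ∨ 0 < pk w a' j' b by omega) with h | h
      · exact List.mem_of_mem_take (List.mem_of_mem_drop (List.count_pos_iff.1 h))
      · exact List.mem_of_mem_take (List.mem_of_mem_drop (List.count_pos_iff.1 h))
    obtain ⟨k, hk, hkb⟩ := List.getElem_of_mem hmem
    exact ⟨k, hk, by rw [List.getElem?_eq_getElem hk, hkb]⟩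
  obtain ⟨κ, hκ, hκb, hlast⟩ := exists_last_occurrence w b _ hocc
  have hexp : ∀ (x : ℕ → ℕ) (P : Fin σ → ℕ), ((∑ c, P c * weight w x w.length c : ℕ) : ZMod W) =
      P b * x κ + ∑ c ∈ Finset.univ.erase b, (P c : ZMod W) * (weight w x w.length c : ℕ) := by
    intro x P
    rw [← Finset.add_sum_erase _ _ (Finset.mem_univ b), hlast]
    push_cast
    rfl
  have hcongr : ∀ ω ω' : Fin T → Fin W, (∀ j ≠ (⟨κ, by omega⟩ : Fin T), ω j = ω' j) →
      ∀ P : Fin σ → ℕ, ∑ c ∈ Finset.univ.erase b,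
        (P c : ZMod W) * (weight w (tapeFun ω) w.length c : ℕ) =
        ∑ c ∈ Finset.univ.erase b, (P c : ZMod W) * (weight w (tapeFun ω') w.length c : ℕ) := by
    intro ω ω' h P
    refine Finset.sum_congr rfl fun c hc => ?_
    rw [weight_congr (κ := κ) (x' := tapeFun ω')]
    · rw [hκb]
      simpa [eq_comm] using Finset.ne_of_mem_erase hc
    · intro k hk
      unfold tapeFun
      split_ifs with hkT
      · rw [h ⟨k, hkT⟩ (by simpa [Fin.ext_iff] using hk)]
      · rfl
  have hval : ∀ ω : Fin T → Fin W, tapeFun ω κ = ω ⟨κ, by omega⟩ := fun ω => by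
    simp [tapeFun, show κ < T by omega]
  have hmod : ∀ ω : Fin T → Fin W, weightSum w W (tapeFun ω) (pk w a j) =
      weightSum w W (tapeFun ω) (pk w a' j') →
      ((∑ c, pk w a j c * weight w (tapeFun ω) w.length c : ℕ) : ZMod W) =
      ((∑ c, pk w a' j' c * weight w (tapeFun ω) w.length c : ℕ) : ZMod W) := fun ω h =>
    (ZMod.natCast_eq_natCast_iff _ _ _).2 h
  -- The coefficient is a natural number, so the smaller count is subtracted from the larger one.
  rcases lt_or_gt_of_ne hb with hlt | hlt
  · refine (card_mul_le_of_congr (W := W) (⟨κ, by omega⟩ : Fin T) (d := pk w a' j' b - pk w a j b) (by omega)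
      fun ω ω' h h' hag => ?_).trans (Nat.mul_le_mul_right _
        (show pk w a' j' b - pk w a j b ≤ w.length by omega))
    have h1 := hmod ω h
    have h2 := hmod ω' h'
    rw [hexp, hexp] at h1 h2
    rw [← hcongr ω ω' hag, ← hcongr ω ω' hag] at h2
    rw [← ZMod.natCast_eq_natCast_iff, ← hval, ← hval]
    push_cast [Nat.cast_sub hlt.le]
    linear_combination h2 - h1
  · refine (card_mul_le_of_congr (W := W) (⟨κ, by omega⟩ : Fin T) (d := pk w a j b - pk w a' j' b) (by omega)
      fun ω ω' h h' hag => ?_).trans (Nat.mul_le_mul_right _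
        (show pk w a j b - pk w a' j' b ≤ w.length by omega))
    have h1 := hmod ω h
    have h2 := hmod ω' h'
    rw [hexp, hexp] at h1 h2
    rw [← hcongr ω ω' hag, ← hcongr ω ω' hag] at h2
    rw [← ZMod.natCast_eq_natCast_iff, ← hval, ← hval]
    push_cast [Nat.cast_sub hlt.le]
    linear_combination h1 - h2

/-- The identifiers that are computed with the random tape `ω`. -/
def randomIdent (w : List (Fin σ)) (ω : Fin T → Fin W) (a p : ℕ) : ℕ :=
  weightSum w W (tapeFun ω) (pk w a (a + p))

-- Equal vectors always get equal identifiers, so only collisions matter. The union bound runs over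
-- all pairs of pairs of end points, whence the exponent `4`.
open Classical in
theorem card_not_faithful_mul_le (hT : w.length ≤ T) :
    (Finset.univ.filter fun ω : Fin T → Fin W => ¬ Faithful w (randomIdent w ω)).card * W ≤
      (w.length + 1) ^ 4 * (w.length * W ^ T) := by
  let I := (Fin (w.length + 1) × Fin (w.length + 1)) × (Fin (w.length + 1) × Fin (w.length + 1))
  let B : I → Finset (Fin T → Fin W) := fun i => if pk w i.1.1 i.1.2 ≠ pk w i.2.1 i.2.2 then
    Finset.univ.filter fun ω : Fin T → Fin W => weightSum w W (tapeFun ω) (pk w i.1.1 i.1.2) =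
      weightSum w W (tapeFun ω) (pk w i.2.1 i.2.2) else ∅
  have hsub : (Finset.univ.filter fun ω : Fin T → Fin W => ¬ Faithful w (randomIdent w ω)) ⊆
      Finset.univ.biUnion B := by
    intro ω hω
    have hω := (Finset.mem_filter.1 hω).2
    unfold Faithful at hω
    push Not at hω
    obtain ⟨a, p, a', p', hp, hp', ha, ha', h⟩ := hω
    have hne : randomIdent w ω a p = randomIdent w ω a' p' ∧
        pk w a (a + p) ≠ pk w a' (a' + p') := by
      rcases h with h | h
      · exact h
      · exact absurd (by rw [randomIdent, randomIdent, h.2]) h.1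
    simp only [Finset.mem_biUnion, Finset.mem_univ, true_and]
    refine ⟨((⟨a, by omega⟩, ⟨a + p, by omega⟩), (⟨a', by omega⟩, ⟨a' + p', by omega⟩)), ?_⟩
    simp only [B]
    rw [if_pos hne.2]
    exact Finset.mem_filter.2 ⟨Finset.mem_univ _, hne.1⟩
  have hB : ∀ i, (B i).card * W ≤ w.length * W ^ T := by
    intro i
    simp only [B]
    split_ifs with h
    · exact card_collision_mul_le hT (by omega) (by omega) h
    · simp
  calc _ ≤ (∑ i, (B i).card) * W :=
        Nat.mul_le_mul_right W ((Finset.card_le_card hsub).trans Finset.card_biUnion_le)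
    _ = ∑ i, (B i).card * W := Finset.sum_mul _ _ _
    _ ≤ ∑ _i : I, w.length * W ^ T := Finset.sum_le_sum fun i _ => hB i
    _ = _ := by
      rw [Finset.sum_const, smul_eq_mul]
      congr 1
      simp only [I, Finset.card_univ, Fintype.card_prod, Fintype.card_fin]
      ring

theorem pow_lt_wordCount {K : ℕ} (hK : 0 < K) (n σ : ℕ) : (n + σ) ^ K < wordCount K n σ := by
  unfold wordCount
  rw [mul_comm, pow_mul]
  exact Nat.pow_lt_pow_left (Nat.lt_size_self _) hK.ne'

theorem wide_of_pow_le {n σ W : ℕ} (hn : 0 < n) (hσ : 0 < σ) (h : (n + σ) ^ 5 ≤ W) :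
    Wide n σ W := by
  have h2 : 2 ≤ n + σ := by omega
  have h3 : 8 ≤ (n + σ) ^ 3 := Nat.pow_le_pow_left h2 3
  have h5 : (n + σ) ^ 2 * 8 ≤ W := by
    calc _ ≤ (n + σ) ^ 2 * (n + σ) ^ 3 := Nat.mul_le_mul_left _ h3
      _ = (n + σ) ^ 5 := by ring
      _ ≤ W := h
  exact ⟨hn, by nlinarith, by nlinarith, by nlinarith, by nlinarith⟩

theorem length_pos_and_alphabet_pos {w : List (Fin σ)} (hw : w ≠ []) : 0 < w.length ∧ 0 < σ := by
  obtain ⟨a, l, rfl⟩ := List.exists_cons_of_ne_nil hw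
  exact ⟨by simp, lt_of_le_of_lt (Nat.zero_le _) a.2⟩

theorem runsProg_random (hW : Wide w.length σ W) (hT : w.length ≤ T) (ω : Fin T → Fin W) :
    WP W (runsProg randomProg) (fun s τ => τ ≤ 200 * w.length ^ 2 + 3000 * w.length ^ 2 ∧
      (Faithful w (randomIdent w ω) → ListsAllAbelianRuns w s.out)) (inputState w (tapeOf ω)) 0 := by
  refine (runsProg_spec hW (N := 200 * w.length ^ 2) (q := fun ident => ident = randomIdent w ω)
    fun τ₀ s₀ h₀ hz ht => ?_).mono ?_
  · refine (randomProg_spec hW h₀ (hz 12 (by omega)) (tapeFun ω) fun k hk => ?_).mono ?_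
    · rw [ht]
      exact drop_tapeOf ω (by omega)
    · rintro s τ ⟨h1, h2, h3, h4⟩
      exact ⟨h1, h2, h3, _, rfl, h4⟩
  · rintro s τ ⟨h1, ident, rfl, h2⟩
    exact ⟨h1, h2⟩

/-- With `W > (n + σ) ^ (c + 5)`, five of the factors absorb the bound `(n + 1) ^ 4 * n` for the
collisions (as `1 ≤ σ`), and the other `c` factors give the error probability. The time is `200` for
the weights and `3000` for the rest, times `n ^ 2`. -/
theorem randomizedSolves (c : ℕ) {w : List (Fin σ)} (hw : w ≠ []) :
    RandomizedSolves (runsProg randomProg) (c + 5) (3200 * w.length ^ 2)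
      (1 - 1 / ((w.length : ℝ) + (σ : ℝ)) ^ c) w := by
  classical
  obtain ⟨hn, hσ⟩ := length_pos_and_alphabet_pos hw
  have hlt := pow_lt_wordCount (K := c + 5) (by omega) w.length σ
  have hpow : (w.length + σ) ^ 5 ≤ (w.length + σ) ^ (c + 5) :=
    Nat.pow_le_pow_right (by omega) (by omega)
  have hW : Wide w.length σ (wordCount (c + 5) w.length σ) :=
    wide_of_pow_le hn hσ (hpow.trans hlt.le)
  have hT : w.length ≤ 3200 * w.length ^ 2 := by nlinarith
  unfold RandomizedSolves
  generalize wordCount (c + 5) w.length σ = W at hlt hW ⊢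
  generalize hTdef : 3200 * w.length ^ 2 = T at hT ⊢
  have hrun := fun ω : Fin T → Fin W => runsProg_random hW hT ω
  refine ⟨fun ω => ?_, ?_⟩
  · obtain ⟨t, s', h1, h2, -⟩ := hrun ω
    exact ⟨t, s', h1, by omega⟩
  have hbad := card_not_faithful_mul_le (W := W) hT
  have hWpos : 0 < W := by omega
  have hall : (Finset.univ.filter fun ω : Fin T → Fin W => Faithful w (randomIdent w ω)).card +
      (Finset.univ.filter fun ω : Fin T → Fin W => ¬ Faithful w (randomIdent w ω)).card =
      W ^ T := by
    rw [Finset.card_filter_add_card_filter_not, Finset.card_univ]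
    simp
  have hgood : (Finset.univ.filter fun ω : Fin T → Fin W => Faithful w (randomIdent w ω)).card ≤
      Nat.card {ω : Fin T → Fin W // ∃ t s', Exec W (runsProg randomProg)
        (inputState w (tapeOf ω)) t s' ∧ ListsAllAbelianRuns w s'.out} := by
    rw [Nat.card_eq_fintype_card, Fintype.card_subtype]
    refine Finset.card_le_card fun ω hω => ?_
    have hω := (Finset.mem_filter.1 hω).2
    obtain ⟨t, s', h1, -, h3⟩ := hrun ω
    exact Finset.mem_filter.2 ⟨Finset.mem_univ _, t, s', h1, h3 hω⟩
  have hcard : Nat.card (Fin T → Fin W) = W ^ T := by simp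
  unfold tapeProb
  rw [hcard]
  generalize Nat.card {ω : Fin T → Fin W // ∃ t s', Exec W (runsProg randomProg)
        (inputState w (tapeOf ω)) t s' ∧ ListsAllAbelianRuns w s'.out} = g at hgood ⊢
  generalize (Finset.univ.filter fun ω : Fin T → Fin W =>
    ¬ Faithful w (randomIdent w ω)).card = b at hbad hall
  generalize (Finset.univ.filter fun ω : Fin T → Fin W =>
    Faithful w (randomIdent w ω)).card = f at hall hgood
  have hV : 0 < W ^ T := Nat.pow_pos hWpos
  have hmain : b * (w.length + σ) ^ c ≤ W ^ T := by
    have h1 : (w.length + 1) ^ 4 * w.length ≤ (w.length + σ) ^ 5 := by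
      calc _ ≤ (w.length + σ) ^ 4 * (w.length + σ) :=
            Nat.mul_le_mul (Nat.pow_le_pow_left (by omega) 4) (by omega)
        _ = _ := by ring
    refine Nat.le_of_mul_le_mul_right ?_ hWpos
    calc b * (w.length + σ) ^ c * W = b * W * (w.length + σ) ^ c := by ring
      _ ≤ (w.length + 1) ^ 4 * (w.length * W ^ T) * (w.length + σ) ^ c :=
          Nat.mul_le_mul_right _ hbad
      _ = (w.length + 1) ^ 4 * w.length * (w.length + σ) ^ c * W ^ T := by ring
      _ ≤ (w.length + σ) ^ 5 * (w.length + σ) ^ c * W ^ T :=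
          Nat.mul_le_mul_right _ (Nat.mul_le_mul_right _ h1)
      _ = (w.length + σ) ^ (c + 5) * W ^ T := by ring
      _ ≤ W * W ^ T := Nat.mul_le_mul_right _ hlt.le
      _ = W ^ T * W := mul_comm _ _
  have hVr : (0 : ℝ) < (W : ℝ) ^ T := by exact_mod_cast hV
  have hmr : (0 : ℝ) < ((w.length : ℝ) + (σ : ℝ)) ^ c := by positivity
  have h1 : (b : ℝ) * ((w.length : ℝ) + (σ : ℝ)) ^ c ≤ (W : ℝ) ^ T := by exact_mod_cast hmain
  have h2 : (W : ℝ) ^ T - b ≤ g := by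
    have : W ^ T ≤ g + b := by omega
    have : (W : ℝ) ^ T ≤ g + b := by exact_mod_cast this
    linarith
  push_cast
  rw [le_div_iff₀ hVr, sub_mul, one_mul, div_mul_eq_mul_div, one_mul]
  have h3 : (b : ℝ) ≤ (W : ℝ) ^ T / ((w.length : ℝ) + (σ : ℝ)) ^ c := by
    rwa [le_div_iff₀ hmr]
  linarith

end Probability

/-! ### Trees of names for Parikh vectors. -/

section Naming

variable {σ : ℕ}

/-- The name of the node `v` of the tree `t` comes from the names of its children by the
table `tab`, and it is `0` if and only if these are. -/
def NodeOk (tab : ℕ → ℕ → ℕ) (t : ℕ → ℕ) (v : ℕ) : Prop :=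
  (t v = 0 ∧ t (2 * v) = 0 ∧ t (2 * v + 1) = 0) ∨
  (t v ≠ 0 ∧ t v = tab (t (2 * v)) (t (2 * v + 1)) ∧ (t (2 * v) ≠ 0 ∨ t (2 * v + 1) ≠ 0))

/-- `t` is a tree of names for the vector `c`, in which the names of the proper ancestors of
the node `x` may be wrong. The leaves are `B, …, 2 * B - 1`, and all names are below `M`. -/
structure TreeOk (B M : ℕ) (tab : ℕ → ℕ → ℕ) (t : ℕ → ℕ) (c : Fin σ → ℕ) (x : ℕ) : Prop where
  leaf : ∀ b : Fin σ, t (B + b) = c b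
  rest : ∀ b < B, σ ≤ b → t (B + b) = 0
  lt : ∀ v < 2 * B, t v < M
  node : ∀ v, 0 < v → v < B → (∀ k, 0 < k → v ≠ x / 2 ^ k) → NodeOk tab t v

/-- The entries of the table `tab` that are not `0` are different from each other, and they are at
most `cnt`. -/
structure TabOk (M : ℕ) (tab : ℕ → ℕ → ℕ) (cnt : ℕ) : Prop where
  le : ∀ l < M, ∀ r < M, tab l r ≤ cnt
  inj : ∀ l < M, ∀ r < M, ∀ l' < M, ∀ r' < M, tab l r ≠ 0 → tab l r = tab l' r' → l = l' ∧ r = r'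

/-- The table `tab'` has all entries of `tab`, and maybe more. -/
def Extends (M : ℕ) (tab tab' : ℕ → ℕ → ℕ) : Prop :=
  ∀ l < M, ∀ r < M, tab l r ≠ 0 → tab' l r = tab l r

variable {B M : ℕ} {tab tab' : ℕ → ℕ → ℕ} {t t' : ℕ → ℕ} {c c' : Fin σ → ℕ} {x cnt : ℕ}

theorem Extends.trans {tab'' : ℕ → ℕ → ℕ} (h : Extends M tab tab') (h' : Extends M tab' tab'') :
    Extends M tab tab'' := fun l hl r hr h0 => by
  have h1 := h l hl r hr h0
  rw [h' l hl r hr (by rwa [h1]), h1]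

/-- Entries of the table, once assigned, never change, so trees that were named earlier stay valid
as the table grows. -/
theorem NodeOk.extend {v : ℕ} (h : NodeOk tab t v) (he : Extends M tab tab')
    (hl : t (2 * v) < M) (hr : t (2 * v + 1) < M) : NodeOk tab' t v := by
  rcases h with h | ⟨h1, h2, h3⟩
  · exact Or.inl h
  · exact Or.inr ⟨h1, by rw [he _ hl _ hr (by rwa [← h2]), ← h2], h3⟩

theorem TreeOk.extend (h : TreeOk B M tab t c x) (he : Extends M tab tab') :
    TreeOk B M tab' t c x :=
  ⟨h.leaf, h.rest, h.lt, fun v h0 hv hk =>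
    (h.node v h0 hv hk).extend he (h.lt _ (by omega)) (h.lt _ (by omega))⟩

/-- The new name exceeds all names in use, so it is different from them. -/
theorem TabOk.insert {l₀ r₀ : ℕ} (h : TabOk M tab cnt) (hl : l₀ < M) (hr : r₀ < M)
    (h0 : tab l₀ r₀ = 0)
    (h' : ∀ l < M, ∀ r < M, tab' l r = if l = l₀ ∧ r = r₀ then cnt + 1 else tab l r) :
    TabOk M tab' (cnt + 1) ∧ Extends M tab tab' := by
  refine ⟨⟨fun l hl r hr => ?_, fun l hl r hr l' hl' r' hr' hne heq => ?_⟩,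
    fun l hl r hr hne => ?_⟩
  · rw [h' l hl r hr]
    have := h.le l hl r hr
    split_ifs <;> omega
  · rw [h' l hl r hr] at hne heq
    rw [h' l' hl' r' hr'] at heq
    have h1 := h.le l hl r hr
    have h2 := h.le l' hl' r' hr'
    split_ifs at hne heq with g1 g2
    · omega
    · omega
    · omega
    · exact h.inj l hl r hr l' hl' r' hr' hne heq
  · rw [h' l hl r hr, if_neg]
    rintro ⟨rfl, rfl⟩
    exact hne h0

/-- After the parent of `x` has been renamed, only the proper ancestors of that parent can still be
wrong. Its name is not `0` because that of its child `x` is not. -/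
theorem TreeOk.step {N : ℕ} (h : TreeOk B M tab t c x) (hσ : σ ≤ B) (he : Extends M tab tab')
    (hx : 2 ≤ x) (hxB : x < 2 * B) (hpos : t x ≠ 0)
    (hN : tab' (t (2 * (x / 2))) (t (2 * (x / 2) + 1)) = N) (hN0 : N ≠ 0) (hNM : N < M)
    (ht : ∀ v < 2 * B, t' v = if v = x / 2 then N else t v) : TreeOk B M tab' t' c (x / 2) := by
  refine ⟨fun b => ?_, fun b hb hs => ?_, fun v hv => ?_, fun v h0 hv hk => ?_⟩
  · have := b.2
    rw [ht _ (by omega), if_neg (by omega), h.leaf]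
  · rw [ht _ (by omega), if_neg (by omega), h.rest b hb hs]
  · rw [ht _ hv]
    split_ifs
    · exact hNM
    · exact h.lt v hv
  · have h1 := hk 1 (by omega)
    rw [pow_one] at h1
    by_cases hvy : v = x / 2
    · right
      rw [ht v (by omega), if_pos hvy, ht (2 * v) (by omega), if_neg (by omega),
        ht (2 * v + 1) (by omega), if_neg (by omega), hvy]
      refine ⟨hN0, hN.symm, ?_⟩
      rcases (show 2 * (x / 2) = x ∨ 2 * (x / 2) + 1 = x by omega) with h2 | h2
      · exact Or.inl (by rwa [h2])
      · exact Or.inr (by rwa [h2])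
    · unfold NodeOk
      rw [ht v (by omega), if_neg hvy, ht (2 * v) (by omega), if_neg (by omega),
        ht (2 * v + 1) (by omega), if_neg (by omega)]
      refine (h.node v h0 hv fun k hk0 hvk => ?_).extend he (h.lt _ (by omega)) (h.lt _ (by omega))
      rcases (show k = 1 ∨ 0 < k - 1 by omega) with hk1 | hk1
      · rw [hk1, pow_one] at hvk
        exact hvy hvk
      · refine hk (k - 1) hk1 ?_
        rw [hvk, Nat.div_div_eq_div_mul, ← pow_succ', Nat.sub_add_cancel hk0]

/-- Equality of names propagates from the root to the leaves: a name `0` forces both children to be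
`0`, and any other name determines the pair of children by the injectivity of the table. -/
theorem TreeOk.eq_of_root_eq (h : TreeOk B M tab t c 1) (h' : TreeOk B M tab t' c' 1)
    (hσ : σ ≤ B) (htab : TabOk M tab cnt) (hroot : t 1 = t' 1) : c = c' := by
  -- The node `1` has no proper ancestors with positive index, so every inner node is correct.
  have hone : ∀ v, 0 < v → ∀ k, 0 < k → v ≠ 1 / 2 ^ k := fun v hv k hk => by
    rw [Nat.div_eq_of_lt (Nat.one_lt_two_pow hk.ne')]; omega
  have key : ∀ v, 0 < v → v < 2 * B → t v = t' v := by
    intro v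
    induction v using Nat.strong_induction_on with
    | _ v ih =>
      intro h0 hv
      rcases (show v = 1 ∨ 2 ≤ v by omega) with rfl | h2
      · exact hroot
      have hu := ih (v / 2) (by omega) (by omega) (by omega)
      have hchild : t (2 * (v / 2)) = t' (2 * (v / 2)) ∧
          t (2 * (v / 2) + 1) = t' (2 * (v / 2) + 1) := by
        rcases h.node (v / 2) (by omega) (by omega) (hone _ (by omega)) with
          ⟨a1, a2, a3⟩ | ⟨a1, a2, a3⟩ <;>
        rcases h'.node (v / 2) (by omega) (by omega) (hone _ (by omega)) with
          ⟨b1, b2, b3⟩ | ⟨b1, b2, b3⟩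
        · exact ⟨by rw [a2, b2], by rw [a3, b3]⟩
        · omega
        · omega
        · exact htab.inj _ (h.lt _ (by omega)) _ (h.lt _ (by omega)) _ (h'.lt _ (by omega)) _
            (h'.lt _ (by omega)) (by rwa [← a2]) (by rw [← a2, ← b2, hu])
      rcases (show 2 * (v / 2) = v ∨ 2 * (v / 2) + 1 = v by omega) with h3 | h3
      · have := hchild.1; rwa [h3] at this
      · have := hchild.2; rwa [h3] at this
  funext b
  have := b.2
  rw [← h.leaf, ← h'.leaf, key _ (by omega) (by omega)]

/-- Equality propagates from the leaves to the root, since the name of a node is a function of the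
names of its children. -/
theorem TreeOk.root_eq (h : TreeOk B M tab t c 1) (h' : TreeOk B M tab t' c 1) (hB : 0 < B) :
    t 1 = t' 1 := by
  have hone : ∀ v, 0 < v → ∀ k, 0 < k → v ≠ 1 / 2 ^ k := fun v hv k hk => by
    rw [Nat.div_eq_of_lt (Nat.one_lt_two_pow hk.ne')]; omega
  have key : ∀ d v, 2 * B - v = d → 0 < v → v < 2 * B → t v = t' v := by
    intro d
    induction d using Nat.strong_induction_on with
    | _ d ih =>
      intro v hd h0 hv
      rcases lt_or_ge v B with hvB | hvB
      · have e1 := ih _ (by omega) (2 * v) rfl (by omega) (by omega)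
        have e2 := ih _ (by omega) (2 * v + 1) rfl (by omega) (by omega)
        rcases h.node v h0 hvB (hone v h0) with ⟨a1, a2, a3⟩ | ⟨a1, a2, a3⟩ <;>
        rcases h'.node v h0 hvB (hone v h0) with ⟨b1, b2, b3⟩ | ⟨b1, b2, b3⟩
        · rw [a1, b1]
        · omega
        · omega
        · rw [a2, b2, e1, e2]
      · obtain ⟨b, rfl⟩ := Nat.exists_eq_add_of_le hvB
        by_cases hb : b < σ
        · exact (h.leaf ⟨b, hb⟩).trans (h'.leaf ⟨b, hb⟩).symm
        · rw [h.rest b (by omega) (by omega), h'.rest b (by omega) (by omega)]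
  exact key _ 1 rfl one_pos (by omega)

/-- `v` is the name of the vector `c`. -/
def Named (B M : ℕ) (tab : ℕ → ℕ → ℕ) (c : Fin σ → ℕ) (v : ℕ) : Prop :=
  ∃ t, TreeOk B M tab t c 1 ∧ t 1 = v

end Naming

/-! ### The program for names, and the renaming of one node. -/

section Deterministic

variable {σ : ℕ} {w : List (Fin σ)} {W : ℕ}

/-- The index of the cell for the node `e` of the tree of the row in register `10`. -/
def nodeCell (e : RExpr) : RExpr := cellE (.reg 22) (.reg 10) e

/-- The index of the cell for the names of the children of the node in register `12`. -/
def pairCell : RExpr :=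
  cellE (.reg 21) (.read 12 (nodeCell (times (.const 2) (.reg 12))))
    (.read 12 (nodeCell (plus (times (.const 2) (.reg 12)) (.const 1))))

/-- Go to the parent of the node in register `12`, and compute its name. -/
def upStep : Cmd :=
  block [
    .assign 12 (.op .div (.reg 12) (.const 2)),
    .branch (.read 13 pairCell) .skip
      (block [.assign 23 (plus (.reg 23) (.const 1)), .store 13 pairCell (.reg 23)]),
    .store 12 (nodeCell (.reg 12)) (.read 13 pairCell)]

/-- Add one letter to the vector of the fragment, update the tree, and store the name of the
vector. -/
def letterStep : Cmd :=
  block [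
    .assign 12 (plus (.reg 20) (.read 0 (plus (.reg 10) (.reg 11)))),
    .store 12 (nodeCell (.reg 12)) (plus (.read 12 (nodeCell (.reg 12))) (.const 1)),
    .loop (less (.const 1) (.reg 12)) upStep,
    .assign 11 (plus (.reg 11) (.const 1)),
    .store 8 (cellE (.reg 2) (.reg 10) (.reg 11)) (.read 12 (nodeCell (.const 1)))]

/-- Compute names of the Parikh vectors of all fragments that start at the position in the
register `10`. -/
def rowProg : Cmd :=
  block [
    .assign 11 (.const 0),
    .loop (less (plus (.reg 10) (.reg 11)) (.reg 0)) letterStep,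
    .assign 10 (plus (.reg 10) (.const 1))]

/-- Compute names of the Parikh vectors of all fragments. -/
def namingProg : Cmd :=
  block [
    .assign 20 (.const 1),
    .loop (less (.reg 20) (.reg 1)) (.assign 20 (times (.const 2) (.reg 20))),
    .assign 21 (plus (times (times (.reg 0) (.reg 0)) (.reg 1)) (.const 1)),
    .assign 22 (times (.const 2) (.reg 20)),
    .assign 23 (.const 0),
    .assign 10 (.const 0),
    .loop (less (.reg 10) (.reg 0)) rowProg]

/-- The tree of the row `a`. -/
def rowOf (B a : ℕ) (s : State) (v : ℕ) : ℕ := s.arr 12 (cell (2 * B) a v)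

/-- The table of names. -/
def tabOf (M : ℕ) (s : State) (l r : ℕ) : ℕ := s.arr 13 (cell M l r)

/-- The registers of the naming program. -/
structure NamingRegs (B M a p cnt : ℕ) (s : State) : Prop where
  r10 : s.reg 10 = a
  r11 : s.reg 11 = p
  r20 : s.reg 20 = B
  r21 : s.reg 21 = M
  r22 : s.reg 22 = 2 * B
  r23 : s.reg 23 = cnt

/-- The invariant of the update of the tree of the row `a`, at the node `x`. -/
structure UpInv (B M : ℕ) (s₀ : State) (a p : ℕ) (c : Fin σ → ℕ) (x cnt : ℕ) (s : State) :
    Prop where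
  frame : Frame [12, 13] s₀ s
  out : s.out = s₀.out
  regs : NamingRegs B M a p cnt s
  r12 : s.reg 12 = x
  rows : ∀ a' ≠ a, ∀ v < 2 * B, rowOf B a' s v = rowOf B a' s₀ v
  ext : Extends M (tabOf M s₀) (tabOf M s)
  tree : TreeOk B M (tabOf M s) (rowOf B a s) c x
  tab : TabOk M (tabOf M s) cnt
  ne_zero : rowOf B a s x ≠ 0
  pos : 0 < x
  lt : x < 2 * B

/-- The words of a machine with `W` words suffice for the indices of the trees and of the table. -/
structure NamingWide (σ n B M W : ℕ) : Prop where
  le : σ ≤ B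
  two : 2 < W
  tree : n * (2 * B) ≤ W
  tab : M * M ≤ W
  one : 0 < n

/-- Either the pair of children has a name already, or it gets the next number; so a step adds at
most one name. -/
theorem upStep_spec {n B M a p x cnt τ : ℕ} (hN : NamingWide σ n B M W) {s₀ s : State}
    {c : Fin σ → ℕ} (ha : a < n) (hcnt : cnt + 1 < M) (hx : 2 ≤ x)
    (h : UpInv B M s₀ a p c x cnt s) :
    WP W upStep (fun s' τ' => τ' ≤ τ + 100 ∧ ∃ cnt' ≤ cnt + 1,
      UpInv B M s₀ a p c (x / 2) cnt' s') s τ := by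
  have htwo := hN.two
  have hB := h.lt
  have htab := hN.tab
  have hMM : M ≤ M * M := Nat.le_mul_self M
  have hnode : ∀ {v}, v < 2 * B → cell (2 * B) a v < W := fun hv =>
    lt_of_lt_of_le (cell_lt ha hv) hN.tree
  have hvW : ∀ {v}, v < 2 * B → v < W := fun hv =>
    lt_of_lt_of_le hv ((Nat.le_mul_of_pos_left _ hN.one).trans hN.tree)
  rw [upStep, wp_block_cons, wp_assign, show (RExpr.op .div (.reg 12) (.const 2)).eval W s = x / 2 by
    simp only [RExpr.eval, BinOp.eval, h.r12]; rw [Nat.mod_eq_of_lt htwo]]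
  obtain ⟨y, hy⟩ : ∃ y, x / 2 = y := ⟨_, rfl⟩
  have hl := h.tree.lt (2 * y) (by omega)
  have hr := h.tree.lt (2 * y + 1) (by omega)
  set l := rowOf B a s (2 * y) with hldef
  set r := rowOf B a s (2 * y + 1) with hrdef
  rw [hy]
  -- The index of the pair is evaluated anew after each change of the state; the names of the
  -- children stay the same, since array `12` is not written before the last store.
  have hpair : ∀ s' : State, NamingRegs B M a p (s'.reg 23) s' → s'.reg 12 = y →
      s'.arr 12 = s.arr 12 → pairCell.eval W s' = cell M l r := by
    intro s' h1 h2 h3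
    have e2 : (times (.const 2) (.reg 12)).eval W s' = 2 * y :=
      eval_times (eval_const htwo) (eval_reg h2) (hvW (by omega))
    refine eval_cellE (eval_reg h1.r21) ?_ ?_ (lt_of_lt_of_le (cell_lt hl hr) htab)
    · rw [RExpr.eval, nodeCell, eval_cellE (eval_reg h1.r22) (eval_reg h1.r10) e2
        (hnode (by omega)), h3]
      rfl
    · rw [RExpr.eval, nodeCell, eval_cellE (eval_reg h1.r22) (eval_reg h1.r10)
        (eval_plus e2 (eval_const (by omega)) (hvW (by omega))) (hnode (by omega)), h3]
      rfl
  have hfin : ∀ {s' : State} {τ' cnt' : ℕ}, cnt' ≤ cnt + 1 → τ' ≤ τ + 60 → Frame [12, 13] s₀ s' →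
      s'.out = s₀.out → NamingRegs B M a p cnt' s' → s'.reg 12 = y → s'.arr 12 = s.arr 12 →
      TabOk M (tabOf M s') cnt' → Extends M (tabOf M s) (tabOf M s') → tabOf M s' l r ≠ 0 →
      WP W (block [.store 12 (nodeCell (.reg 12)) (.read 13 pairCell)]) (fun s' τ' => τ' ≤ τ + 100 ∧
        ∃ cnt' ≤ cnt + 1, UpInv B M s₀ a p c y cnt' s') s' τ' := by
    intro s' τ' cnt' hc' hτ' hf ho hregs h12 harr htok hext hne
    rw [wp_block_cons, wp_store, wp_block_nil, nodeCell, eval_cellE (eval_reg hregs.r22)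
      (eval_reg hregs.r10) (eval_reg h12) (hnode (by omega)), RExpr.eval,
      hpair s' (by rw [hregs.r23]; exact hregs) h12 harr]
    have hle := htok.le l hl r hr
    have hrow : ∀ a' v, v < 2 * B → rowOf B a' (s'.setArr 12 (cell (2 * B) a y)
        (s'.arr 13 (cell M l r))) v = if a' = a ∧ v = y then tabOf M s' l r else rowOf B a' s v := by
      intro a' v hv
      unfold rowOf
      simp only [setArr_arr, true_and, cell_inj hv (show y < 2 * B by omega), harr]
      rfl
    have htabeq : tabOf M (s'.setArr 12 (cell (2 * B) a y) (s'.arr 13 (cell M l r))) =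
      tabOf M s' := by
      funext l' r'
      simp [tabOf]
    refine ⟨by simp only [RExpr.cost, cost_cellE, pairCell, nodeCell]; omega, cnt', hc',
      hf.setArr (by simp) _ _, ho, ⟨hregs.r10, hregs.r11, hregs.r20, hregs.r21, hregs.r22, hregs.r23⟩,
      h12, ?_, ?_, ?_, ?_, ?_, by omega, by omega⟩
    · intro a' ha' v hv
      rw [hrow a' v hv, if_neg (by tauto), h.rows a' ha' v hv]
    · rw [htabeq]; exact h.ext.trans hext
    · rw [htabeq]
      have := h.tree.step (N := tabOf M s' l r) (t' := rowOf B a (s'.setArr 12 (cell (2 * B) a y)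
        (s'.arr 13 (cell M l r)))) hN.le hext hx h.lt h.ne_zero (by rw [hy]) hne (by omega)
        fun v hv => by rw [hrow a v hv, hy]; simp
      rwa [hy] at this
    · rw [htabeq]; exact htok
    · rw [hrow a y (by omega), if_pos ⟨rfl, rfl⟩]; exact hne
  set s₁ := s.setReg 12 y with hs₁
  have hregs₁ : NamingRegs B M a p cnt s₁ := by
    obtain ⟨g1, g2, g3, g4, g5, g6⟩ := h.regs
    constructor <;> simpa [hs₁]
  have hp₁ : pairCell.eval W s₁ = cell M l r :=
    hpair s₁ (by rw [hregs₁.r23]; exact hregs₁) (by simp [hs₁]) rfl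
  have hg : (RExpr.read 13 pairCell).eval W s₁ = tabOf M s l r := by
    rw [RExpr.eval, hp₁]; rfl
  rw [wp_block_cons, wp_branch, hg]
  split_ifs with g1
  · rw [wp_skip]
    refine hfin (Nat.le_succ _) ?_ (h.frame.setReg (by omega) _) h.out hregs₁ (by simp [hs₁]) rfl
      h.tab (fun _ _ _ _ _ => rfl) g1
    simp only [RExpr.cost, cost_cellE, pairCell, nodeCell]; omega
  · have g0 : tabOf M s l r = 0 := by simpa using g1
    simp only [wp_block_cons (c := Cmd.assign _ _), wp_assign]
    rw [eval_plus (eval_reg hregs₁.r23) (eval_const (by omega)) (by omega)]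
    set s₂ := s₁.setReg 23 (cnt + 1) with hs₂
    have hregs₂ : NamingRegs B M a p (cnt + 1) s₂ := by
      obtain ⟨g1, g2, g3, g4, g5, g6⟩ := hregs₁
      constructor <;> simp [hs₂] <;> assumption
    simp only [wp_block_cons (c := Cmd.store 13 _ _), wp_store, wp_block_nil]
    rw [hpair s₂ (by rw [hregs₂.r23]; exact hregs₂) (by simp [hs₂, hs₁]) rfl,
      eval_reg hregs₂.r23]
    have hins := h.tab.insert (tab' := tabOf M (s₂.setArr 13 (cell M l r) (cnt + 1))) hl hr g0 ?_
    · refine hfin le_rfl ?_ ?_ h.out ?_ (by simp [hs₂, hs₁]) (by funext k; simp [hs₂, hs₁]) hins.1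
        hins.2 (by simp [tabOf])
      · simp only [RExpr.cost, cost_cellE, pairCell, nodeCell]; omega
      · exact ((h.frame.setReg (by omega) _).setReg (by omega) _).setArr (by simp) _ _
      · exact ⟨hregs₂.r10, hregs₂.r11, hregs₂.r20, hregs₂.r21, hregs₂.r22, hregs₂.r23⟩
    · intro l' hl' r' hr'
      simp only [tabOf, setArr_arr, true_and, cell_inj hr' hr]
      rfl

end Deterministic

/-! ### Incrementing a leaf, and the tree of the zero vector. -/

section Naming

variable {σ : ℕ} {B M : ℕ} {tab : ℕ → ℕ → ℕ} {t t' : ℕ → ℕ} {c c' : Fin σ → ℕ}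

/-- Only one leaf changes, and only its parent depends on it directly, which is among the proper
ancestors that are exempt. -/
theorem TreeOk.increment (h : TreeOk B M tab t c 1) (hσ : σ ≤ B) (b : Fin σ)
    (hc : ∀ b', c' b' = if b' = b then c b + 1 else c b') (hM : c b + 1 < M)
    (ht : ∀ v < 2 * B, t' v = if v = B + b then c b + 1 else t v) :
    TreeOk B M tab t' c' (B + b) := by
  have hb := b.2
  refine ⟨fun b' => ?_, fun b' hb' hs => ?_, fun v hv => ?_, fun v h0 hv hk => ?_⟩
  · have := b'.2
    rw [ht _ (by omega), hc, ← h.leaf b']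
    simp only [Nat.add_left_cancel_iff, Fin.val_inj]
  · rw [ht _ (by omega), if_neg (by omega), h.rest b' hb' hs]
  · rw [ht _ hv]
    split_ifs
    · exact hM
    · exact h.lt v hv
  · have h1 := hk 1 (by omega)
    rw [pow_one] at h1
    unfold NodeOk
    rw [ht v (by omega), if_neg (by omega), ht (2 * v) (by omega), if_neg (by omega),
      ht (2 * v + 1) (by omega), if_neg (by omega)]
    refine h.node v h0 hv fun k hk0 => ?_
    rw [Nat.div_eq_of_lt (Nat.one_lt_two_pow hk0.ne')]
    omega

/-- Since the name `0` is reserved for zero subtrees, untouched memory is a valid tree for any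
table. So each row gets its tree without initialization, which would take time proportional to `σ`.
-/
theorem TreeOk.zero (hσ : σ ≤ B) (hM : 0 < M) (hc : ∀ b, c b = 0) (ht : ∀ v < 2 * B, t v = 0) :
    TreeOk B M tab t c 1 :=
  ⟨fun b => by rw [hc, ht _ (by have := b.2; omega)], fun b hb _ => ht _ (by omega),
    fun v hv => by rw [ht v hv]; exact hM, fun v h0 hv _ =>
      Or.inl ⟨ht _ (by omega), ht _ (by omega), ht _ (by omega)⟩⟩

theorem Named.extend {v : ℕ} (h : Named B M tab c v) {tab' : ℕ → ℕ → ℕ} (he : Extends M tab tab') :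
    Named B M tab' c v := by
  obtain ⟨t, h1, h2⟩ := h
  exact ⟨t, h1.extend he, h2⟩

end Naming

/-! ### Appending a letter to a fragment. -/

section Deterministic

variable {σ : ℕ} {w : List (Fin σ)} {W : ℕ}

/-- The state of the naming program: `cnt` names have been given to pairs, the tree of the row `a`
is the tree of the vector `c`, and the later rows are empty. -/
structure NamingInv (n B M a p cnt : ℕ) (c : Fin σ → ℕ) (s : State) : Prop where
  regs : NamingRegs B M a p cnt s
  tree : TreeOk B M (tabOf M s) (rowOf B a s) c 1
  tab : TabOk M (tabOf M s) cnt
  rows : ∀ a' > a, ∀ v < 2 * B, rowOf B a' s v = 0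

theorem letterStep_spec (hW : Wide w.length σ W) {B M a p cnt d τ : ℕ}
    (hN : NamingWide σ w.length B M W) {s : State} (hs : Holds w 0 s) (hB : B = 2 ^ d)
    (hM : w.length < M) (hcnt : cnt + d < M) (hap : a + p < w.length)
    (h : NamingInv w.length B M a p cnt (pk w a (a + p)) s) :
    WP W letterStep (fun s' τ' => τ' ≤ τ + 200 * (d + 1) ∧ Frame [8, 12, 13] s s' ∧ s'.out = s.out ∧
      ∃ cnt' ≤ cnt + d, NamingInv w.length B M a (p + 1) cnt' (pk w a (a + p + 1)) s' ∧
        Extends M (tabOf M s) (tabOf M s') ∧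
        ∀ l, s'.arr 8 l = if l = cell (w.length + 1) a (p + 1) then rowOf B a s' 1 else s.arr 8 l)
      s τ := by
  have hlin := hW.lin
  obtain ⟨r10, r11, r20, r21, r22, r23⟩ := h.regs
  obtain ⟨b, hb⟩ : ∃ b, w[a + p] = b := ⟨_, rfl⟩
  have hbσ := b.2
  have hσB := hN.le
  have hnode : ∀ {v}, v < 2 * B → cell (2 * B) a v < W := fun hv =>
    lt_of_lt_of_le (cell_lt (show a < w.length by omega) hv) hN.tree
  have hvW : ∀ {v}, v < 2 * B → v < W := fun hv =>
    lt_of_lt_of_le hv ((Nat.le_mul_of_pos_left _ hN.one).trans hN.tree)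
  have hleaf : (plus (.reg 20) (.read 0 (plus (.reg 10) (.reg 11)))).eval W s = B + b := by
    refine eval_plus (eval_reg r20) ?_ (hvW (by omega))
    rw [RExpr.eval, eval_plus (eval_reg r10) (eval_reg r11) (by omega), hs.letter _ hap, hb]
  have hpk : pk w a (a + p) b ≤ p := by
    have h1 := norm_pk w (i := a) (j := a + p) (by omega)
    have h2 := Finset.single_le_sum (f := pk w a (a + p)) (fun _ _ => Nat.zero_le _)
      (Finset.mem_univ b)
    unfold norm at h1
    omega
  rw [letterStep, wp_block_cons, wp_assign, hleaf, wp_block_cons, wp_store]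
  set s₁ := s.setReg 12 (B + b) with hs₁
  have hcell : (nodeCell (.reg 12)).eval W s₁ = cell (2 * B) a (B + b) :=
    eval_cellE (eval_reg (by simpa [hs₁] using r22)) (eval_reg (by simpa [hs₁] using r10))
      (eval_reg (by simp [hs₁])) (hnode (by omega))
  have hval : (plus (.read 12 (nodeCell (.reg 12))) (.const 1)).eval W s₁ =
      pk w a (a + p) b + 1 := by
    refine eval_plus ?_ (eval_const (by omega)) (by omega)
    rw [RExpr.eval, hcell, ← h.tree.leaf b]
    rfl
  rw [hcell, hval, wp_block_cons]
  set s₂ := s₁.setArr 12 (cell (2 * B) a (B + b)) (pk w a (a + p) b + 1) with hs₂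
  have hrow : ∀ a' v, v < 2 * B → rowOf B a' s₂ v =
      if a' = a ∧ v = B + b then pk w a (a + p) b + 1 else rowOf B a' s v := by
    intro a' v hv
    unfold rowOf
    rw [hs₂]
    simp only [setArr_arr, true_and, cell_inj hv (show B + (b : ℕ) < 2 * B by omega)]
    rfl
  have htab : tabOf M s₂ = tabOf M s := by
    funext l r
    simp [tabOf, hs₂, hs₁]
  have hframe : Frame [12, 13] s s₂ := ((Frame.refl _ _).setReg (by omega) _).setArr (by simp) _ _
  have hinit : UpInv B M s₂ a p (pk w a (a + p + 1)) (B + b) cnt s₂ := by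
    refine ⟨Frame.refl _ _, rfl, ?_, by simp [hs₂, hs₁], fun _ _ _ _ => rfl, fun _ _ _ _ _ => rfl,
      ?_, ?_, ?_, by omega, by omega⟩
    · constructor <;> simpa [hs₂, hs₁]
    · rw [htab]
      refine h.tree.increment hN.le b (fun b' => ?_) (by omega) fun v hv => ?_
      · rw [pk_succ_apply w (by omega) hap, hb]
        by_cases hbb : b' = b
        · simp [hbb]
        · simp [hbb, Ne.symm hbb]
      · rw [hrow a v hv]; simp
    · rw [htab]; exact h.tab
    · rw [hrow a _ (by omega), if_pos ⟨rfl, rfl⟩]; omega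
  -- `i` counts the levels done and `j` bounds those that remain above `x`. Each level adds at most
  -- one name and takes at most `120` units of time.
  refine wp_loop (fun s' τ' => ∃ x j i cnt', i + j = d ∧ x < 2 ^ (j + 1) ∧ cnt' ≤ cnt + i ∧
      τ' ≤ τ + 40 + i * 120 ∧ UpInv B M s₂ a p (pk w a (a + p + 1)) x cnt' s')
    (fun s' => s'.reg 12) ?_ ?_ ?_
  · refine ⟨B + b, d, 0, cnt, by omega, by rw [pow_succ, ← hB]; omega, by omega, ?_, hinit⟩
    simp only [RExpr.cost, cost_cellE, nodeCell]; omega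
  · rintro s' τ' ⟨x, j, i, cnt', hij, hx, hc', hτ', hU⟩ hc
    rw [eval_less_ne_zero, eval_const (by omega), eval_reg hU.r12] at hc
    have hj : 0 < j := by
      by_contra hj
      obtain rfl : j = 0 := by omega
      simp at hx
      omega
    refine (upStep_spec hN (n := w.length) (by omega) (by omega) (by omega) hU).mono ?_
    rintro s'' τ'' ⟨hτ'', cnt'', hc'', hU''⟩
    refine ⟨⟨x / 2, j - 1, i + 1, cnt'', by omega, ?_, by omega, ?_, hU''⟩, ?_⟩
    · rw [Nat.sub_add_cancel hj]
      rw [pow_succ] at hx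
      omega
    · simp only [RExpr.cost] at hτ''; omega
    · rw [hU''.r12, hU.r12]; omega
  · rintro s' τ' ⟨x, j, i, cnt', hij, hx, hc', hτ', hU⟩ hc
    rw [← not_ne_iff, eval_less_ne_zero, eval_const (by omega), eval_reg hU.r12] at hc
    have hx0 := hU.pos
    obtain rfl : x = 1 := by omega
    obtain ⟨g10, g11, g20, g21, g22, g23⟩ := hU.regs
    have hH := (hs.frame hframe (by simp)).frame hU.frame (by simp)
    rw [wp_block_cons, wp_assign, eval_plus (eval_reg g11) (eval_const (by omega)) (by omega),
      wp_block_cons, wp_store, wp_block_nil]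
    set s₃ := s'.setReg 11 (p + 1) with hs₃
    have hcell₃ : (cellE (.reg 2) (.reg 10) (.reg 11)).eval W s₃ =
        cell (w.length + 1) a (p + 1) :=
      eval_cellE (eval_reg (by simpa [hs₃] using hH.succ)) (eval_reg (by simpa [hs₃] using g10))
        (eval_reg (by simp [hs₃])) (hW.cell_sq (by omega) (by omega))
    have hroot : (RExpr.read 12 (nodeCell (.const 1))).eval W s₃ = rowOf B a s' 1 := by
      rw [RExpr.eval, nodeCell, eval_cellE (eval_reg (x := 22) (by simpa [hs₃] using g22))
        (eval_reg (x := 10) (by simpa [hs₃] using g10)) (eval_const (by omega)) (hnode (by omega))]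
      rfl
    rw [hcell₃, hroot]
    set s₄ := s₃.setArr 8 (cell (w.length + 1) a (p + 1)) (rowOf B a s' 1) with hs₄
    have hrow₄ : ∀ a', rowOf B a' s₄ = rowOf B a' s' := by
      intro a'; funext v; simp [rowOf, hs₄, hs₃]
    have htab₄ : tabOf M s₄ = tabOf M s' := by
      funext l r; simp [tabOf, hs₄, hs₃]
    have hsub : ∀ {u u' : State}, Frame [12, 13] u u' → Frame [8, 12, 13] u u' := fun hf =>
      ⟨hf.reg, fun k hk => hf.arr k fun h => hk (List.mem_cons_of_mem _ h)⟩
    refine ⟨?_, ?_, hU.out, cnt', by omega, ⟨?_, ?_, ?_, ?_⟩, ?_, ?_⟩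
    · have : i * 120 ≤ d * 120 := Nat.mul_le_mul_right _ (by omega)
      simp only [RExpr.cost, cost_cellE, nodeCell]; omega
    · exact (((hsub hframe).trans (hsub hU.frame)).setReg (by omega) _).setArr (by simp) _ _
    · constructor <;> simp [hs₄, hs₃] <;> assumption
    · rw [htab₄, hrow₄]; exact hU.tree
    · rw [htab₄]; exact hU.tab
    · intro a' ha' v hv
      rw [hrow₄, hU.rows a' (by omega) v hv, hrow a' v hv, if_neg (by omega), h.rows a' ha' v hv]
    · rw [htab₄, ← htab]; exact hU.ext
    · intro l
      rw [hrow₄, hs₄]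
      have h8 : s'.arr 8 = s.arr 8 := by rw [hU.frame.arr 8 (by simp), hframe.arr 8 (by simp)]
      simp only [setArr_arr, true_and, hs₃, setReg_arr, h8]

end Deterministic

/-! ### Names of all fragments, and the deterministic bound. -/

section Deterministic

variable {σ : ℕ} {w : List (Fin σ)} {W : ℕ}

/-- The state of the naming program before the row `a`. -/
structure RowInv (w : List (Fin σ)) (B M a cnt : ℕ) (s₀ s : State) : Prop where
  frame : Frame [8, 12, 13] s₀ s
  out : s.out = s₀.out
  r10 : s.reg 10 = a
  r20 : s.reg 20 = B
  r21 : s.reg 21 = M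
  r22 : s.reg 22 = 2 * B
  r23 : s.reg 23 = cnt
  tab : TabOk M (tabOf M s) cnt
  rows : ∀ a' ≥ a, ∀ v < 2 * B, rowOf B a' s v = 0
  named : ∀ a' < a, ∀ p, 0 < p → a' + p ≤ w.length →
    Named B M (tabOf M s) (pk w a' (a' + p)) (s.arr 8 (cell (w.length + 1) a' p))

/-- The names of earlier fragments stay valid because the table is only extended; hence the names in
all rows refer to the same final table. -/
theorem rowProg_spec (hW : Wide w.length σ W) {B M a cnt d τ : ℕ}
    (hN : NamingWide σ w.length B M W) {s₀ s : State} (h₀ : Holds w 0 s₀) (hB : B = 2 ^ d)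
    (hM : w.length < M) (hcnt : cnt + w.length * d < M) (ha : a < w.length)
    (h : RowInv w B M a cnt s₀ s) :
    WP W rowProg (fun s' τ' => τ' ≤ τ + w.length * (200 * (d + 1) + 20) + 40 ∧
      ∃ cnt' ≤ cnt + w.length * d, RowInv w B M (a + 1) cnt' s₀ s') s τ := by
  have hlin := hW.lin
  obtain ⟨hf, ho, r10, r20, r21, r22, r23, htab, hrows, hnamed⟩ := h
  rw [rowProg, wp_block_cons, wp_assign, eval_const (by omega), wp_block_cons]
  refine wp_loop (fun s' τ' => ∃ p cnt', a + p ≤ w.length ∧ cnt' ≤ cnt + p * d ∧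
      τ' ≤ τ + 5 + p * (200 * (d + 1) + 10) ∧ Frame [8, 12, 13] s₀ s' ∧ s'.out = s₀.out ∧
      NamingInv w.length B M a p cnt' (pk w a (a + p)) s' ∧
      ∀ a' p', (a' < a ∨ a' = a ∧ p' ≤ p) → 0 < p' → a' + p' ≤ w.length →
        Named B M (tabOf M s') (pk w a' (a' + p')) (s'.arr 8 (cell (w.length + 1) a' p')))
    (fun s' => w.length - s'.reg 11) ?_ ?_ ?_
  · refine ⟨0, cnt, by omega, by omega, by simp [RExpr.cost], hf.setReg (by omega) _, ho,
      ⟨?_, ?_, htab, fun a' ha' => hrows a' (by omega)⟩, fun a' p' h1 h2 h3 => ?_⟩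
    · constructor <;> simp <;> assumption
    · exact TreeOk.zero hN.le (by omega) (fun b => by simp [pk_self]) (hrows a le_rfl)
    · exact hnamed a' (by omega) p' h2 h3
  · rintro s₁ τ₁ ⟨p, cnt₁, hap, hc₁, t₁, f₁, o₁, inv, nm⟩ hc
    have H₁ := h₀.frame f₁ (by simp)
    have hsum : (plus (.reg 10) (.reg 11)).eval W s₁ = a + p :=
      eval_plus (eval_reg inv.regs.r10) (eval_reg inv.regs.r11) (by omega)
    rw [eval_less_ne_zero, hsum, eval_reg H₁.len] at hc
    have hpd : p * d + d ≤ w.length * d := by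
      rw [← Nat.succ_mul]; exact Nat.mul_le_mul_right _ (by omega)
    refine (letterStep_spec hW hN H₁ hB hM (by omega) hc inv).mono ?_
    rintro s₂ τ₂ ⟨t₂, f₂, o₂, cnt₂, hc₂, inv₂, ext, h8⟩
    refine ⟨⟨p + 1, cnt₂, by omega, by rw [Nat.succ_mul]; omega, ?_, f₁.trans f₂, by rw [o₂, o₁],
      inv₂, fun a' p' h1 h2 h3 => ?_⟩, ?_⟩
    · rw [Nat.succ_mul]
      simp only [RExpr.cost] at t₂
      omega
    · rw [h8]
      simp only [cell_inj (show p' < w.length + 1 by omega) (show p + 1 < w.length + 1 by omega)]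
      split_ifs with hcell
      · rw [hcell.1, hcell.2]
        exact ⟨_, inv₂.tree, rfl⟩
      · exact (nm a' p' (by omega) h2 h3).extend ext
    · rw [inv.regs.r11, inv₂.regs.r11]
      omega
  · rintro s₁ τ₁ ⟨p, cnt₁, hap, hc₁, t₁, f₁, o₁, inv, nm⟩ hc
    have H₁ := h₀.frame f₁ (by simp)
    have hsum : (plus (.reg 10) (.reg 11)).eval W s₁ = a + p :=
      eval_plus (eval_reg inv.regs.r10) (eval_reg inv.regs.r11) (by omega)
    rw [← not_ne_iff, eval_less_ne_zero, hsum, eval_reg H₁.len] at hc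
    have hpd : p * d ≤ w.length * d := Nat.mul_le_mul_right _ (by omega)
    have hpt : p * (200 * (d + 1) + 10) ≤ w.length * (200 * (d + 1) + 10) :=
      Nat.mul_le_mul_right _ (by omega)
    obtain ⟨g10, g11, g20, g21, g22, g23⟩ := inv.regs
    rw [wp_block_cons, wp_assign, wp_block_nil,
      eval_plus (eval_reg g10) (eval_const (by omega)) (by omega)]
    refine ⟨?_, cnt₁, by omega, f₁.setReg (by omega) _, o₁, by simp, by simpa, by simpa, by simpa,
      by simpa, inv.tab, fun a' ha' => inv.rows a' (by omega), fun a' ha' p' h2 h3 =>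
        nm a' p' (by omega) h2 h3⟩
    simp only [RExpr.cost]
    have : w.length * (200 * (d + 1) + 20) = w.length * (200 * (d + 1) + 10) + w.length * 10 := by
      ring
    omega

theorem faithful_of_named {B M cnt : ℕ} {tab : ℕ → ℕ → ℕ} (hB : 0 < B) (hσ : σ ≤ B)
    (htab : TabOk M tab cnt) {ident : ℕ → ℕ → ℕ} (h : ∀ a p, 0 < p → a + p ≤ w.length →
      Named B M tab (pk w a (a + p)) (ident a p)) : Faithful w ident := by
  intro a p a' p' hp hp' hap hap'
  obtain ⟨t, h1, h2⟩ := h a p hp hap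
  obtain ⟨t', h1', h2'⟩ := h a' p' hp' hap'
  refine ⟨fun he => h1.eq_of_root_eq h1' hσ htab (by rw [h2, h2', he]), fun he => ?_⟩
  rw [← he] at h1'
  rw [← h2, ← h2', h1.root_eq h1' hB]

/-- At most `n * n` letters are appended, each with at most `k ≤ σ` new names, where `B = 2 ^ k`. So
`M = n * n * σ + 1` exceeds all names, and it also exceeds the counts at the leaves. The table needs
indices up to `M * M ≤ (n + σ) ^ 6`, so words below `(n + σ) ^ 8` suffice. -/
theorem namingProg_spec (hW : Wide w.length σ W) (hσ : 0 < σ)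
    (hbig : (w.length + σ) ^ 8 ≤ W) {s₀ : State} (h₀ : Holds w 0 s₀)
    (h12 : ∀ l, s₀.arr 12 l = 0) (h13 : ∀ l, s₀.arr 13 l = 0) {τ₀ : ℕ} :
    WP W namingProg (fun s τ => τ ≤ τ₀ + 1000 * w.length ^ 2 * (1 + Nat.log 2 σ) ∧
      Frame [8, 12, 13] s₀ s ∧ s.out = s₀.out ∧ ∃ ident, Faithful w ident ∧
        ∀ a p, 0 < p → a + p ≤ w.length → s.arr 8 (cell (w.length + 1) a p) = ident a p)
      s₀ τ₀ := by
  have hpos := hW.pos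
  have hlin := hW.lin
  obtain ⟨n, hn⟩ : ∃ n, w.length = n := ⟨_, rfl⟩
  rw [hn] at hpos hbig
  have h3 : 4 * σ + n * n * σ + 1 ≤ (n + σ) ^ 3 := by
    nlinarith [Nat.zero_le (n * n * n), Nat.zero_le (σ * σ * σ), Nat.mul_le_mul hpos hσ,
      Nat.mul_le_mul (Nat.mul_le_mul hpos hpos) hσ, Nat.mul_le_mul (Nat.mul_le_mul hpos hσ) hσ]
  have hs : 2 ≤ n + σ := by omega
  have h8 : 2 * (n + σ) ^ 3 ≤ W := by
    refine le_trans ?_ hbig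
    rw [show (n + σ) ^ 8 = (n + σ) ^ 5 * (n + σ) ^ 3 by ring]
    refine Nat.mul_le_mul_right _ (hs.trans (Nat.le_self_pow (by norm_num) _))
  have h6 : (n * n * σ + 1) * (n * n * σ + 1) ≤ W := by
    refine le_trans ?_ hbig
    calc _ ≤ (n + σ) ^ 3 * (n + σ) ^ 3 := Nat.mul_le_mul (by omega) (by omega)
      _ = (n + σ) ^ 6 := by ring
      _ ≤ _ := Nat.pow_le_pow_right (by omega) (by norm_num)
  have h4 : n * (4 * σ) ≤ W := by
    refine le_trans ?_ hbig
    calc n * (4 * σ) ≤ (n + σ) ^ 2 := by nlinarith [sq_nonneg ((n : ℤ) - σ), two_mul_le_add_sq n σ]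
      _ ≤ _ := Nat.pow_le_pow_right (by omega) (by norm_num)
  rw [namingProg, wp_block_cons, wp_assign, eval_const (by omega), wp_block_cons]
  -- The last power below `σ` yields both `k ≤ 1 + Nat.log 2 σ`, for the time, and `B ≤ 2 * σ`, for
  -- the indices of the trees.
  refine wp_loop (fun s τ => ∃ k, (k = 0 ∨ 2 ^ (k - 1) < σ) ∧ Frame [8, 12, 13] s₀ s ∧
      s.out = s₀.out ∧ τ ≤ τ₀ + 5 + k * 10 ∧ s.reg 20 = 2 ^ k ∧ s.arr = s₀.arr)
    (fun s => σ - s.reg 20) ?_ ?_ ?_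
  · exact ⟨0, Or.inl rfl, (Frame.refl _ _).setReg (by omega) _, rfl, by simp [RExpr.cost], by simp,
      rfl⟩
  · rintro s τ ⟨k, hk, hf, ho, hτ, r20, harr⟩ hc
    have hH := h₀.frame hf (by simp)
    rw [eval_less_ne_zero, eval_reg r20, eval_reg hH.alph] at hc
    rw [wp_assign, eval_times (eval_const (by omega)) (eval_reg r20) (by omega)]
    have := Nat.pow_pos (n := k) (show 0 < 2 by norm_num)
    refine ⟨⟨k + 1, Or.inr (by simpa), hf.setReg (by omega) _, ho, ?_, ?_, harr⟩, ?_⟩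
    · simp only [RExpr.cost]; omega
    · simp [pow_succ, mul_comm]
    · simp only [setReg_reg, if_true, r20]; omega
  · rintro s τ ⟨k, hk, hf, ho, hτ, r20, harr⟩ hc
    have hH := h₀.frame hf (by simp)
    rw [← not_ne_iff, eval_less_ne_zero, eval_reg r20, eval_reg hH.alph] at hc
    obtain ⟨B, hB⟩ : ∃ B, B = 2 ^ k := ⟨_, rfl⟩
    obtain ⟨M, hM⟩ : ∃ M, M = n * n * σ + 1 := ⟨_, rfl⟩
    rw [← hB] at r20 hc
    have hk' : k ≤ 1 + Nat.log 2 σ ∧ k ≤ σ ∧ B ≤ 2 * σ := by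
      rcases hk with rfl | hk
      · rw [pow_zero] at hB
        omega
      · rcases Nat.eq_zero_or_pos k with rfl | hk0
        · rw [pow_zero] at hB
          omega
        · have h1 := Nat.le_log_of_pow_le (by norm_num) hk.le
          have h2 : k - 1 < 2 ^ (k - 1) := Nat.lt_two_pow_self
          have h3 : B = 2 ^ (k - 1) * 2 := by rw [hB, ← pow_succ, Nat.sub_add_cancel hk0]
          omega
    obtain ⟨hk1, hk2, hBσ⟩ := hk'
    have hnn : n ≤ n * n * σ := by
      rw [mul_assoc]
      exact Nat.le_mul_of_pos_right _ (Nat.mul_pos hpos hσ)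
    have hnn2 : n * n ≤ n * n * σ := Nat.le_mul_of_pos_right _ hσ
    have hN : NamingWide σ w.length B M W := by
      rw [hn]
      exact ⟨by omega, by omega, le_trans (Nat.mul_le_mul_left _ (by omega)) h4, by rw [hM]; exact h6,
        hpos⟩
    have hnnk : n * (n * k) < M := by
      rw [hM, mul_assoc]
      exact Nat.lt_succ_of_le (Nat.mul_le_mul_left _ (Nat.mul_le_mul_left _ hk2))
    rw [hn] at hlin
    simp only [wp_block_cons (c := Cmd.assign _ _), wp_assign]
    rw [eval_plus (x := n * n * σ) (eval_times (eval_times (eval_reg (hH.len.trans hn))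
      (eval_reg (hH.len.trans hn)) (by omega)) (eval_reg hH.alph) (by omega)) (eval_const (by omega))
      (by omega), ← hM, eval_times (y := B) (eval_const (by omega)) (eval_reg (by simpa using r20))
      (by omega), eval_const (by omega), eval_const (by omega)]
    rw [wp_block_cons]
    refine wp_loop (fun s' τ' => ∃ a cnt, a ≤ n ∧ cnt ≤ a * (n * k) ∧
        τ' ≤ τ + 30 + a * (n * (200 * (k + 1) + 20) + 50) ∧ RowInv w B M a cnt s₀ s')
      (fun s => n - s.reg 10) ?_ ?_ ?_
    · refine ⟨0, 0, by omega, by omega, ?_, ?_, ho, by simp, by simpa using r20, by simp, by simp,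
        by simp, ?_, ?_, by simp⟩
      · simp [RExpr.cost]
      · exact ((((hf.setReg (by omega) _).setReg (by omega) _).setReg (by omega) _).setReg
          (by omega) _)
      · have hz : tabOf M (((((s.setReg 21 M).setReg 22 (2 * B)).setReg 23 0).setReg 10 0)) =
            fun _ _ => 0 := by
          funext l r; simp [tabOf, harr, h13]
        rw [hz]
        exact ⟨fun _ _ _ _ => le_rfl, fun _ _ _ _ _ _ _ _ h => absurd rfl h⟩
      · intro a' _ v _
        simp [rowOf, harr, h12]
    · rintro s₁ τ₁ ⟨a, cnt, ha, hcnt, t₁, inv⟩ hc₁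
      have H₁ := h₀.frame inv.frame (by simp)
      rw [eval_less_ne_zero, eval_reg inv.r10, eval_reg (H₁.len.trans hn)] at hc₁
      have hank : a * (n * k) + n * k ≤ n * (n * k) := by
        rw [← Nat.succ_mul]; exact Nat.mul_le_mul_right _ hc₁
      refine (rowProg_spec hW hN h₀ hB (by omega) (by rw [hn]; omega) (by omega) inv).mono ?_
      rintro s₂ τ₂ ⟨t₂, cnt₂, hcnt₂, inv₂⟩
      rw [hn] at t₂ hcnt₂
      refine ⟨⟨a + 1, cnt₂, by omega, by rw [Nat.succ_mul]; omega, ?_, inv₂⟩, ?_⟩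
      · rw [Nat.succ_mul]
        simp only [RExpr.cost] at t₂
        omega
      · rw [inv.r10, inv₂.r10]; omega
    · rintro s₁ τ₁ ⟨a, cnt, ha, hcnt, t₁, inv⟩ hc₁
      have H₁ := h₀.frame inv.frame (by simp)
      rw [← not_ne_iff, eval_less_ne_zero, eval_reg inv.r10, eval_reg (H₁.len.trans hn)] at hc₁
      obtain rfl : a = n := by omega
      rw [wp_block_nil]
      refine ⟨?_, inv.frame, inv.out, _, ?_, fun a p _ _ => rfl⟩
      · rw [hn]
        obtain ⟨L, hL⟩ : ∃ L, L = 1 + Nat.log 2 σ := ⟨_, rfl⟩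
        rw [← hL] at hk1 ⊢
        have hL1 : 1 ≤ L := by omega
        -- As `k ≤ L` and `1 ≤ L`, the bound `200 * k + 270` for one letter, with its share of the
        -- overhead of the row, is at most `470 * L`.
        have e1 : a * (a * (200 * (k + 1) + 20) + 50) ≤ a * (a * (470 * L)) := by
          refine Nat.mul_le_mul_left _ ?_
          calc a * (200 * (k + 1) + 20) + 50 ≤ a * (200 * (k + 1) + 20) + a * 50 := by omega
            _ = a * (200 * (k + 1) + 70) := by ring
            _ ≤ a * (470 * L) := Nat.mul_le_mul_left _ (by omega)
        have e2 : a * (a * (470 * L)) = 470 * (a ^ 2 * L) := by ring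
        have e3 : L ≤ a ^ 2 * L := Nat.le_mul_of_pos_left _ (Nat.pow_pos hpos)
        rw [show 1000 * a ^ 2 * L = 1000 * (a ^ 2 * L) by ring]
        simp only [RExpr.cost] at t₁ ⊢
        omega
      · exact faithful_of_named (by omega) hN.le inv.tab fun a p hp hap =>
          inv.named a (by omega) p hp hap

theorem runsProg_namingProg_isDeterministic : (runsProg namingProg).IsDeterministic := by
  simp [runsProg, namingProg, tablesProg, reverseProg, tailProg, tailStep, reportProg, recStep,
    emitStep, rowProg, letterStep, upStep, block,
    Cmd.IsDeterministic]

theorem deterministicSolves {w : List (Fin σ)} (hw : w ≠ []) :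
    DeterministicSolves (runsProg namingProg) 8 (4000 * w.length ^ 2 * (1 + Nat.log 2 σ)) w := by
  obtain ⟨hn, hσ⟩ := length_pos_and_alphabet_pos hw
  have hlt := pow_lt_wordCount (K := 8) (by omega) w.length σ
  have hW : Wide w.length σ (wordCount 8 w.length σ) :=
    wide_of_pow_le hn hσ ((Nat.pow_le_pow_right (by omega) (by omega)).trans hlt.le)
  obtain ⟨t, s', h1, h2, ident, h3, h4⟩ := runsProg_spec hW (idProg := namingProg) (tape := [])
    (q := Faithful w) (N := 1000 * w.length ^ 2 * (1 + Nat.log 2 σ))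
    fun τ₀ s₀ h₀ hz _ => namingProg_spec hW hσ hlt.le h₀ (hz 12 (by omega)) (hz 13 (by omega))
  refine ⟨runsProg_namingProg_isDeterministic, t, s', h1, ?_, h4 h3⟩
  have : 3000 * w.length ^ 2 ≤ 3000 * w.length ^ 2 * (1 + Nat.log 2 σ) :=
    Nat.le_mul_of_pos_right _ (by omega)
  have e : 4000 * w.length ^ 2 * (1 + Nat.log 2 σ) = 1000 * w.length ^ 2 * (1 + Nat.log 2 σ) +
    3000 * w.length ^ 2 * (1 + Nat.log 2 σ) := by ring
  omega

end Deterministic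

end AbelianRuns

theorem mainTheorem4 :
    (∀ c : ℕ, ∃ (prog : AbelianRuns.Cmd) (K C : ℕ), 0 < K ∧
      ∀ (σ : ℕ) (w : List (Fin σ)), w ≠ [] →
        AbelianRuns.RandomizedSolves prog K (C * w.length ^ 2)
          (1 - 1 / ((w.length : ℝ) + (σ : ℝ)) ^ c) w) ∧
    (∃ (prog : AbelianRuns.Cmd) (K C : ℕ), 0 < K ∧
      ∀ (σ : ℕ) (w : List (Fin σ)), w ≠ [] →
        AbelianRuns.DeterministicSolves prog K (C * w.length ^ 2 * (1 + Nat.log 2 σ)) w) :=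
  ⟨fun c => ⟨AbelianRuns.runsProg AbelianRuns.randomProg, c + 5, 3200, by omega,
      fun _ _ hw => AbelianRuns.randomizedSolves c hw⟩,
    ⟨AbelianRuns.runsProg AbelianRuns.namingProg, 8, 4000, by norm_num,
      fun _ _ hw => AbelianRuns.deterministicSolves hw⟩⟩
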